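/- **Setting.** Let $d\ge 1$ and let $\Lambda$ be a stationary random Borel measure on $\mathbb{R}^d$ (a random element of the space of Borel measures with the evaluation $\sigma$-algebra, whose law is invariant under the shifts $\vartheta_x\mu(A)=\mu(A+x)$) with $\mathbb{E}[\Lambda([0,1]^d)]=1$. Let $\lambda>0$ and let $X^\lambda$ be a Cox point process with intensity measure $\lambda\Lambda$: conditioned on $\Lambda$, $X^\lambda$ is a Poisson point process with intensity measure $\lambda\Lambda$. Put $Q_a=[-a/2,a/2]^d$, let $B_r(o)$ be the Euclidean ball of radius $r$ around the origin $o$, and let $|\cdot|$ be Lebesgue measure. The distributions of the Palm versions $\Lambda^*$ and $X^{\lambda,*}$ are defined by $$\mathbb{E}[f(\Lambda^*)]=\mathbb{E}\Big[\int_{Q_1}f(\vartheta_x\Lambda)\,\Lambda(\mathrm{d}x)\Big],\qquad \mathbb{E}[f(X^{\lambda,*})]=\frac1\lambda\,\mathbb{E}\Big[\sum_{X_i\in X^\lambda\cap Q_1}f(X^\lambda-X_i)\Big]$$ for measurable $f\ge 0$. For $r>0$, the Gilbert graph $g_r(X^{\lambda,*})$ has vertex set $X^{\lambda,*}$ and an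 edge between any two distinct points at distance less than $r$, and $$\theta(\lambda,r)=\mathbb{P}\big(o\text{ lies in an infinite connected component of }g_r(X^{\lambda,*})\big).$$ **Theorem.** (i) One has $$\liminf_{r\to\infty}r^{-d}\log(1-\theta(\lambda,r))\;\ge\;\liminf_{r\to\infty}r^{-d}\log\mathbb{E}[\exp(-\lambda\Lambda^*(B_r(o)))].$$ (ii) Suppose in addition that $d\ge 2$, that $\Lambda$ is $b$-dependent for some $b\ge 0$ (the restrictions of $\Lambda$ to Borel sets $A$ and $B$ are independent whenever $\inf\{|x-y|: x\in A,\,y\in B\}>b$), and that $\Lambda(Q_1)$ has all exponential moments ($\mathbb{E}[e^{\alpha\Lambda(Q_1)}]<\infty$ for all $\alpha>0$). Then the limit $$I^*=-\lim_{r\to\infty}r^{-d}\log\mathbb{E}[\exp(-\lambda\Lambda(Q_r))]$$ exists in $\mathbb{R}$, and $$\lim_{r\to\infty}r^{-d}\log(1-\theta(\lambda,r))=-|B_1(o)|\,I^*.$$ -/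

import Mathlib

open MeasureTheory ProbabilityTheory Filter Topology
open scoped ENNReal NNReal

noncomputable section

namespace CoxPercolation

/-- The Euclidean space `ℝ^d`. -/
abbrev E (d : ℕ) : Type := EuclideanSpace ℝ (Fin d)

/-- The closed cube `Q_a = [-a/2, a/2]^d`. -/
def cube (d : ℕ) (a : ℝ) : Set (E d) := {x | ∀ i, -(a / 2) ≤ x i ∧ x i ≤ a / 2}

/-- The cube `[0,1]^d`. -/
def unitCube (d : ℕ) : Set (E d) := {x | ∀ i, 0 ≤ x i ∧ x i ≤ 1}

/-- The shift `ϑ_x μ`, given by `(ϑ_x μ)(A) = μ(A + x)`; for `μ = ∑ δ_{x_i}` this is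
`∑ δ_{x_i - x}`. -/
def shift {d : ℕ} (x : E d) (μ : Measure (E d)) : Measure (E d) := μ.map (fun y => y - x)

section RandomMeasures

variable {Ω : Type*} [MeasurableSpace Ω] {d : ℕ}

/-- A stationary random measure: its law on the space of Borel measures, with the σ-algebra
generated by the evaluations, is invariant under all shifts. -/
structure IsStationaryRandomMeasure (P : Measure Ω) (Λ : Ω → Measure (E d)) : Prop where
  measurable : Measurable Λ
  map_shift : ∀ x : E d, P.map (fun ω => shift x (Λ ω)) = P.map Λ

/-- The distance `inf {|x - y| : x ∈ A, y ∈ B}` of two sets (`∞` if one of them is empty). -/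
def setDist (A B : Set (E d)) : ℝ≥0∞ := ⨅ x ∈ A, ⨅ y ∈ B, edist x y

/-- `b`-dependence: the restrictions of `Λ` to `A` and to `B` are independent whenever
`dist(A, B) > b`. -/
def IsDependent (P : Measure Ω) (Λ : Ω → Measure (E d)) (b : ℝ≥0) : Prop :=
  ∀ A B : Set (E d), MeasurableSet A → MeasurableSet B → (b : ℝ≥0∞) < setDist A B →
    IndepFun (fun ω => (Λ ω).restrict A) (fun ω => (Λ ω).restrict B) P

/-- All exponential moments of a `[0,∞]`-valued random variable are finite. -/
def HasAllExpMoments (P : Measure Ω) (Y : Ω → ℝ≥0∞) : Prop :=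
  ∀ α : ℝ, 0 < α → ∫⁻ ω, EReal.exp ((ENNReal.ofReal α * Y ω : ℝ≥0∞) : EReal) ∂P < ∞

/-- `Q` is the law of a Poisson point process with intensity measure `m`; point configurations
are counting measures. -/
structure IsPoissonLaw (m : Measure (E d)) (Q : Measure (Measure (E d))) : Prop where
  isProbabilityMeasure : IsProbabilityMeasure Q
  map_count : ∀ B : Set (E d), MeasurableSet B → m B ≠ ∞ →
    Q.map (fun ν => ν B) = (poissonMeasure (m B).toNNReal).map (fun n : ℕ => (n : ℝ≥0∞))
  indep_count : ∀ (k : ℕ) (B : Fin k → Set (E d)), (∀ i, MeasurableSet (B i)) →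
    Pairwise (fun i j => Disjoint (B i) (B j)) →
    iIndepFun (fun (i : Fin k) (ν : Measure (E d)) => ν (B i)) Q

/-- `X` is a Cox process with random intensity measure `M`: conditioned on `M`, the point process
`X` is a Poisson point process with intensity measure `M`. The kernel `κ` is a regular version of
the conditional law of `X` given `M`. -/
structure IsCoxProcess (P : Measure Ω) (M X : Ω → Measure (E d)) : Prop where
  measurable : Measurable X
  exists_kernel : ∃ κ : Kernel (Measure (E d)) (Measure (E d)), IsMarkovKernel κ ∧
    P.map (fun ω => (M ω, X ω)) = (P.map M).compProd κ ∧
    ∀ᵐ m ∂(P.map M), IsPoissonLaw m (κ m)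

/-- The expectation `E[f(ξ^*)]` under the Palm version `ξ^*` of a stationary random measure (or
point process) `ξ` of intensity `c`:
`E[f(ξ^*)] = c⁻¹ E[∫_{Q_1} f(ϑ_x ξ) ξ(dx)]`.
For a point process the inner integral is the sum of `f(ξ - X_i)` over the points `X_i` in
`Q_1`. -/
def palmExpectation (P : Measure Ω) (ξ : Ω → Measure (E d)) (c : ℝ≥0∞)
    (f : Measure (E d) → ℝ≥0∞) : ℝ≥0∞ :=
  c⁻¹ * ∫⁻ ω, ∫⁻ x in cube d 1, f (shift x (ξ ω)) ∂(ξ ω) ∂P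

end RandomMeasures

/-- The points of a counting measure. -/
def points {d : ℕ} (ν : Measure (E d)) : Set (E d) := {x | ν {x} ≠ 0}

/-- The Gilbert graph: distinct points are joined if their distance is less than `r`. -/
def gilbertGraph {d : ℕ} (r : ℝ) (V : Set (E d)) : SimpleGraph V where
  Adj x y := x ≠ y ∧ dist (x : E d) (y : E d) < r
  symm := ⟨fun _ _ h => ⟨h.1.symm, by rw [dist_comm]; exact h.2⟩⟩
  loopless := ⟨fun _ h => h.1 rfl⟩

/-- The event that the origin is a point of `ν` and lies in an infinite connected component of
the Gilbert graph on the points of `ν`. -/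
def originPercolates {d : ℕ} (r : ℝ) : Set (Measure (E d)) :=
  {ν | ∃ h : (0 : E d) ∈ points ν,
    ((gilbertGraph r (points ν)).connectedComponentMk ⟨0, h⟩).supp.Infinite}

/-- The percolation probability `θ(λ, r)` of the Palm version of a Cox process `X` of
intensity `λ`. -/
def percolationProbability {Ω : Type*} [MeasurableSpace Ω] {d : ℕ} (P : Measure Ω)
    (X : Ω → Measure (E d)) (lam r : ℝ) : ℝ≥0∞ :=
  palmExpectation P X (ENNReal.ofReal lam) ((originPercolates r).indicator 1)

/-- The functional `μ ↦ exp(-λ μ(B))` (with value `0` if `μ(B) = ∞`). -/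
def expNeg {d : ℕ} (lam : ℝ) (B : Set (E d)) (μ : Measure (E d)) : ℝ≥0∞ :=
  EReal.exp (-((ENNReal.ofReal lam * μ B : ℝ≥0∞) : EReal))

/-- `r^{-d} log p`, with `log 0 = -∞`. -/
def logRate (d : ℕ) (r : ℝ) (p : ℝ≥0∞) : EReal := (((r ^ d)⁻¹ : ℝ) : EReal) * ENNReal.log p

end CoxPercolation

end

/-! Part (i) compares finite clusters with isolated points. If `Q_1` contains exactly one point and
the ball of radius `r + √d` about the origin contains no other, that point has no neighbour.
Averaging the Poisson probabilities over `Λ` and dividing by `λ` yields `1 - θ ≥ E[Λ(Q_1) exp(-λ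
Λ(B_{r+√d}))]` (`lintegral_le_one_sub_percolationProbability`). The Palm void probability of a ball
is bounded by the same kind of expectation for a ball smaller by `√d`, and bounded changes of radius
are invisible at scale `r^d`.

For part (ii), let `ψ(a) = -log E[exp(-λ Λ(Q_a))]`. Cubes separated by corridors of width greater
than `b` are independent, so `ψ` is superadditive up to corridors, while Jensen's inequality gives
`ψ(a) ≤ λ a^d`; a Fekete argument produces the rate `I` (`exists_tendsto_div_pow`).

The lower bound on `1 - θ` requires the void probability of a ball. The ball is tiled by cells of
fixed large side `n`. Emptying the independent cores costs about `I` per unit volume. The corridors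
fill a small fraction of the volume, and their mass exceeds a small multiple of `R^d` only with
negligible probability, thanks to the exponential moments (`voidProb_pow_le`,
`eventually_le_lintegral_expNeg_ball`).

The upper bound is a Peierls argument on cells of side `s = r / ρ` with `ρ` large and fixed. A small
finite cluster occupying the cells `S` forces `(S + D) \ S` to be vacant, where `D` is a discretised
ball of radius `ρ`. By Cauchy-Davenport this set has at least `|D| - 1` cells, which is almost the
volume of the ball of radius `r`, whatever the shape of `S` (`card_le_card_add_sdiff`). A large
finite cluster is surrounded by a long star-connected contour of vacant cells
(`exists_path_outer_boundary`), and the sum over contours is geometric because the void probability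
of one cell tends to zero when `I > 0`. The number of small shapes does not depend on `r`, so it
does not affect the rate. Connectedness of the contour rests on a discrete Poincaré lemma: a
function on star-edges that is closed on triangles is a gradient (`exists_potential`,
`starConnected_boundary`). -/

noncomputable section

namespace CoxPercolation

/-! ### Boxes, lattice cells and their cores -/

section Boxes

variable {d : ℕ}

/-- The closed box with lower corner `c` and side length `a`. -/
def box (c : Fin d → ℝ) (a : ℝ) : Set (E d) := {x | ∀ i, c i ≤ x i ∧ x i ≤ c i + a}

/-- The half-open lattice cell `s z + [0, s)^d`. -/
def cell (s : ℝ) (z : Fin d → ℤ) : Set (E d) := {x | ∀ i, s * z i ≤ x i ∧ x i < s * z i + s}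

/-- The closed core of a lattice cell, at distance `β` from its faces. -/
def core (s β : ℝ) (z : Fin d → ℤ) : Set (E d) := box (fun i => s * z i + β) (s - 2 * β)

/-- The index of the lattice cell containing a point. -/
def cellIndex (s : ℝ) (x : E d) : Fin d → ℤ := fun i => ⌊x i / s⌋

lemma measurableSet_box (c : Fin d → ℝ) (a : ℝ) : MeasurableSet (box c a) := by
  have : box c a = ⋂ i, {x : E d | c i ≤ x i ∧ x i ≤ c i + a} := by
    ext x; simp [box]
  rw [this]
  refine MeasurableSet.iInter fun i => ?_
  have h : Measurable fun x : E d => x i := by fun_prop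
  exact (measurableSet_le measurable_const h).inter (measurableSet_le h measurable_const)

lemma measurableSet_cell (s : ℝ) (z : Fin d → ℤ) : MeasurableSet (cell s z) := by
  have : cell s z = ⋂ i, {x : E d | s * z i ≤ x i ∧ x i < s * z i + s} := by
    ext x; simp [cell]
  rw [this]
  refine MeasurableSet.iInter fun i => ?_
  have h : Measurable fun x : E d => x i := by fun_prop
  exact (measurableSet_le measurable_const h).inter (measurableSet_lt h measurable_const)

lemma measurableSet_core (s β : ℝ) (z : Fin d → ℤ) : MeasurableSet (core s β z) :=
  measurableSet_box _ _

lemma cube_eq_box (a : ℝ) : cube d a = box (fun _ => -(a / 2)) a := by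
  ext x
  refine forall_congr' fun i => ?_
  rw [show -(a / 2) + a = a / 2 by ring]

lemma unitCube_eq_box : unitCube d = box (fun _ => 0) 1 := by
  ext x; simp [unitCube, box]

lemma measurableSet_cube (a : ℝ) : MeasurableSet (cube d a) := by
  rw [cube_eq_box]; exact measurableSet_box _ _

lemma volume_preimage_toLp (A : Set (E d)) (hA : MeasurableSet A) :
    volume A = volume ((fun f : Fin d → ℝ => (WithLp.toLp 2 f : E d)) ⁻¹' A) :=
  ((EuclideanSpace.volume_preserving_symm_measurableEquiv_toLp (Fin d)).symm.measure_preimage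
    hA.nullMeasurableSet).symm

lemma volume_cell {s : ℝ} (z : Fin d → ℤ) :
    volume (cell s z) = ENNReal.ofReal s ^ d := by
  rw [volume_preimage_toLp _ (measurableSet_cell s z)]
  have : (fun f : Fin d → ℝ => (WithLp.toLp 2 f : E d)) ⁻¹' (cell s z)
      = Set.univ.pi fun i => Set.Ico (s * z i) (s * z i + s) := by
    ext f; simp [cell, Set.mem_pi]
  rw [this, Real.volume_pi_Ico]
  simp

lemma volume_box (c : Fin d → ℝ) (a : ℝ) :
    volume (box c a) = ENNReal.ofReal a ^ d := by
  rw [volume_preimage_toLp _ (measurableSet_box c a)]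
  have : (fun f : Fin d → ℝ => (WithLp.toLp 2 f : E d)) ⁻¹' (box c a)
      = Set.univ.pi fun i => Set.Icc (c i) (c i + a) := by
    ext f
    simp only [Set.mem_preimage, Set.mem_univ_pi, Set.mem_Icc]
    rfl
  rw [this, volume_pi, Measure.pi_pi]
  simp

lemma mem_cell_iff {s : ℝ} (hs : 0 < s) (z : Fin d → ℤ) (x : E d) :
    x ∈ cell s z ↔ cellIndex s x = z := by
  simp only [cell, cellIndex, Set.mem_ofPred_eq, funext_iff, Int.floor_eq_iff, le_div_iff₀ hs,
    div_lt_iff₀ hs]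
  refine forall_congr' fun i => ?_
  rw [mul_comm s, add_mul, one_mul]

lemma mem_cell_cellIndex {s : ℝ} (hs : 0 < s) (x : E d) : x ∈ cell s (cellIndex s x) :=
  (mem_cell_iff hs _ _).2 rfl

lemma abs_apply_sub_le_dist (x y : E d) (i : Fin d) : |x i - y i| ≤ dist x y := by
  rw [dist_eq_norm, ← Real.norm_eq_abs]
  exact PiLp.norm_apply_le (x - y) i

lemma dist_le_of_forall_abs_le {x y : E d} {a : ℝ} (ha : 0 ≤ a) (h : ∀ i, |x i - y i| ≤ a) :
    dist x y ≤ a * √d := by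
  rw [EuclideanSpace.dist_eq]
  refine Real.sqrt_le_iff.2 ⟨by positivity, ?_⟩
  rw [mul_pow, Real.sq_sqrt (by positivity)]
  calc ∑ i, dist (x i) (y i) ^ 2 ≤ ∑ _i : Fin d, a ^ 2 :=
        Finset.sum_le_sum fun i _ => by
          rw [Real.dist_eq]; exact pow_le_pow_left₀ (abs_nonneg _) (h i) 2
    _ = a ^ 2 * d := by simp [mul_comm]

lemma dist_le_of_mem_cell {s : ℝ} (hs : 0 < s) {z : Fin d → ℤ} {x y : E d} (hx : x ∈ cell s z)
    (hy : y ∈ cell s z) : dist x y ≤ s * √d := by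
  refine dist_le_of_forall_abs_le hs.le fun i => ?_
  have h1 := hx i
  have h2 := hy i
  rw [abs_le]
  constructor <;> linarith

lemma core_subset_cell {s β : ℝ} (hβ : 0 < β) (z : Fin d → ℤ) : core s β z ⊆ cell s z := by
  intro x hx i
  have := hx i
  constructor <;> linarith

/-- Distinct lattice points differ by at least one in some coordinate. -/
lemma exists_add_one_le {z w : Fin d → ℤ} (h : z ≠ w) : ∃ i, z i + 1 ≤ w i ∨ w i + 1 ≤ z i := by
  obtain ⟨i, hi⟩ := Function.ne_iff.1 h
  exact ⟨i, by omega⟩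

lemma ofReal_le_edist_of_coord {x y : E d} {g : ℝ} (i : Fin d) (h : g ≤ |x i - y i|) :
    ENNReal.ofReal g ≤ edist x y := by
  rw [edist_dist]
  exact ENNReal.ofReal_le_ofReal (h.trans (abs_apply_sub_le_dist x y i))

lemma edist_core_core {s β : ℝ} (hs : 0 < s) {z w : Fin d → ℤ} (h : z ≠ w) {x y : E d}
    (hx : x ∈ core s β z) (hy : y ∈ core s β w) : ENNReal.ofReal (2 * β) ≤ edist x y := by
  obtain ⟨i, hi⟩ := exists_add_one_le h
  refine ofReal_le_edist_of_coord i ?_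
  have h1 := hx i
  have h2 := hy i
  rw [le_abs]
  rcases hi with hi | hi
  · have : (z i : ℝ) + 1 ≤ w i := by exact_mod_cast hi
    right; nlinarith
  · have : (w i : ℝ) + 1 ≤ z i := by exact_mod_cast hi
    left; nlinarith

/-- The faces of the cells lie on hyperplanes through multiples of `s`. One of these passes through
the origin, so the first coordinate of a core point has modulus at least `β`, against at most `1/2`
in `Q_1`. This holds even for the cells that meet `Q_1`. -/
lemma edist_cube_core [NeZero d] {s β : ℝ} (hs : 0 < s) {z : Fin d → ℤ} {x y : E d}
    (hx : x ∈ cube d 1) (hy : y ∈ core s β z) : ENNReal.ofReal (β - 1 / 2) ≤ edist x y := by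
  refine ofReal_le_edist_of_coord 0 ?_
  have h1 := hx 0
  have h2 := hy 0
  rw [le_abs]
  rcases le_or_gt 0 (z 0) with hz | hz
  · have : (0 : ℝ) ≤ z 0 := by exact_mod_cast hz
    right; nlinarith
  · have : (z 0 : ℝ) + 1 ≤ 0 := by exact_mod_cast hz
    left; nlinarith

lemma pairwiseDisjoint_cell {s : ℝ} (hs : 0 < s) (F : Set (Fin d → ℤ)) :
    F.PairwiseDisjoint (cell s) := by
  intro z _ w _ h
  rw [Function.onFun, Set.disjoint_left]
  intro x hx hy
  exact h (((mem_cell_iff hs _ _).1 hx).symm.trans ((mem_cell_iff hs _ _).1 hy))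

lemma card_mul_pow_le_volume {s : ℝ} (hs : 0 < s) (F : Finset (Fin d → ℤ)) {A : Set (E d)}
    (h : ∀ z ∈ F, cell s z ⊆ A) : (F.card : ℝ≥0∞) * ENNReal.ofReal s ^ d ≤ volume A := by
  calc (F.card : ℝ≥0∞) * ENNReal.ofReal s ^ d = ∑ z ∈ F, volume (cell s z) := by
        simp [volume_cell]
    _ = volume (⋃ z ∈ F, cell s z) :=
        (measure_biUnion_finset (pairwiseDisjoint_cell hs _)
          fun z _ => measurableSet_cell s z).symm
    _ ≤ volume A := measure_mono (Set.iUnion₂_subset h)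

lemma volume_le_card_mul_pow {s : ℝ} (F : Finset (Fin d → ℤ)) {A : Set (E d)}
    (h : A ⊆ ⋃ z ∈ F, cell s z) : volume A ≤ (F.card : ℝ≥0∞) * ENNReal.ofReal s ^ d := by
  calc volume A ≤ volume (⋃ z ∈ F, cell s z) := measure_mono h
    _ ≤ ∑ z ∈ F, volume (cell s z) := measure_biUnion_finset_le _ _
    _ = (F.card : ℝ≥0∞) * ENNReal.ofReal s ^ d := by simp [volume_cell]

lemma finite_setOf_cell_inter_nonempty {s : ℝ} (hs : 0 < s) {A : Set (E d)}
    (hA : Bornology.IsBounded A) : {z : Fin d → ℤ | (cell s z ∩ A).Nonempty}.Finite := by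
  obtain ⟨R, hR⟩ := hA.subset_closedBall 0
  refine (Set.finite_Icc (fun _ : Fin d => ⌊-R / s⌋) (fun _ => ⌊R / s⌋)).subset ?_
  rintro z ⟨x, hxz, hxA⟩
  rw [mem_cell_iff hs] at hxz
  have hx : ∀ i, |x i| ≤ R := fun i => by
    have h1 := abs_apply_sub_le_dist x 0 i
    have h2 := hR hxA
    simp only [Metric.mem_closedBall] at h2
    simpa using h1.trans h2
  subst hxz
  constructor <;> intro i <;> simp only [cellIndex] <;>
    exact Int.floor_le_floor (div_le_div_of_nonneg_right (by have := abs_le.1 (hx i); linarith) hs.le)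

/-- The lattice cells that meet a bounded set. -/
lemma exists_finset_cell {s : ℝ} (hs : 0 < s) {A : Set (E d)} (hA : Bornology.IsBounded A) :
    ∃ F : Finset (Fin d → ℤ), (∀ z, z ∈ F ↔ (cell s z ∩ A).Nonempty) ∧
      A ⊆ ⋃ z ∈ F, cell s z := by
  refine ⟨(finite_setOf_cell_inter_nonempty hs hA).toFinset, fun z => by simp, fun x hx => ?_⟩
  simp only [Set.Finite.mem_toFinset, Set.mem_ofPred_eq, Set.mem_iUnion]
  exact ⟨cellIndex s x, ⟨x, mem_cell_cellIndex hs x, hx⟩, mem_cell_cellIndex hs x⟩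

lemma isBounded_box (c : Fin d → ℝ) (a : ℝ) : Bornology.IsBounded (box c a) := by
  rw [Metric.isBounded_iff_subset_closedBall (WithLp.toLp 2 c : E d)]
  refine ⟨|a| * √d, fun x hx => ?_⟩
  rw [Metric.mem_closedBall]
  refine dist_le_of_forall_abs_le (abs_nonneg a) fun i => ?_
  have := hx i
  rw [abs_of_nonneg (by simpa using this.1)]
  calc x i - c i ≤ a := by linarith
    _ ≤ |a| := le_abs_self a

lemma isBounded_cube (a : ℝ) : Bornology.IsBounded (cube d a) := by
  rw [cube_eq_box]; exact isBounded_box _ _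

lemma dist_le_of_mem_cube_one {x : E d} (hx : x ∈ cube d 1) : dist x 0 ≤ √d := by
  refine (dist_le_of_forall_abs_le zero_le_one fun i => ?_).trans_eq (one_mul _)
  have := hx i
  rw [abs_le]
  constructor <;> simp <;> linarith

end Boxes

/-! ### Stationarity, intensity and `b`-dependence -/

section Stationary

variable {Ω : Type*} [MeasurableSpace Ω] {d : ℕ} {P : Measure Ω} {Λ : Ω → Measure (E d)}

lemma shift_apply (x : E d) (μ : Measure (E d)) {A : Set (E d)} (hA : MeasurableSet A) :
    shift x μ A = μ ((fun y => y - x) ⁻¹' A) :=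
  Measure.map_apply (by fun_prop) hA

lemma measurable_shift (x : E d) : Measurable (shift x : Measure (E d) → Measure (E d)) :=
  Measure.measurable_map _ (by fun_prop)

lemma measurable_eval {M : Ω → Measure (E d)} (hM : Measurable M) {A : Set (E d)}
    (hA : MeasurableSet A) : Measurable fun ω => M ω A :=
  (Measure.measurable_coe hA).comp hM

lemma IsStationaryRandomMeasure.lintegral_shift (hΛ : IsStationaryRandomMeasure P Λ) (x : E d)
    {G : Measure (E d) → ℝ≥0∞} (hG : Measurable G) :
    ∫⁻ ω, G (shift x (Λ ω)) ∂P = ∫⁻ ω, G (Λ ω) ∂P := by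
  have h := congrArg (fun ρ => ∫⁻ μ, G μ ∂ρ) (hΛ.map_shift x)
  have hm : Measurable fun ω => shift x (Λ ω) := (measurable_shift x).comp hΛ.measurable
  rwa [lintegral_map hG hm, lintegral_map hG hΛ.measurable] at h

lemma IsStationaryRandomMeasure.lintegral_box (hΛ : IsStationaryRandomMeasure P Λ)
    {g : ℝ≥0∞ → ℝ≥0∞} (hg : Measurable g) (c c' : Fin d → ℝ) (a : ℝ) :
    ∫⁻ ω, g (Λ ω (box c a)) ∂P = ∫⁻ ω, g (Λ ω (box c' a)) ∂P := by
  rw [← hΛ.lintegral_shift (WithLp.toLp 2 (c - c') : E d) (G := fun μ => g (μ (box c' a)))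
    (hg.comp (Measure.measurable_coe (measurableSet_box _ _)))]
  refine lintegral_congr fun ω => ?_
  rw [shift_apply _ _ (measurableSet_box _ _)]
  congr 2
  ext x
  refine forall_congr' fun i => ?_
  simp only [PiLp.sub_apply, Pi.sub_apply]
  constructor <;> rintro ⟨h1, h2⟩ <;> constructor <;> linarith

/-- The intensity measure of a stationary random measure with mean one is Lebesgue measure. -/
lemma IsStationaryRandomMeasure.lintegral_apply_eq_volume (hΛ : IsStationaryRandomMeasure P Λ)
    (hmean : ∫⁻ ω, Λ ω (unitCube d) ∂P = 1) {A : Set (E d)} (hA : MeasurableSet A) :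
    ∫⁻ ω, Λ ω A ∂P = volume A := by
  -- The mean measure inherits translation invariance from the law and is locally finite because
  -- unit boxes have mean mass one. Hence it is a multiple of Lebesgue measure, and the unit cube
  -- fixes the factor.
  set μ : Measure (E d) := P.bind Λ with hμ
  have hμA : ∀ {B : Set (E d)}, MeasurableSet B → μ B = ∫⁻ ω, Λ ω B ∂P := fun hB =>
    Measure.bind_apply hB hΛ.measurable.aemeasurable
  have : μ.IsAddLeftInvariant := by
    refine ⟨fun g => Measure.ext fun B hB => ?_⟩
    have hB' : MeasurableSet ((fun x => g + x) ⁻¹' B) := measurable_const_add g hB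
    rw [Measure.map_apply (measurable_const_add g) hB, hμA hB', hμA hB,
      ← hΛ.lintegral_shift (-g) (Measure.measurable_coe hB)]
    refine lintegral_congr fun ω => ?_
    rw [shift_apply _ _ hB]
    congr 1
    ext x
    simp [add_comm]
  have : IsLocallyFiniteMeasure μ := by
    refine ⟨fun x => ?_⟩
    refine ⟨box (fun i => x i - 1 / 2) 1, ?_, ?_⟩
    · refine Filter.mem_of_superset (Metric.ball_mem_nhds x (ε := 1 / 2) (by norm_num)) ?_
      intro y hy i
      have h := (abs_apply_sub_le_dist y x i).trans_lt hy
      have := abs_lt.1 h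
      constructor <;> linarith
    · have h := hΛ.lintegral_box measurable_id (fun i => x i - 1 / 2) (fun _ => 0) 1
      simp only [id_eq] at h
      rw [hμA (measurableSet_box _ _), h, ← unitCube_eq_box, hmean]
      exact ENNReal.one_lt_top
  have key := Measure.isAddLeftInvariant_eq_smul μ (volume : Measure (E d))
  have hone : μ.addHaarScalarFactor (volume : Measure (E d)) = 1 := by
    have h := hμA (B := unitCube d) (by rw [unitCube_eq_box]; exact measurableSet_box _ _)
    rw [hmean, key, Measure.smul_apply, unitCube_eq_box, volume_box] at h
    simpa [ENNReal.smul_def] using h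
  rw [← hμA hA, key, hone, one_smul]

lemma IsStationaryRandomMeasure.ae_apply_lt_top (hΛ : IsStationaryRandomMeasure P Λ)
    (hmean : ∫⁻ ω, Λ ω (unitCube d) ∂P = 1) {A : Set (E d)} (hA : MeasurableSet A)
    (hb : Bornology.IsBounded A) : ∀ᵐ ω ∂P, Λ ω A < ∞ := by
  refine ae_lt_top (measurable_eval hΛ.measurable hA) ?_
  rw [hΛ.lintegral_apply_eq_volume hmean hA]
  exact hb.measure_lt_top.ne

lemma IsStationaryRandomMeasure.lintegral_cube_one (hΛ : IsStationaryRandomMeasure P Λ)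
    (hmean : ∫⁻ ω, Λ ω (unitCube d) ∂P = 1) : ∫⁻ ω, Λ ω (cube d 1) ∂P = 1 := by
  rw [hΛ.lintegral_apply_eq_volume hmean (measurableSet_cube 1), cube_eq_box, volume_box]
  simp

lemma measurable_restrict_measure (A : Set (E d)) (hA : MeasurableSet A) :
    Measurable fun μ : Measure (E d) => μ.restrict A := by
  refine Measure.measurable_of_measurable_coe _ fun s hs => ?_
  simp only [Measure.restrict_apply hs]
  exact Measure.measurable_coe (hs.inter hA)

/-- Functionals of a `b`-dependent random measure on separated sets are uncorrelated. -/
lemma IsDependent.lintegral_mul {b : ℝ≥0} (hdep : IsDependent P Λ b) (hΛ : Measurable Λ)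
    {A B : Set (E d)} (hA : MeasurableSet A) (hB : MeasurableSet B) (hAB : (b : ℝ≥0∞) < setDist A B)
    {f g : Measure (E d) → ℝ≥0∞} (hf : Measurable f) (hg : Measurable g) :
    ∫⁻ ω, f ((Λ ω).restrict A) * g ((Λ ω).restrict B) ∂P
      = (∫⁻ ω, f ((Λ ω).restrict A) ∂P) * ∫⁻ ω, g ((Λ ω).restrict B) ∂P := by
  have h := (hdep A B hA hB hAB).comp hf hg
  exact lintegral_mul_eq_lintegral_mul_lintegral_of_indepFun
    (hf.comp ((measurable_restrict_measure A hA).comp hΛ))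
    (hg.comp ((measurable_restrict_measure B hB).comp hΛ)) h

lemma lt_setDist {b : ℝ≥0} {b' : ℝ≥0∞} (hb : (b : ℝ≥0∞) < b') {A B : Set (E d)}
    (h : ∀ x ∈ A, ∀ y ∈ B, b' ≤ edist x y) : (b : ℝ≥0∞) < setDist A B :=
  hb.trans_le (le_iInf₂ fun x hx => le_iInf₂ fun y hy => h x hx y hy)

/-- A functional of a `b`-dependent random measure on `B` is uncorrelated with products of
functions of the masses of finitely many sets separated from `B`. -/
lemma IsDependent.lintegral_mul_prod_eq {ι : Type*} {b : ℝ≥0} {b' : ℝ≥0∞}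
    (hdep : IsDependent P Λ b) (hΛ : Measurable Λ) (hb : (b : ℝ≥0∞) < b') {B : Set (E d)}
    (hB : MeasurableSet B) {K : ι → Set (E d)} (hK : ∀ z, MeasurableSet (K z))
    {h g : ℝ≥0∞ → ℝ≥0∞} (hh : Measurable h) (hg : Measurable g) (F : Finset ι)
    (hsep : ∀ z ∈ F, ∀ x ∈ B, ∀ y ∈ K z, b' ≤ edist x y) :
    ∫⁻ ω, h (Λ ω B) * ∏ z ∈ F, g (Λ ω (K z)) ∂P
      = (∫⁻ ω, h (Λ ω B) ∂P) * ∫⁻ ω, ∏ z ∈ F, g (Λ ω (K z)) ∂P := by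
  have hmF : MeasurableSet (⋃ w ∈ F, K w) := F.measurableSet_biUnion fun w _ => hK w
  have key := hdep.lintegral_mul hΛ hB hmF
    (lt_setDist hb (by
      intro x hx y hy
      simp only [Set.mem_iUnion] at hy
      obtain ⟨w, hw, hy⟩ := hy
      exact hsep w hw x hx y hy))
    (f := fun μ => h (μ B)) (g := fun μ => ∏ w ∈ F, g (μ (K w)))
    (hh.comp (Measure.measurable_coe hB))
    (Finset.measurable_prod _ fun w _ => hg.comp (Measure.measurable_coe (hK w)))
  have e1 : ∀ ω, (Λ ω).restrict B B = Λ ω B := fun ω => by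
    rw [Measure.restrict_apply hB, Set.inter_self]
  have e2 : ∀ ω, ∏ w ∈ F, g ((Λ ω).restrict (⋃ w ∈ F, K w) (K w)) = ∏ w ∈ F, g (Λ ω (K w)) :=
    fun ω => Finset.prod_congr rfl fun w hw => by
      have : K w ⊆ ⋃ w ∈ F, K w := fun x hx => Set.mem_biUnion hw hx
      rw [Measure.restrict_apply (hK w), Set.inter_eq_left.2 this]
  simpa only [e1, e2] using key

/-- For a `b`-dependent random measure the masses of separated sets behave as independent
variables. -/
lemma IsDependent.lintegral_prod {ι : Type*} {b : ℝ≥0} {b' : ℝ≥0∞} [IsProbabilityMeasure P]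
    (hdep : IsDependent P Λ b) (hΛ : Measurable Λ) (hb : (b : ℝ≥0∞) < b') {K : ι → Set (E d)}
    (hK : ∀ z, MeasurableSet (K z)) {g : ℝ≥0∞ → ℝ≥0∞} (hg : Measurable g) (F : Finset ι)
    (hsep : ∀ z ∈ F, ∀ w ∈ F, z ≠ w → ∀ x ∈ K z, ∀ y ∈ K w, b' ≤ edist x y) :
    ∫⁻ ω, ∏ z ∈ F, g (Λ ω (K z)) ∂P = ∏ z ∈ F, ∫⁻ ω, g (Λ ω (K z)) ∂P := by
  classical
  induction F using Finset.induction_on with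
  | empty => simp
  | insert z F hz ih =>
    simp only [Finset.prod_insert hz]
    rw [hdep.lintegral_mul_prod_eq hΛ hb (hK z) hK hg hg F
        (fun w hw => hsep z (Finset.mem_insert_self _ _) w (Finset.mem_insert_of_mem hw)
          (fun h => hz (h ▸ hw))),
      ih fun z hz w hw => hsep z (Finset.mem_insert_of_mem hz) w (Finset.mem_insert_of_mem hw)]

end Stationary

/-! ### Negative exponentials and Poisson counts -/

/-- The function `t ↦ exp(-t)` on `[0, ∞]`. -/
def expMinus (t : ℝ≥0∞) : ℝ≥0∞ := EReal.exp (-(t : EReal))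

lemma expMinus_zero : expMinus 0 = 1 := by simp [expMinus]

lemma expMinus_of_ne_top {t : ℝ≥0∞} (ht : t ≠ ∞) :
    expMinus t = ENNReal.ofReal (Real.exp (-t.toReal)) := by
  lift t to ℝ≥0 using ht
  rfl

lemma expMinus_ofReal {t : ℝ} (ht : 0 ≤ t) :
    expMinus (ENNReal.ofReal t) = ENNReal.ofReal (Real.exp (-t)) := by
  rw [expMinus_of_ne_top ENNReal.ofReal_ne_top, ENNReal.toReal_ofReal ht]

lemma expMinus_antitone : Antitone expMinus := fun s t h => by
  unfold expMinus
  rw [EReal.exp_le_exp_iff, EReal.neg_le_neg_iff]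
  exact_mod_cast h

lemma expMinus_le_one (t : ℝ≥0∞) : expMinus t ≤ 1 :=
  (expMinus_antitone zero_le).trans_eq expMinus_zero

lemma measurable_expMinus : Measurable expMinus := expMinus_antitone.measurable

lemma expMinus_add (s t : ℝ≥0∞) : expMinus (s + t) = expMinus s * expMinus t := by
  unfold expMinus
  rw [← EReal.exp_add, EReal.coe_ennreal_add, EReal.neg_add, sub_eq_add_neg]
  · left; simp
  · right; simp

lemma expMinus_sum {ι : Type*} (F : Finset ι) (f : ι → ℝ≥0∞) :
    expMinus (∑ i ∈ F, f i) = ∏ i ∈ F, expMinus (f i) := by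
  classical
  induction F using Finset.induction_on with
  | empty => simp [expMinus_zero]
  | insert i F hi ih => rw [Finset.sum_insert hi, Finset.prod_insert hi, expMinus_add, ih]

section Poisson

variable {d : ℕ} {m : Measure (E d)} {Q : Measure (Measure (E d))}

/-- This recursion gives both the mean of the Poisson law and its mass at one. -/
lemma succ_mul_poissonMeasure_singleton (r : ℝ≥0) (n : ℕ) :
    ((n + 1 : ℕ) : ℝ≥0∞) * poissonMeasure r {n + 1} = r * poissonMeasure r {n} := by
  rw [poissonMeasure_singleton, poissonMeasure_singleton, ← ENNReal.ofReal_natCast,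
    ← ENNReal.ofReal_coe_nnreal, ← ENNReal.ofReal_mul (by positivity),
    ← ENNReal.ofReal_mul (by positivity)]
  congr 1
  rw [Nat.factorial_succ]
  push_cast
  field_simp
  ring

lemma lintegral_natCast_poissonMeasure (r : ℝ≥0) :
    ∫⁻ n : ℕ, (n : ℝ≥0∞) ∂poissonMeasure r = r := by
  rw [lintegral_countable', tsum_eq_zero_add' ENNReal.summable]
  simp only [succ_mul_poissonMeasure_singleton, Nat.cast_zero, zero_mul, zero_add]
  have h := lintegral_countable' (μ := poissonMeasure r) (fun _ => 1)
  simp only [lintegral_const, measure_univ, one_mul] at h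
  rw [ENNReal.tsum_mul_left, ← h, mul_one]

lemma poissonMeasure_singleton_zero (t : ℝ≥0∞) (ht : t ≠ ∞) :
    poissonMeasure t.toNNReal {0} = expMinus t := by
  rw [poissonMeasure_singleton, expMinus_of_ne_top ht]
  simp [ENNReal.toReal]

lemma poissonMeasure_singleton_one (t : ℝ≥0∞) (ht : t ≠ ∞) :
    poissonMeasure t.toNNReal {1} = t * expMinus t := by
  have h := succ_mul_poissonMeasure_singleton t.toNNReal 0
  rw [poissonMeasure_singleton_zero t ht, ENNReal.coe_toNNReal ht] at h
  simpa using h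

lemma IsPoissonLaw.lintegral_comp (h : IsPoissonLaw m Q) {B : Set (E d)} (hB : MeasurableSet B)
    (hm : m B ≠ ∞) {f : ℝ≥0∞ → ℝ≥0∞} (hf : Measurable f) :
    ∫⁻ ν, f (ν B) ∂Q = ∫⁻ n : ℕ, f n ∂poissonMeasure (m B).toNNReal := by
  rw [← lintegral_map hf (Measure.measurable_coe hB), h.map_count B hB hm,
    lintegral_map hf (measurable_of_countable _)]

lemma IsPoissonLaw.lintegral_mul (h : IsPoissonLaw m Q) {A B : Set (E d)} (hA : MeasurableSet A)
    (hB : MeasurableSet B) (hAB : Disjoint A B) {f g : ℝ≥0∞ → ℝ≥0∞} (hf : Measurable f)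
    (hg : Measurable g) :
    ∫⁻ ν, f (ν A) * g (ν B) ∂Q = (∫⁻ ν, f (ν A) ∂Q) * ∫⁻ ν, g (ν B) ∂Q := by
  have hi := (h.indep_count 2 ![A, B] (by simp [Fin.forall_fin_two, hA, hB]) (by
    intro i j hij
    fin_cases i <;> fin_cases j <;> simp_all [hAB.symm])).indepFun (i := 0) (j := 1) (by simp)
  exact lintegral_mul_eq_lintegral_mul_lintegral_of_indepFun
    (hf.comp (Measure.measurable_coe hA)) (hg.comp (Measure.measurable_coe hB)) (hi.comp hf hg)

end Poisson

/-! ### Averaging Poisson formulas over the random intensity -/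

section Cox

variable {Ω : Type*} [MeasurableSpace Ω] {d : ℕ} {P : Measure Ω} [IsProbabilityMeasure P]
  {M X : Ω → Measure (E d)}

/-- The expectation of a product of functions of the counts of a Cox process in two disjoint sets
is obtained by averaging the Poisson expectations over the random intensity. -/
lemma IsCoxProcess.lintegral_mul (hX : IsCoxProcess P M X) (hM : Measurable M) {A B : Set (E d)}
    (hA : MeasurableSet A) (hB : MeasurableSet B) (hAB : Disjoint A B)
    (hMA : ∀ᵐ ω ∂P, M ω A < ∞) (hMB : ∀ᵐ ω ∂P, M ω B < ∞) {f g : ℝ≥0∞ → ℝ≥0∞}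
    (hf : Measurable f) (hg : Measurable g) :
    ∫⁻ ω, f (X ω A) * g (X ω B) ∂P
      = ∫⁻ ω, (∫⁻ n : ℕ, f n ∂poissonMeasure (M ω A).toNNReal)
        * ∫⁻ n : ℕ, g n ∂poissonMeasure (M ω B).toNNReal ∂P := by
  obtain ⟨κ, hκ, hmap, hpois⟩ := hX.exists_kernel
  have : IsProbabilityMeasure (P.map M) := Measure.isProbabilityMeasure_map hM.aemeasurable
  have hF : Measurable fun ν : Measure (E d) => f (ν A) * g (ν B) :=
    (hf.comp (Measure.measurable_coe hA)).mul (hg.comp (Measure.measurable_coe hB))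
  have h := congrArg (fun ρ => ∫⁻ q : Measure (E d) × Measure (E d), f (q.2 A) * g (q.2 B) ∂ρ) hmap
  have hF2 : Measurable fun q : Measure (E d) × Measure (E d) => f (q.2 A) * g (q.2 B) :=
    hF.comp measurable_snd
  have hMX : Measurable fun ω => (M ω, X ω) := hM.prodMk hX.measurable
  rw [lintegral_map hF2 hMX, Measure.lintegral_compProd hF2,
    lintegral_map hF.lintegral_kernel hM] at h
  rw [h]
  refine lintegral_congr_ae ?_
  filter_upwards [ae_of_ae_map hM.aemeasurable hpois, hMA, hMB] with ω h1 h2 h3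
  rw [h1.lintegral_mul hA hB hAB hf hg, h1.lintegral_comp hA h2.ne hf, h1.lintegral_comp hB h3.ne hg]

lemma IsCoxProcess.ae_eq_natCast (hX : IsCoxProcess P M X) (hM : Measurable M) {B : Set (E d)}
    (hB : MeasurableSet B) (hMB : ∀ᵐ ω ∂P, M ω B < ∞) :
    ∀ᵐ ω ∂P, X ω B ∈ Set.range ((↑) : ℕ → ℝ≥0∞) := by
  have hr : MeasurableSet (Set.range ((↑) : ℕ → ℝ≥0∞)) := (Set.countable_range _).measurableSet
  -- An empty second set and the constant function one reduce the two-set formula to `B` alone. The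
  -- averaged Poisson law puts no mass outside the naturals.
  have h := hX.lintegral_mul hM hB MeasurableSet.empty (disjoint_bot_right) hMB (by simp)
    (f := (Set.range ((↑) : ℕ → ℝ≥0∞))ᶜ.indicator 1) (g := fun _ => 1)
    (measurable_one.indicator hr.compl) measurable_const
  simp only [mul_one] at h
  have h0 : ∫⁻ ω, (Set.range ((↑) : ℕ → ℝ≥0∞))ᶜ.indicator 1 (X ω B) ∂P = 0 := by
    rw [h]; simp
  have hm : Measurable fun ω =>
      (Set.range ((↑) : ℕ → ℝ≥0∞))ᶜ.indicator (1 : ℝ≥0∞ → ℝ≥0∞) (X ω B) :=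
    (measurable_one.indicator hr.compl).comp (measurable_eval hX.measurable hB)
  rw [lintegral_eq_zero_iff hm] at h0
  filter_upwards [h0] with ω hω
  by_contra hc
  simp [Set.indicator_of_mem (show X ω B ∈ (Set.range ((↑) : ℕ → ℝ≥0∞))ᶜ from hc)] at hω

/-- Counting the points of `A` while `B` is vacant is the form in which vacant sets enter the union
bound for the Palm version. -/
lemma IsCoxProcess.lintegral_mul_indicator_zero (hX : IsCoxProcess P M X) (hM : Measurable M)
    {A B : Set (E d)} (hA : MeasurableSet A) (hB : MeasurableSet B) (hAB : Disjoint A B)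
    (hMA : ∀ᵐ ω ∂P, M ω A < ∞) (hMB : ∀ᵐ ω ∂P, M ω B < ∞) :
    ∫⁻ ω, X ω A * ({0} : Set ℝ≥0∞).indicator 1 (X ω B) ∂P
      = ∫⁻ ω, M ω A * expMinus (M ω B) ∂P := by
  refine (hX.lintegral_mul hM hA hB hAB hMA hMB (f := id) measurable_id
    (measurable_one.indicator (measurableSet_singleton 0))).trans ?_
  refine lintegral_congr_ae ?_
  filter_upwards [hMA, hMB] with ω h2 h3
  have e : ∀ n : ℕ, ({0} : Set ℝ≥0∞).indicator (1 : ℝ≥0∞ → ℝ≥0∞) n = ({0} : Set ℕ).indicator 1 n :=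
    fun n => by simp [Set.indicator_apply]
  simp only [id_eq, e]
  rw [lintegral_natCast_poissonMeasure, lintegral_indicator_one (measurableSet_singleton 0),
    poissonMeasure_singleton_zero _ h3.ne, ENNReal.coe_toNNReal h2.ne]

/-- On this event the single point of `A` is alone in `A ∪ B`. The Poisson weight `t exp(-t)` at one
supplies both the factor `M A` and the part of the exponent that belongs to `A`. -/
lemma IsCoxProcess.lintegral_indicator_one_mul_indicator_zero (hX : IsCoxProcess P M X)
    (hM : Measurable M)
    {A B : Set (E d)} (hA : MeasurableSet A) (hB : MeasurableSet B) (hAB : Disjoint A B)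
    (hMA : ∀ᵐ ω ∂P, M ω A < ∞) (hMB : ∀ᵐ ω ∂P, M ω B < ∞) :
    ∫⁻ ω, ({1} : Set ℝ≥0∞).indicator 1 (X ω A) * ({0} : Set ℝ≥0∞).indicator 1 (X ω B) ∂P
      = ∫⁻ ω, M ω A * expMinus (M ω A + M ω B) ∂P := by
  refine (hX.lintegral_mul hM hA hB hAB hMA hMB
    (measurable_one.indicator (measurableSet_singleton 1))
    (measurable_one.indicator (measurableSet_singleton 0))).trans ?_
  refine lintegral_congr_ae ?_
  filter_upwards [hMA, hMB] with ω h2 h3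
  have e : ∀ n : ℕ, ({0} : Set ℝ≥0∞).indicator (1 : ℝ≥0∞ → ℝ≥0∞) n = ({0} : Set ℕ).indicator 1 n :=
    fun n => by simp [Set.indicator_apply]
  have e' : ∀ n : ℕ, ({1} : Set ℝ≥0∞).indicator (1 : ℝ≥0∞ → ℝ≥0∞) n = ({1} : Set ℕ).indicator 1 n :=
    fun n => by simp [Set.indicator_apply]
  simp only [e, e']
  rw [lintegral_indicator_one (measurableSet_singleton 1),
    lintegral_indicator_one (measurableSet_singleton 0),
    poissonMeasure_singleton_zero _ h3.ne, poissonMeasure_singleton_one _ h2.ne, expMinus_add,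
    mul_assoc]

lemma IsCoxProcess.lintegral_apply (hX : IsCoxProcess P M X) (hM : Measurable M)
    {A : Set (E d)} (hA : MeasurableSet A) (hMA : ∀ᵐ ω ∂P, M ω A < ∞) :
    ∫⁻ ω, X ω A ∂P = ∫⁻ ω, M ω A ∂P := by
  have h := hX.lintegral_mul_indicator_zero hM hA MeasurableSet.empty disjoint_bot_right hMA
    (by simp)
  simpa [expMinus_zero] using h

end Cox

/-! ### Atoms of integer-valued measures -/

section Counting

variable {d : ℕ} {ν : Measure (E d)}

/-- A measure that gives integer mass to all dyadic cells. -/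
def IsCounting (ν : Measure (E d)) : Prop :=
  ∀ (n : ℕ) (z : Fin d → ℤ), ν (cell ((1 / 2) ^ n) z) ∈ Set.range ((↑) : ℕ → ℝ≥0∞)

lemma cell_half_subset {s : ℝ} (hs : 0 < s) (x : E d) :
    cell (s / 2) (cellIndex (s / 2) x) ⊆ cell s (cellIndex s x) := by
  intro y hy i
  have h1 := mem_cell_cellIndex (half_pos hs) x i
  have h2 := mem_cell_cellIndex hs x i
  have h3 := hy i
  generalize cellIndex (s / 2) x i = k at *
  generalize cellIndex s x i = j at *
  have a1 : k < 2 * j + 2 := by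
    have : (k : ℝ) < 2 * j + 2 := by nlinarith
    exact_mod_cast this
  have a2 : 2 * j < k + 1 := by
    have : (2 * j : ℝ) < k + 1 := by nlinarith
    exact_mod_cast this
  have b1 : (k : ℝ) ≤ 2 * j + 1 := by exact_mod_cast (by omega : k ≤ 2 * j + 1)
  have b2 : (2 * j : ℝ) ≤ k := by exact_mod_cast (by omega : 2 * j ≤ k)
  constructor <;> nlinarith

/-- The dyadic cells containing `x` decrease to `{x}`, so their masses converge to that of `{x}`. A
decreasing sequence of naturals attains its limit. -/
lemma IsCounting.exists_singleton_eq (hν : IsCounting ν) (x : E d) :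
    ∃ n : ℕ, ν {x} = ν (cell ((1 / 2) ^ n) (cellIndex ((1 / 2) ^ n) x)) := by
  set c : ℕ → Set (E d) := fun n => cell ((1 / 2) ^ n) (cellIndex ((1 / 2) ^ n) x) with hc
  have hx : ∀ n, x ∈ c n := fun n => mem_cell_cellIndex (by positivity) x
  have hanti : Antitone c := antitone_nat_of_succ_le fun n => by
    simp only [hc, pow_succ (1 / 2 : ℝ) n, mul_one_div]
    exact cell_half_subset (by positivity) x
  have hinter : ⋂ n, c n = {x} := by
    refine Set.Subset.antisymm (fun y hy => ?_) (by simpa using hx)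
    have hle : ∀ n : ℕ, dist y x ≤ (1 / 2) ^ n * √d := fun n =>
      dist_le_of_mem_cell (by positivity) (Set.mem_iInter.1 hy n) (hx n)
    have hlim : Tendsto (fun n : ℕ => (1 / 2 : ℝ) ^ n * √d) atTop (𝓝 (0 * √d)) :=
      (tendsto_pow_atTop_nhds_zero_of_lt_one (by norm_num) (by norm_num)).mul_const _
    rw [zero_mul] at hlim
    exact dist_le_zero.1 (ge_of_tendsto' hlim hle)
  choose k hk using fun n => hν n (cellIndex ((1 / 2) ^ n) x)
  obtain ⟨n, hn⟩ : ∃ n, ∀ m, k n ≤ k m :=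
    ⟨Function.argmin k, fun m => Function.argmin_le k m⟩
  refine ⟨n, ?_⟩
  rw [← hinter, hanti.measure_iInter (fun n => (measurableSet_cell _ _).nullMeasurableSet)
    ⟨0, by simp only [hc, ← hk]; simp⟩]
  refine le_antisymm (iInf_le _ n) (le_iInf fun m => ?_)
  simp only [hc, ← hk]
  exact_mod_cast hn m

lemma IsCounting.one_le_singleton (hν : IsCounting ν) {x : E d} (hx : ν {x} ≠ 0) :
    1 ≤ ν {x} := by
  obtain ⟨n, hn⟩ := hν.exists_singleton_eq x
  obtain ⟨k, hk⟩ := hν n (cellIndex ((1 / 2) ^ n) x)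
  rw [hn, ← hk] at hx ⊢
  exact_mod_cast Nat.one_le_iff_ne_zero.2 (by exact_mod_cast hx)

/-- A point that is not an atom has a null dyadic cell around it, and there are only countably many
dyadic cells. -/
lemma IsCounting.compl_points (hν : IsCounting ν) : ν (points ν)ᶜ = 0 := by
  refine measure_mono_null (t := ⋃ q : {q : ℕ × (Fin d → ℤ) // ν (cell ((1 / 2) ^ q.1) q.2) = 0},
    cell ((1 / 2) ^ q.1.1) q.1.2) (fun x hx => ?_) (measure_iUnion_null fun q => q.2)
  have h0 : ν {x} = 0 := by simpa [points] using hx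
  obtain ⟨n, hn⟩ := hν.exists_singleton_eq x
  exact Set.mem_iUnion.2 ⟨⟨(n, cellIndex ((1 / 2) ^ n) x), hn.symm.trans h0⟩,
    mem_cell_cellIndex (by positivity : (0 : ℝ) < (1 / 2) ^ n) x⟩

lemma IsCounting.apply_eq_zero (hν : IsCounting ν) {A : Set (E d)}
    (hA : ∀ x ∈ A, ν {x} = 0) : ν A = 0 :=
  measure_mono_null (fun x hx => by simpa [points] using hA x hx) hν.compl_points

end Counting

/-! ### Clusters of the Gilbert graph -/

section Clusters

variable {d : ℕ} {ν : Measure (E d)} {r : ℝ} {x : E d}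

lemma shift_singleton (x y : E d) (ν : Measure (E d)) : shift x ν {y} = ν {y + x} := by
  rw [shift_apply _ _ (measurableSet_singleton _)]
  congr 1
  ext z
  simp [sub_eq_iff_eq_add]

lemma exists_ne_of_originPercolates (h : shift x ν ∈ originPercolates r) :
    ∃ y, y ≠ x ∧ ν {y} ≠ 0 ∧ ν {x} ≠ 0 ∧ dist x y < r := by
  obtain ⟨h0, hinf⟩ := h
  have hx : ν {x} ≠ 0 := by
    have : shift x ν {0} ≠ 0 := h0
    rwa [shift_singleton, zero_add] at this
  obtain ⟨u, hu, hne⟩ := hinf.exists_notMem_finset {⟨0, h0⟩}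
  have hreach : (gilbertGraph r (points (shift x ν))).Reachable ⟨0, h0⟩ u :=
    (SimpleGraph.ConnectedComponent.exact hu).symm
  obtain ⟨w⟩ := hreach
  cases w with
  | nil => simp at hne
  | @cons _ v _ hadj w =>
    have hv : shift x ν {v.1} ≠ 0 := v.2
    rw [shift_singleton] at hv
    refine ⟨v + x, fun hvx => ?_, hv, hx, ?_⟩
    · exact hadj.1 (Subtype.ext (by simpa using (add_eq_right.1 hvx).symm))
    · simpa using hadj.2

/-- If a point of `ν` does not percolate, its cluster is a finite set which is connected and closed
under passing to points at distance less than `r`. -/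
lemma exists_finite_cluster (hx : ν {x} ≠ 0) (h : shift x ν ∉ originPercolates r) :
    ∃ C : Set (E d), C.Finite ∧ x ∈ C ∧ (∀ c ∈ C, ν {c} ≠ 0) ∧
      (∀ c ∈ C, ∀ y, ν {y} ≠ 0 → dist c y < r → y ∈ C) ∧
      ∀ c ∈ C, Relation.ReflTransGen (fun a b => a ∈ C ∧ b ∈ C ∧ dist a b < r) x c := by
  have h0 : (0 : E d) ∈ points (shift x ν) := by
    change shift x ν {0} ≠ 0
    rwa [shift_singleton, zero_add]
  set G := gilbertGraph r (points (shift x ν)) with hG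
  set S := (G.connectedComponentMk ⟨0, h0⟩).supp with hS
  have hfin : S.Finite := by
    by_contra hc
    exact h ⟨h0, hc⟩
  have hmem : ∀ u, u ∈ S ↔ G.Reachable ⟨0, h0⟩ u := fun u => by
    rw [hS, SimpleGraph.ConnectedComponent.mem_supp_iff, SimpleGraph.ConnectedComponent.eq]
    exact ⟨fun h => h.symm, fun h => h.symm⟩
  set C := (fun u : points (shift x ν) => (u : E d) + x) '' S with hC
  have hx0 : x ∈ C := ⟨⟨0, h0⟩, (hmem _).2 (SimpleGraph.Reachable.refl _), by simp⟩
  refine ⟨C, hfin.image _, hx0, ?_, ?_, ?_⟩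
  · rintro _ ⟨u, _, rfl⟩
    have hu : shift x ν {u.1} ≠ 0 := u.2
    rwa [shift_singleton] at hu
  · rintro _ ⟨u, hu, rfl⟩ y hy hd
    have hy' : y - x ∈ points (shift x ν) := by
      change shift x ν {y - x} ≠ 0
      rwa [shift_singleton, sub_add_cancel]
    refine ⟨⟨y - x, hy'⟩, ?_, by simp⟩
    rw [hmem] at hu ⊢
    by_cases he : u = ⟨y - x, hy'⟩
    · rwa [← he]
    · refine hu.trans (SimpleGraph.Adj.reachable ⟨he, ?_⟩)
      rw [dist_eq_norm] at hd ⊢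
      simpa [add_sub_assoc, sub_sub_eq_add_sub] using hd
  · rintro _ ⟨u, hu, rfl⟩
    rw [hmem, SimpleGraph.reachable_iff_reflTransGen] at hu
    induction hu with
    | refl => simpa using Relation.ReflTransGen.refl
    | @tail v w hv hvw ih =>
      refine ih.tail ⟨⟨v, ?_, rfl⟩, ⟨w, ?_, rfl⟩, ?_⟩
      · rw [hmem, SimpleGraph.reachable_iff_reflTransGen]; exact hv
      · rw [hmem, SimpleGraph.reachable_iff_reflTransGen]; exact hv.tail hvw
      · simpa using hvw.2

/-- If the unit cube contains exactly one point and its neighbourhood no other point, then no point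
of the unit cube percolates. -/
lemma lintegral_percolates_add_le (hν : IsCounting ν) (r : ℝ) :
    ∫⁻ x in cube d 1, (originPercolates r).indicator 1 (shift x ν) ∂ν
      + ({1} : Set ℝ≥0∞).indicator 1 (ν (cube d 1))
        * ({0} : Set ℝ≥0∞).indicator 1 (ν (Metric.ball 0 (r + √d) \ cube d 1))
      ≤ ν (cube d 1) := by
  by_cases h : ν (cube d 1) = 1 ∧ ν (Metric.ball 0 (r + √d) \ cube d 1) = 0
  · obtain ⟨h1, h2⟩ := h
    have hz : ∫⁻ x in cube d 1, (originPercolates r).indicator 1 (shift x ν) ∂ν = 0 := by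
      rw [← nonpos_iff_eq_zero]
      refine (setLIntegral_mono (g := fun _ => 0) measurable_const fun x hx => ?_).trans (by simp)
      rw [Set.indicator_of_notMem]
      intro hp
      obtain ⟨y, hyx, hy, hx0, hd⟩ := exists_ne_of_originPercolates hp
      by_cases hyQ : y ∈ cube d 1
      -- Atoms have mass at least one, so a second point inside the cube would exceed its total
      -- mass. A neighbour outside the cube lies within `r + √d` of the origin, in the set assumed
      -- null.
      · have h3 : ν {x} + ν {y} ≤ 1 := by
          rw [← h1, ← measure_union (by simpa using hyx.symm) (measurableSet_singleton y)]
          exact measure_mono (Set.union_subset (by simpa using hx) (by simpa using hyQ))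
        have h4 := (add_le_add (hν.one_le_singleton hx0) (hν.one_le_singleton hy)).trans h3
        norm_num at h4
      · have hb : y ∈ Metric.ball 0 (r + √d) := by
          rw [Metric.mem_ball]
          have := dist_triangle_left y 0 x
          have := dist_le_of_mem_cube_one hx
          linarith
        exact hy (measure_mono_null (Set.singleton_subset_iff.2 (Set.mem_sdiff_of_mem hb hyQ)) h2)
    simp [hz, h1, h2]
  · have : ({1} : Set ℝ≥0∞).indicator (1 : ℝ≥0∞ → ℝ≥0∞) (ν (cube d 1))
        * ({0} : Set ℝ≥0∞).indicator (1 : ℝ≥0∞ → ℝ≥0∞) (ν (Metric.ball 0 (r + √d) \ cube d 1)) = 0 := by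
      rw [not_and_or] at h
      rcases h with h | h
      · rw [Set.indicator_of_notMem (by simpa using h), zero_mul]
      · rw [Set.indicator_of_notMem (a := ν (Metric.ball 0 (r + √d) \ cube d 1))
          (by simpa using h), mul_zero]
    rw [this, add_zero]
    refine (setLIntegral_mono (g := fun _ => 1) measurable_const fun x _ => ?_).trans (by simp)
    exact Set.indicator_apply_le' (fun _ => le_rfl) (fun _ => zero_le)

/-- If all points in the unit cube percolate, the number of percolating points is the number of
points. -/
lemma apply_le_lintegral_percolates (hν : IsCounting ν) (r : ℝ)
    (h : ∀ x ∈ cube d 1, ν {x} ≠ 0 → shift x ν ∈ originPercolates r) :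
    ν (cube d 1) ≤ ∫⁻ x in cube d 1, (originPercolates r).indicator 1 (shift x ν) ∂ν := by
  have h1 : ∀ᵐ x ∂ν.restrict (cube d 1), (1 : ℝ≥0∞) ≤ (originPercolates r).indicator 1 (shift x ν) := by
    rw [ae_restrict_iff' (measurableSet_cube 1)]
    have : ∀ᵐ x ∂ν, x ∈ points ν := hν.compl_points
    filter_upwards [this] with x hx hxQ
    rw [Set.indicator_of_mem (h x hxQ hx)]
    rfl
  refine le_trans ?_ (lintegral_mono_ae h1)
  simp

end Clusters

/-! ### Bounds on the percolation probability by void expectations -/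

section PercolationProbability

variable {Ω : Type*} [MeasurableSpace Ω] {d : ℕ} {P : Measure Ω}
  {Λ X : Ω → Measure (E d)} {lam : ℝ}

lemma expNeg_eq (lam : ℝ) (B : Set (E d)) (μ : Measure (E d)) :
    expNeg lam B μ = expMinus (ENNReal.ofReal lam * μ B) := rfl

lemma measurable_const_smul_measure (c : ℝ≥0∞) (hΛ : Measurable Λ) :
    Measurable fun ω => c • Λ ω := by
  refine Measure.measurable_of_measurable_coe _ fun s hs => ?_
  simp only [Measure.smul_apply, smul_eq_mul]
  exact (measurable_eval hΛ hs).const_mul c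

lemma ae_smul_apply_lt_top (hΛ : IsStationaryRandomMeasure P Λ)
    (hmean : ∫⁻ ω, Λ ω (unitCube d) ∂P = 1) (lam : ℝ) {A : Set (E d)} (hA : MeasurableSet A)
    (hb : Bornology.IsBounded A) : ∀ᵐ ω ∂P, (ENNReal.ofReal lam • Λ ω) A < ∞ := by
  filter_upwards [hΛ.ae_apply_lt_top hmean hA hb] with ω hω
  exact ENNReal.mul_lt_top ENNReal.ofReal_lt_top hω

lemma isBounded_cell {s : ℝ} (hs : 0 < s) (z : Fin d → ℤ) : Bornology.IsBounded (cell s z) :=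
  Metric.isBounded_iff.2 ⟨s * √d, fun _ hx _ hy => dist_le_of_mem_cell hs hx hy⟩

lemma IsCoxProcess.ae_isCounting [IsProbabilityMeasure P] (hΛ : IsStationaryRandomMeasure P Λ)
    (hmean : ∫⁻ ω, Λ ω (unitCube d) ∂P = 1)
    (hX : IsCoxProcess P (fun ω => ENNReal.ofReal lam • Λ ω) X) :
    ∀ᵐ ω ∂P, IsCounting (X ω) := by
  unfold IsCounting
  rw [ae_all_iff]
  intro n
  rw [ae_all_iff]
  intro z
  exact hX.ae_eq_natCast (measurable_const_smul_measure _ hΛ.measurable) (measurableSet_cell _ _)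
    (ae_smul_apply_lt_top hΛ hmean lam (measurableSet_cell _ _) (isBounded_cell (by positivity) z))

lemma IsCoxProcess.lintegral_cube_one [IsProbabilityMeasure P] (hΛ : IsStationaryRandomMeasure P Λ)
    (hmean : ∫⁻ ω, Λ ω (unitCube d) ∂P = 1)
    (hX : IsCoxProcess P (fun ω => ENNReal.ofReal lam • Λ ω) X) :
    ∫⁻ ω, X ω (cube d 1) ∂P = ENNReal.ofReal lam := by
  rw [hX.lintegral_apply (measurable_const_smul_measure _ hΛ.measurable) (measurableSet_cube 1)
    (ae_smul_apply_lt_top hΛ hmean lam (measurableSet_cube 1) (isBounded_cube 1))]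
  simp only [Measure.smul_apply, smul_eq_mul]
  rw [lintegral_const_mul _ (measurable_eval hΛ.measurable (measurableSet_cube 1)),
    hΛ.lintegral_cube_one hmean, mul_one]

/-- Lower bound for the probability not to percolate by the probability to be isolated. -/
lemma lintegral_le_one_sub_percolationProbability [IsProbabilityMeasure P] (hlam : 0 < lam)
    (hΛ : IsStationaryRandomMeasure P Λ) (hmean : ∫⁻ ω, Λ ω (unitCube d) ∂P = 1)
    (hX : IsCoxProcess P (fun ω => ENNReal.ofReal lam • Λ ω) X) {r : ℝ} (hr : 0 < r) :
    ∫⁻ ω, Λ ω (cube d 1) * expNeg lam (Metric.ball 0 (r + √d)) (Λ ω) ∂P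
      ≤ 1 - percolationProbability P X lam r := by
  set N : Set (E d) := Metric.ball 0 (r + √d) with hN
  have hQ := measurableSet_cube (d := d) 1
  have hQN : cube d 1 ⊆ N := fun x hx => by
    rw [hN, Metric.mem_ball]
    have := dist_le_of_mem_cube_one hx
    linarith
  have hNQ : MeasurableSet (N \ cube d 1) := Metric.isOpen_ball.measurableSet.diff hQ
  have hl0 : ENNReal.ofReal lam ≠ 0 := by simpa using hlam
  have key := hX.lintegral_indicator_one_mul_indicator_zero
    (measurable_const_smul_measure _ hΛ.measurable) hQ hNQ Set.disjoint_sdiff_right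
    (ae_smul_apply_lt_top hΛ hmean lam hQ (isBounded_cube 1))
    (ae_smul_apply_lt_top hΛ hmean lam hNQ (Metric.isBounded_ball.subset Set.sdiff_subset))
  -- The exponential factor for exactly one point in the cube and the void factor of the remainder
  -- combine to the void factor of the whole ball.
  have e : ∀ ω, (ENNReal.ofReal lam • Λ ω) (cube d 1)
      * expMinus ((ENNReal.ofReal lam • Λ ω) (cube d 1) + (ENNReal.ofReal lam • Λ ω) (N \ cube d 1))
      = ENNReal.ofReal lam * (Λ ω (cube d 1) * expNeg lam N (Λ ω)) := fun ω => by
    rw [← measure_union Set.disjoint_sdiff_right hNQ, Set.union_sdiff_cancel hQN, expNeg_eq,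
      ← mul_assoc]
    rfl
  have hm : Measurable fun ω => Λ ω (cube d 1) * expNeg lam N (Λ ω) :=
    (measurable_eval hΛ.measurable hQ).mul (measurable_expMinus.comp
      ((measurable_eval hΛ.measurable Metric.isOpen_ball.measurableSet).const_mul _))
  simp only [e] at key
  rw [lintegral_const_mul _ hm] at key
  have hsum := lintegral_mono_ae (μ := P) (by
    filter_upwards [IsCoxProcess.ae_isCounting hΛ hmean hX] with ω hω
    exact lintegral_percolates_add_le hω r)
  have hm2 : Measurable fun ω => ({1} : Set ℝ≥0∞).indicator (1 : ℝ≥0∞ → ℝ≥0∞) (X ω (cube d 1))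
        * ({0} : Set ℝ≥0∞).indicator (1 : ℝ≥0∞ → ℝ≥0∞) (X ω (N \ cube d 1)) :=
    ((measurable_one.indicator (measurableSet_singleton 1)).comp
      (measurable_eval hX.measurable hQ)).mul
      ((measurable_one.indicator (measurableSet_singleton 0)).comp
      (measurable_eval hX.measurable hNQ))
  rw [lintegral_add_right _ hm2, key, IsCoxProcess.lintegral_cube_one hΛ hmean hX] at hsum
  have hsum' := mul_le_mul_right hsum (ENNReal.ofReal lam)⁻¹
  rw [mul_add, ← mul_assoc, ENNReal.inv_mul_cancel hl0 ENNReal.ofReal_ne_top, one_mul] at hsum'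
  have hth : percolationProbability P X lam r + ∫⁻ ω, Λ ω (cube d 1) * expNeg lam N (Λ ω) ∂P ≤ 1 :=
    hsum'
  have hne : percolationProbability P X lam r ≠ ∞ :=
    ((le_self_add.trans hth).trans_lt ENNReal.one_lt_top).ne
  exact ENNReal.le_sub_of_add_le_left hne hth

/-- Upper bound for the probability not to percolate by a union bound over vacant sets. -/
lemma one_sub_percolationProbability_le_tsum [IsProbabilityMeasure P] (hlam : 0 < lam)
    (hΛ : IsStationaryRandomMeasure P Λ) (hmean : ∫⁻ ω, Λ ω (unitCube d) ∂P = 1)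
    (hX : IsCoxProcess P (fun ω => ENNReal.ofReal lam • Λ ω) X) {r : ℝ} {ι : Type*} [Countable ι]
    (A : ι → Set (E d)) (hA : ∀ i, MeasurableSet (A i)) (hb : ∀ i, Bornology.IsBounded (A i))
    (hdisj : ∀ i, Disjoint (cube d 1) (A i))
    (hperc : ∀ ν : Measure (E d), IsCounting ν → (∀ i, ν (A i) ≠ 0) →
      ∀ x ∈ cube d 1, ν {x} ≠ 0 → shift x ν ∈ originPercolates r) :
    1 - percolationProbability P X lam r
      ≤ ∑' i, ∫⁻ ω, Λ ω (cube d 1) * expNeg lam (A i) (Λ ω) ∂P := by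
  have hQ := measurableSet_cube (d := d) 1
  have hl0 : ENNReal.ofReal lam ≠ 0 := by simpa using hlam
  have hm2 : ∀ i, Measurable fun ω =>
      X ω (cube d 1) * ({0} : Set ℝ≥0∞).indicator (1 : ℝ≥0∞ → ℝ≥0∞) (X ω (A i)) := fun i =>
    (measurable_eval hX.measurable hQ).mul
      ((measurable_one.indicator (measurableSet_singleton 0)).comp
      (measurable_eval hX.measurable (hA i)))
  have hsum : ∫⁻ ω, X ω (cube d 1) ∂P
      ≤ ∫⁻ ω, (∫⁻ x in cube d 1, (originPercolates r).indicator 1 (shift x (X ω)) ∂(X ω))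
        + ∑' i, X ω (cube d 1) * ({0} : Set ℝ≥0∞).indicator 1 (X ω (A i)) ∂P := by
    refine lintegral_mono_ae ?_
    filter_upwards [IsCoxProcess.ae_isCounting hΛ hmean hX] with ω hω
    -- Either every `A i` is occupied and all points of the cube percolate, or a single vacant `A i`
    -- already pays for all points of the cube.
    by_cases h : ∀ i, X ω (A i) ≠ 0
    · exact (apply_le_lintegral_percolates hω r (hperc _ hω h)).trans le_self_add
    · push Not at h
      obtain ⟨i, hi⟩ := h
      refine le_trans ?_ le_add_self
      refine le_trans ?_ (ENNReal.le_tsum i)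
      simp [hi]
  rw [lintegral_add_right _ (Measurable.tsum hm2),
    lintegral_tsum fun i => (hm2 i).aemeasurable,
    IsCoxProcess.lintegral_cube_one hΛ hmean hX] at hsum
  have e : ∀ i, ∫⁻ ω, X ω (cube d 1) * ({0} : Set ℝ≥0∞).indicator 1 (X ω (A i)) ∂P
      = ENNReal.ofReal lam * ∫⁻ ω, Λ ω (cube d 1) * expNeg lam (A i) (Λ ω) ∂P := fun i => by
    rw [hX.lintegral_mul_indicator_zero (measurable_const_smul_measure _ hΛ.measurable) hQ (hA i)
      (hdisj i) (ae_smul_apply_lt_top hΛ hmean lam hQ (isBounded_cube 1))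
      (ae_smul_apply_lt_top hΛ hmean lam (hA i) (hb i)), ← lintegral_const_mul]
    · simp only [Measure.smul_apply, smul_eq_mul, mul_assoc]
      rfl
    · exact (measurable_eval hΛ.measurable hQ).mul (measurable_expMinus.comp
        ((measurable_eval hΛ.measurable (hA i)).const_mul _))
  simp only [e] at hsum
  rw [ENNReal.tsum_mul_left] at hsum
  have hsum' := mul_le_mul_right hsum (ENNReal.ofReal lam)⁻¹
  rw [mul_add, ← mul_assoc (ENNReal.ofReal lam)⁻¹ (ENNReal.ofReal lam),
    ENNReal.inv_mul_cancel hl0 ENNReal.ofReal_ne_top, one_mul] at hsum'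
  exact tsub_le_iff_left.2 hsum'

/-- The Palm expectation of the void probability of a ball is bounded by the void probability of a
smaller ball, weighted by the mass of the unit cube. -/
lemma palmExpectation_expNeg_le (lam r : ℝ) :
    palmExpectation P Λ 1 (expNeg lam (Metric.ball 0 (r + √d)))
      ≤ ∫⁻ ω, Λ ω (cube d 1) * expNeg lam (Metric.ball 0 r) (Λ ω) ∂P := by
  rw [palmExpectation, inv_one, one_mul]
  refine lintegral_mono fun ω => ?_
  refine (setLIntegral_mono (g := fun _ => expNeg lam (Metric.ball 0 r) (Λ ω)) measurable_const
    fun x hx => ?_).trans (by simp [mul_comm])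
  rw [expNeg_eq, expNeg_eq, shift_apply _ _ Metric.isOpen_ball.measurableSet]
  refine expMinus_antitone (mul_le_mul_right (measure_mono fun y hy => ?_) _)
  rw [Metric.mem_ball] at hy
  rw [Set.mem_preimage, Metric.mem_ball, dist_zero_right, ← dist_eq_norm]
  have := dist_triangle_right y x 0
  have := dist_le_of_mem_cube_one hx
  linarith

end PercolationProbability

/-! ### Exponential rates on the scale `r^d` -/

section LogRate

variable {d : ℕ}

lemma logRate_mono {r : ℝ} (hr : 0 ≤ r) {p q : ℝ≥0∞} (h : p ≤ q) : logRate d r p ≤ logRate d r q :=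
  mul_le_mul_of_nonneg_left (ENNReal.log_monotone h)
    (by exact_mod_cast inv_nonneg.2 (pow_nonneg hr d))

lemma logRate_ofReal_exp (r x : ℝ) :
    logRate d r (ENNReal.ofReal (Real.exp x)) = ((x / r ^ d : ℝ) : EReal) := by
  rw [logRate, ENNReal.log_ofReal_of_pos (Real.exp_pos x), Real.log_exp, ← EReal.coe_mul,
    div_eq_inv_mul]

lemma ofReal_exp_le_of_lt_logRate {r a : ℝ} (hr : 0 < r) {p : ℝ≥0∞}
    (h : (a : EReal) < logRate d r p) : ENNReal.ofReal (Real.exp (a * r ^ d)) ≤ p := by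
  by_contra hc
  have h2 := logRate_mono (d := d) hr.le (not_le.1 hc).le
  rw [logRate_ofReal_exp, mul_div_cancel_right₀ _ (pow_pos hr d).ne'] at h2
  exact absurd (h.trans_le h2) (lt_irrefl _)

lemma tendsto_add_pow_div_pow (d : ℕ) (k : ℝ) :
    Tendsto (fun r : ℝ => (r + k) ^ d / r ^ d) atTop (𝓝 1) := by
  have h : Tendsto (fun r : ℝ => (1 + k / r) ^ d) atTop (𝓝 ((1 + 0) ^ d)) :=
    (tendsto_const_nhds.add (tendsto_const_nhds.div_atTop tendsto_id)).pow d
  rw [add_zero, one_pow] at h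
  refine h.congr' ?_
  filter_upwards [eventually_gt_atTop 0] with r hr
  rw [← div_pow, add_div, div_self hr.ne']

lemma le_liminf_logRate {q : ℝ → ℝ≥0∞} {u : ℝ → ℝ} {a : ℝ}
    (h : ∀ᶠ r in atTop, ENNReal.ofReal (Real.exp (u r)) ≤ q r)
    (hu : Tendsto (fun r => u r / r ^ d) atTop (𝓝 a)) :
    (a : EReal) ≤ liminf (fun r => logRate d r (q r)) atTop := by
  have hu' : Tendsto (fun r => ((u r / r ^ d : ℝ) : EReal)) atTop (𝓝 (a : EReal)) :=
    (continuous_coe_real_ereal.tendsto a).comp hu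
  rw [← hu'.liminf_eq]
  refine liminf_le_liminf ?_
  filter_upwards [h, eventually_ge_atTop 0] with r hr h0
  rw [← logRate_ofReal_exp]
  exact logRate_mono h0 hr

/-- A bounded shift of the argument does not decrease the lower exponential rate. -/
lemma liminf_logRate_le_of_shift {p q : ℝ → ℝ≥0∞} {k : ℝ}
    (h : ∀ᶠ r in atTop, p (r + k) ≤ q r) :
    liminf (fun r => logRate d r (p r)) atTop ≤ liminf (fun r => logRate d r (q r)) atTop := by
  refine le_of_forall_lt fun c hc => ?_
  obtain ⟨a, hca, ha⟩ := EReal.lt_iff_exists_real_btwn.1 hc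
  refine hca.trans_le ?_
  have hev : ∀ᶠ r in atTop, (a : EReal) < logRate d r (p r) := eventually_lt_of_lt_liminf ha
  have hev' : ∀ᶠ r in atTop, ENNReal.ofReal (Real.exp (a * (r + k) ^ d)) ≤ q r := by
    filter_upwards [h, (tendsto_atTop_add_const_right atTop k tendsto_id).eventually hev,
      eventually_gt_atTop (-k)] with r h1 h2 h3
    simp only [id_eq] at h2
    exact (ofReal_exp_le_of_lt_logRate (by linarith) h2).trans h1
  refine le_liminf_logRate hev' ?_
  have := (tendsto_add_pow_div_pow d k).const_mul a
  rw [mul_one] at this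
  exact this.congr fun r => by ring

lemma tendsto_logRate {q : ℝ → ℝ≥0∞} {a : ℝ}
    (hlow : ∀ ε > 0, ∀ᶠ r : ℝ in atTop, ENNReal.ofReal (Real.exp (-(a + ε) * r ^ d)) ≤ q r)
    (hupp : ∀ ε > 0, ∀ᶠ r : ℝ in atTop, q r ≤ ENNReal.ofReal (Real.exp (-(a - ε) * r ^ d))) :
    Tendsto (fun r => logRate d r (q r)) atTop (𝓝 ((-a : ℝ) : EReal)) := by
  refine tendsto_order.2 ⟨fun l hl => ?_, fun l hl => ?_⟩
  · obtain ⟨c, hlc, hc⟩ := EReal.lt_iff_exists_real_btwn.1 hl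
    have hc' : c < -a := by exact_mod_cast hc
    filter_upwards [hlow (-a - c) (by linarith), eventually_gt_atTop 0] with r hr h0
    refine hlc.trans_le ?_
    have := logRate_mono (d := d) h0.le hr
    rwa [logRate_ofReal_exp, mul_div_cancel_right₀ _ (pow_pos h0 d).ne',
      show -(a + (-a - c)) = c by ring] at this
  · obtain ⟨c, hc, hlc⟩ := EReal.lt_iff_exists_real_btwn.1 hl
    have hc' : -a < c := by exact_mod_cast hc
    filter_upwards [hupp (c + a) (by linarith), eventually_gt_atTop 0] with r hr h0
    refine lt_of_le_of_lt ?_ hlc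
    have := logRate_mono (d := d) h0.le hr
    rwa [logRate_ofReal_exp, mul_div_cancel_right₀ _ (pow_pos h0 d).ne',
      show -(a - (c + a)) = c by ring] at this

end LogRate

/-! ### Part (i) -/

section IsolationBound

variable {Ω : Type*} [MeasurableSpace Ω] {d : ℕ} {P : Measure Ω} [IsProbabilityMeasure P]
  {Λ X : Ω → Measure (E d)} {lam : ℝ}

/-- The lower exponential rate of the probability not to percolate is at least that of the
probability to be isolated. -/
theorem liminf_logRate_palm_le (hlam : 0 < lam) (hΛ : IsStationaryRandomMeasure P Λ)
    (hmean : ∫⁻ ω, Λ ω (unitCube d) ∂P = 1)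
    (hX : IsCoxProcess P (fun ω => ENNReal.ofReal lam • Λ ω) X) :
    liminf (fun r : ℝ =>
        logRate d r (palmExpectation P Λ 1 (expNeg lam (Metric.ball 0 r)))) atTop
      ≤ liminf (fun r : ℝ => logRate d r (1 - percolationProbability P X lam r)) atTop := by
  -- One `√d` comes from recentring the Palm ball at the origin, the other from enlarging the ball
  -- so that it isolates every position in `Q_1`.
  refine liminf_logRate_le_of_shift (k := √d + √d) ?_
  filter_upwards [eventually_gt_atTop 0] with r hr
  rw [← add_assoc]
  exact (palmExpectation_expNeg_le lam (r + √d)).trans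
    (lintegral_le_one_sub_percolationProbability hlam hΛ hmean hX hr)

end IsolationBound

/-! ### Void probabilities of cubes and existence of the rate -/

section VoidProbability

variable {Ω : Type*} [MeasurableSpace Ω] {d : ℕ} {P : Measure Ω}
  {Λ : Ω → Measure (E d)} {lam : ℝ} {b : ℝ≥0}

/-- The probability that the Cox process with intensity `λ Λ` has no points in the cube `Q_a`. -/
def voidProb (P : Measure Ω) (Λ : Ω → Measure (E d)) (lam a : ℝ) : ℝ≥0∞ :=
  ∫⁻ ω, expNeg lam (cube d a) (Λ ω) ∂P

/-- The negative logarithm of the void probability of the cube `Q_a`. -/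
def voidCost (P : Measure Ω) (Λ : Ω → Measure (E d)) (lam a : ℝ) : ℝ :=
  -Real.log (voidProb P Λ lam a).toReal

lemma voidProb_le_one [IsProbabilityMeasure P] (lam a : ℝ) : voidProb P Λ lam a ≤ 1 :=
  (lintegral_mono fun _ => expMinus_le_one _).trans (by simp)

/-- Convexity: the graph of `exp(-t)` lies above its tangent at `c`. The inequality is arranged
without subtraction so that it also covers `t = ∞`. -/
lemma expMinus_add_mul_ge (c : ℝ) (t : ℝ≥0∞) :
    ENNReal.ofReal (Real.exp (-c) * (1 + c))
      ≤ expMinus t + ENNReal.ofReal (Real.exp (-c)) * t := by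
  rcases eq_or_ne t ∞ with rfl | ht
  · rw [ENNReal.mul_top (by simpa using Real.exp_pos _)]; simp
  · lift t to ℝ≥0 using ht
    rw [expMinus_of_ne_top ENNReal.coe_ne_top, ENNReal.coe_toReal, ← ENNReal.ofReal_coe_nnreal,
      ← ENNReal.ofReal_mul (Real.exp_pos _).le, ← ENNReal.ofReal_add (Real.exp_pos _).le
        (by positivity)]
    refine ENNReal.ofReal_le_ofReal ?_
    have h1 := Real.add_one_le_exp (c - t)
    have h2 : Real.exp (-(t : ℝ)) = Real.exp (-c) * Real.exp (c - t) := by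
      rw [← Real.exp_add]; congr 1; ring
    rw [h2]
    nlinarith [Real.exp_pos (-c)]

/-- Jensen's inequality, obtained by integrating the tangent bound at the mean `c = lam * a ^ d` and
cancelling the finite linear term. -/
lemma ofReal_exp_le_voidProb [IsProbabilityMeasure P] (hlam : 0 < lam) (hΛ : IsStationaryRandomMeasure P Λ)
    (hmean : ∫⁻ ω, Λ ω (unitCube d) ∂P = 1) {a : ℝ} (ha : 0 ≤ a) :
    ENNReal.ofReal (Real.exp (-(lam * a ^ d))) ≤ voidProb P Λ lam a := by
  set c := lam * a ^ d with hc
  have hc0 : 0 ≤ c := by positivity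
  have hQ := measurableSet_cube (d := d) a
  have hmean' : ∫⁻ ω, ENNReal.ofReal (Real.exp (-c)) * (ENNReal.ofReal lam * Λ ω (cube d a)) ∂P
      = ENNReal.ofReal (Real.exp (-c) * c) := by
    rw [lintegral_const_mul _ ((measurable_eval hΛ.measurable hQ).const_mul _),
      lintegral_const_mul _ (measurable_eval hΛ.measurable hQ),
      hΛ.lintegral_apply_eq_volume hmean hQ, cube_eq_box, volume_box,
      ← ENNReal.ofReal_pow ha, ← ENNReal.ofReal_mul hlam.le, ← ENNReal.ofReal_mul
        (Real.exp_pos _).le]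
  have h : ENNReal.ofReal (Real.exp (-c) * (1 + c))
      ≤ voidProb P Λ lam a + ENNReal.ofReal (Real.exp (-c) * c) := by
    rw [← hmean', voidProb, ← lintegral_add_right _
      (((measurable_eval hΛ.measurable hQ).const_mul _).const_mul _)]
    calc ENNReal.ofReal (Real.exp (-c) * (1 + c))
        = ∫⁻ _ω, ENNReal.ofReal (Real.exp (-c) * (1 + c)) ∂P := by simp
      _ ≤ _ := lintegral_mono fun ω => expMinus_add_mul_ge c _
  rw [mul_add, mul_one, ENNReal.ofReal_add (Real.exp_pos _).le (by positivity)] at h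
  exact (ENNReal.add_le_add_iff_right ENNReal.ofReal_ne_top).1 h

/-- The Jensen bound keeps the void probability away from zero, so the real logarithm in `voidCost`
never takes its default value here. -/
lemma voidProb_eq_ofReal_exp [IsProbabilityMeasure P] (hlam : 0 < lam) (hΛ : IsStationaryRandomMeasure P Λ)
    (hmean : ∫⁻ ω, Λ ω (unitCube d) ∂P = 1) {a : ℝ} (ha : 0 ≤ a) :
    voidProb P Λ lam a = ENNReal.ofReal (Real.exp (-voidCost P Λ lam a)) := by
  have h1 : voidProb P Λ lam a ≠ ∞ := ((voidProb_le_one lam a).trans_lt ENNReal.one_lt_top).ne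
  have h0 : voidProb P Λ lam a ≠ 0 := by
    have := ofReal_exp_le_voidProb hlam hΛ hmean ha
    exact (lt_of_lt_of_le (by simpa using Real.exp_pos _) this).ne'
  rw [voidCost, neg_neg, Real.exp_log (ENNReal.toReal_pos h0 h1), ENNReal.ofReal_toReal h1]

lemma voidCost_nonneg [IsProbabilityMeasure P] (lam a : ℝ) : 0 ≤ voidCost P Λ lam a := by
  rw [voidCost, neg_nonneg]
  exact Real.log_nonpos ENNReal.toReal_nonneg
    (ENNReal.toReal_le_of_le_ofReal zero_le_one (by simpa using voidProb_le_one lam a))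

lemma voidCost_le [IsProbabilityMeasure P] (hlam : 0 < lam) (hΛ : IsStationaryRandomMeasure P Λ)
    (hmean : ∫⁻ ω, Λ ω (unitCube d) ∂P = 1) {a : ℝ} (ha : 0 ≤ a) :
    voidCost P Λ lam a ≤ lam * a ^ d := by
  have h := ofReal_exp_le_voidProb hlam hΛ hmean ha
  rw [voidProb_eq_ofReal_exp hlam hΛ hmean ha, ENNReal.ofReal_le_ofReal_iff (Real.exp_pos _).le,
    Real.exp_le_exp] at h
  linarith

lemma expNeg_biUnion {ι : Type*} (lam : ℝ) (μ : Measure (E d)) (K : ι → Set (E d)) (F : Finset ι)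
    (hK : ∀ z, MeasurableSet (K z)) (hd : (F : Set ι).PairwiseDisjoint K) :
    expNeg lam (⋃ z ∈ F, K z) μ = ∏ z ∈ F, expNeg lam (K z) μ := by
  simp only [expNeg_eq]
  rw [measure_biUnion_finset hd fun z _ => hK z, Finset.mul_sum, expMinus_sum]

lemma pairwiseDisjoint_core {s β : ℝ} (hs : 0 < s) (hβ : 0 < β) (F : Set (Fin d → ℤ)) :
    F.PairwiseDisjoint (core s β) := fun z hz w hw h =>
  (pairwiseDisjoint_cell hs F hz hw h).mono (core_subset_cell hβ z) (core_subset_cell hβ w)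

lemma lintegral_expNeg_core (hΛ : IsStationaryRandomMeasure P Λ) (lam s β : ℝ) (z : Fin d → ℤ) :
    ∫⁻ ω, expNeg lam (core s β z) (Λ ω) ∂P = voidProb P Λ lam (s - 2 * β) := by
  rw [voidProb, cube_eq_box]
  exact hΛ.lintegral_box (g := fun t => expMinus (ENNReal.ofReal lam * t))
    (measurable_expMinus.comp (measurable_const_mul _)) _ _ _

lemma lintegral_expNeg_biUnion_core [IsProbabilityMeasure P] (hΛ : IsStationaryRandomMeasure P Λ) (hdep : IsDependent P Λ b)
    {s β : ℝ} (hs : 0 < s) (hβ : (b : ℝ) < β) (F : Finset (Fin d → ℤ)) :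
    ∫⁻ ω, expNeg lam (⋃ z ∈ F, core s β z) (Λ ω) ∂P = voidProb P Λ lam (s - 2 * β) ^ F.card := by
  have hβ0 : 0 < β := b.2.trans_lt hβ
  simp only [expNeg_biUnion lam _ _ F (measurableSet_core s β) (pairwiseDisjoint_core hs hβ0 _)]
  refine (hdep.lintegral_prod (g := fun t => expMinus (ENNReal.ofReal lam * t)) hΛ.measurable
    (b' := ENNReal.ofReal (2 * β)) ?_ (measurableSet_core s β)
    (measurable_expMinus.comp (measurable_const_mul _)) F
    fun z _ w _ h x hx y hy => edist_core_core hs h hx hy).trans ?_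
  rotate_left
  · exact (Finset.prod_congr rfl fun z _ => lintegral_expNeg_core hΛ lam s β z).trans
      (Finset.prod_const _)
  · rw [← ENNReal.ofReal_coe_nnreal]
    exact (ENNReal.ofReal_lt_ofReal_iff (by linarith)).2 (by linarith)

/-- With `β ≥ b + 1` every core is farther than `b` from `Q_1`. The Palm weight `Λ(Q_1)` is then
independent of the void event and contributes only its mean, one. -/
lemma lintegral_mul_expNeg_biUnion_core [IsProbabilityMeasure P] [NeZero d] (hΛ : IsStationaryRandomMeasure P Λ)
    (hmean : ∫⁻ ω, Λ ω (unitCube d) ∂P = 1) (hdep : IsDependent P Λ b)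
    {s β : ℝ} (hs : 0 < s) (hβ : (b : ℝ) + 1 ≤ β) (F : Finset (Fin d → ℤ)) :
    ∫⁻ ω, Λ ω (cube d 1) * expNeg lam (⋃ z ∈ F, core s β z) (Λ ω) ∂P
      = voidProb P Λ lam (s - 2 * β) ^ F.card := by
  have hβ0 : 0 < β := by have := b.2; linarith
  have h := hdep.lintegral_mul_prod_eq (g := fun t => expMinus (ENNReal.ofReal lam * t)) (h := id)
    hΛ.measurable (b' := ENNReal.ofReal (β - 1 / 2)) (by
      rw [← ENNReal.ofReal_coe_nnreal]
      have := b.2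
      exact (ENNReal.ofReal_lt_ofReal_iff (by linarith)).2 (by linarith))
    (measurableSet_cube 1) (measurableSet_core s β) measurable_id
    (measurable_expMinus.comp (measurable_const_mul _)) F
    fun z _ x hx y hy => edist_cube_core hs hx hy
  rw [← lintegral_expNeg_biUnion_core hΛ hdep hs (by linarith : (b : ℝ) < β) F]
  simp only [expNeg_biUnion lam _ _ F (measurableSet_core s β) (pairwiseDisjoint_core hs hβ0 _)]
  simp only [id_eq, hΛ.lintegral_cube_one hmean, one_mul] at h
  exact h

/-- Supermultiplicativity of the void probabilities up to corridors. -/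
lemma voidCost_superadditive [IsProbabilityMeasure P] (hlam : 0 < lam) (hΛ : IsStationaryRandomMeasure P Λ)
    (hmean : ∫⁻ ω, Λ ω (unitCube d) ∂P = 1) (hdep : IsDependent P Λ b) {β : ℝ} (hβ : (b : ℝ) < β)
    {a R : ℝ} (ha : 0 < a) (hR : 2 * (a + 2 * β) ≤ R) :
    (R - 2 * (a + 2 * β)) ^ d * voidCost P Λ lam a ≤ (a + 2 * β) ^ d * voidCost P Λ lam R := by
  have hβ0 : 0 < β := b.2.trans_lt hβ
  set s := a + 2 * β with hs
  have hs0 : 0 < s := by positivity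
  -- Cells meeting the cube of side `R - 2 * s` stay inside the cube of side `R`, while they cover
  -- the smaller one. This bounds their number from below.
  obtain ⟨F, hF, hcov⟩ := exists_finset_cell hs0 (isBounded_cube (d := d) (R - 2 * s))
  have hsub : ∀ z ∈ F, cell s z ⊆ cube d R := by
    intro z hz x hx i
    obtain ⟨y, hyz, hy⟩ := (hF z).1 hz
    have h1 := hx i
    have h2 := hyz i
    have h3 := hy i
    constructor <;> linarith
  have hcard : (R - 2 * s) ^ d ≤ F.card * s ^ d := by
    have h := volume_le_card_mul_pow F hcov
    rw [cube_eq_box, volume_box, ← ENNReal.ofReal_pow (by linarith), ← ENNReal.ofReal_pow hs0.le,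
      ← ENNReal.ofReal_natCast, ← ENNReal.ofReal_mul (by positivity),
      ENNReal.ofReal_le_ofReal_iff (by positivity)] at h
    exact h
  have hle : voidProb P Λ lam R ≤ voidProb P Λ lam a ^ F.card := by
    have h := lintegral_expNeg_biUnion_core (lam := lam) hΛ hdep hs0 hβ F
    rw [show s - 2 * β = a by rw [hs]; ring] at h
    rw [← h]
    refine lintegral_mono fun ω => expMinus_antitone (mul_le_mul_right (measure_mono ?_) _)
    exact Set.iUnion₂_subset fun z hz => (core_subset_cell hβ0 z).trans (hsub z hz)
  rw [voidProb_eq_ofReal_exp hlam hΛ hmean ha.le, voidProb_eq_ofReal_exp hlam hΛ hmean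
    (by linarith : 0 ≤ R), ← ENNReal.ofReal_pow (Real.exp_pos _).le, ← Real.exp_nat_mul,
    ENNReal.ofReal_le_ofReal_iff (Real.exp_pos _).le, Real.exp_le_exp] at hle
  calc (R - 2 * s) ^ d * voidCost P Λ lam a ≤ F.card * s ^ d * voidCost P Λ lam a :=
        mul_le_mul_of_nonneg_right hcard (voidCost_nonneg _ _)
    _ = s ^ d * (F.card * voidCost P Λ lam a) := by ring
    _ ≤ s ^ d * voidCost P Λ lam R := mul_le_mul_of_nonneg_left (by linarith) (by positivity)

/-- A function which is superadditive up to corridors has a rate. -/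
lemma exists_tendsto_div_pow {d : ℕ} {ψ : ℝ → ℝ} {β C : ℝ} (hβ : 0 < β) (h0 : ∀ a, 0 ≤ ψ a)
    (hC : ∀ a, 0 ≤ a → ψ a ≤ C * a ^ d)
    (h : ∀ a R, 0 < a → 2 * (a + 2 * β) ≤ R →
      (R - 2 * (a + 2 * β)) ^ d * ψ a ≤ (a + 2 * β) ^ d * ψ R) :
    ∃ I : ℝ, 0 ≤ I ∧ Tendsto (fun R : ℝ => ψ R / R ^ d) atTop (𝓝 I) := by
  have hC0 : 0 ≤ C := by simpa using (h0 1).trans (hC 1 zero_le_one)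
  set f : Set.Ioi (0 : ℝ) → ℝ := fun a => ψ a / (a + 2 * β) ^ d with hf
  have hbdd : BddAbove (Set.range f) := by
    refine ⟨C, ?_⟩
    rintro _ ⟨⟨a, ha⟩, rfl⟩
    have ha' : 0 < a := ha
    simp only [hf]
    rw [div_le_iff₀ (by positivity)]
    refine (hC a ha'.le).trans (mul_le_mul_of_nonneg_left ?_ hC0)
    exact pow_le_pow_left₀ ha'.le (by linarith) d
  have hne : Nonempty (Set.Ioi (0 : ℝ)) := ⟨⟨1, Set.mem_Ioi.2 one_pos⟩⟩
  -- As in Fekete's lemma the limit is a supremum, here of the cost per volume of a cell that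
  -- includes its corridor.
  set I := ⨆ a, f a with hI
  have hfI : ∀ a : ℝ, 0 < a → ψ a / (a + 2 * β) ^ d ≤ I := fun a ha => le_ciSup hbdd ⟨a, ha⟩
  have hI0 : 0 ≤ I := le_trans (div_nonneg (h0 1) (by positivity)) (hfI 1 one_pos)
  refine ⟨I, hI0, tendsto_order.2 ⟨fun l hl => ?_, fun l hl => ?_⟩⟩
  · obtain ⟨⟨a, ha⟩, hla⟩ := exists_lt_of_lt_ciSup hl
    have ha' : 0 < a := ha
    set s := a + 2 * β with hs
    have hs0 : 0 < s := by positivity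
    have hlim := (tendsto_add_pow_div_pow d (-(2 * s))).mul_const (f ⟨a, ha⟩)
    rw [one_mul] at hlim
    filter_upwards [hlim.eventually (lt_mem_nhds hla), eventually_ge_atTop (2 * s),
      eventually_gt_atTop 0] with R h1 h2 h3
    refine h1.trans_le ?_
    have h4 := h a R ha' h2
    simp only [hf]
    rw [div_mul_div_comm, div_le_div_iff₀ (by positivity) (by positivity)]
    calc (R + -(2 * s)) ^ d * ψ a * R ^ d = ((R - 2 * s) ^ d * ψ a) * R ^ d := by
          rw [sub_eq_add_neg]
      _ ≤ (s ^ d * ψ R) * R ^ d := mul_le_mul_of_nonneg_right h4 (by positivity)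
      _ = ψ R * (R ^ d * (a + 2 * β) ^ d) := by rw [← hs]; ring
  -- The upper bound is immediate from the supremum: `ψ R ≤ I * (R + 2 * β) ^ d`, and the corridor
  -- is negligible for large `R`.
  · have hlim := (tendsto_add_pow_div_pow d (2 * β)).mul_const I
    rw [one_mul] at hlim
    filter_upwards [hlim.eventually (gt_mem_nhds hl), eventually_gt_atTop 0] with R h1 h2
    refine lt_of_le_of_lt ?_ h1
    have h3 := hfI R h2
    rw [div_le_iff₀ (by positivity)] at h3
    rw [div_mul_eq_mul_div]
    exact div_le_div_of_nonneg_right (by linarith) (by positivity)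

lemma exists_tendsto_voidCost [IsProbabilityMeasure P] (hlam : 0 < lam) (hΛ : IsStationaryRandomMeasure P Λ)
    (hmean : ∫⁻ ω, Λ ω (unitCube d) ∂P = 1) (hdep : IsDependent P Λ b) :
    ∃ I : ℝ, 0 ≤ I ∧ Tendsto (fun R : ℝ => voidCost P Λ lam R / R ^ d) atTop (𝓝 I) :=
  exists_tendsto_div_pow (β := b + 1) (C := lam) (by positivity) (voidCost_nonneg lam)
    (fun _ ha => voidCost_le hlam hΛ hmean ha)
    (fun _ _ ha hR => voidCost_superadditive hlam hΛ hmean hdep (lt_add_one _) ha hR)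

lemma tendsto_logRate_voidProb [IsProbabilityMeasure P] (hlam : 0 < lam) (hΛ : IsStationaryRandomMeasure P Λ)
    (hmean : ∫⁻ ω, Λ ω (unitCube d) ∂P = 1) {I : ℝ}
    (hI : Tendsto (fun R : ℝ => voidCost P Λ lam R / R ^ d) atTop (𝓝 I)) :
    Tendsto (fun r : ℝ => logRate d r (voidProb P Λ lam r)) atTop (𝓝 ((-I : ℝ) : EReal)) := by
  have h := (continuous_coe_real_ereal.tendsto _).comp hI.neg
  refine h.congr' ?_
  filter_upwards [eventually_ge_atTop 0] with r hr
  rw [voidProb_eq_ofReal_exp hlam hΛ hmean hr, logRate_ofReal_exp, Function.comp_apply, neg_div]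

end VoidProbability

/-! ### Exponential moments and corridors -/

/-- The exponential function on `[0, ∞]`. -/
def expPlus (t : ℝ≥0∞) : ℝ≥0∞ := EReal.exp (t : EReal)

lemma expPlus_mono : Monotone expPlus := fun s t h => by
  unfold expPlus
  rw [EReal.exp_le_exp_iff]
  exact_mod_cast h

lemma measurable_expPlus : Measurable expPlus := expPlus_mono.measurable

lemma expPlus_zero : expPlus 0 = 1 := by simp [expPlus]

lemma one_le_expPlus (t : ℝ≥0∞) : 1 ≤ expPlus t := expPlus_zero.symm.le.trans (expPlus_mono zero_le)

lemma expPlus_add (s t : ℝ≥0∞) : expPlus (s + t) = expPlus s * expPlus t := by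
  unfold expPlus
  rw [← EReal.exp_add, EReal.coe_ennreal_add]

lemma expPlus_sum {ι : Type*} (F : Finset ι) (f : ι → ℝ≥0∞) :
    expPlus (∑ i ∈ F, f i) = ∏ i ∈ F, expPlus (f i) := by
  classical
  induction F using Finset.induction_on with
  | empty => simp [expPlus_zero]
  | insert i F hi ih => rw [Finset.sum_insert hi, Finset.prod_insert hi, expPlus_add, ih]

lemma expPlus_coe (t : ℝ≥0) : expPlus t = ENNReal.ofReal (Real.exp t) := rfl

lemma le_expPlus (t : ℝ≥0∞) : t ≤ expPlus t := by
  rcases eq_or_ne t ∞ with rfl | ht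
  · simp [expPlus]
  · lift t to ℝ≥0 using ht
    rw [expPlus_coe, ← ENNReal.ofReal_coe_nnreal]
    exact ENNReal.ofReal_le_ofReal (by linarith [Real.add_one_le_exp (t : ℝ)])

section ExponentialMoments

variable {Ω : Type*} [MeasurableSpace Ω] {d : ℕ} {P : Measure Ω}
  {Λ : Ω → Measure (E d)} {b : ℝ≥0}

/-- The closed lattice box `u + [0,1]^d`. -/
def unitBox (u : Fin d → ℤ) : Set (E d) := box (fun i => (u i : ℝ)) 1

lemma mem_unitBox_floor (x : E d) : x ∈ unitBox fun i => ⌊x i⌋ := fun _ =>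
  ⟨Int.floor_le _, (Int.lt_floor_add_one _).le⟩

/-- Distinct lattice points congruent modulo `m` differ by at least `m` in some coordinate; the side
length of the boxes takes away one. -/
lemma edist_unitBox {m : ℕ} {u v : Fin d → ℤ} (h : u ≠ v)
    (hc : (fun i => (u i : ZMod m)) = fun i => (v i : ZMod m)) {x y : E d} (hx : x ∈ unitBox u)
    (hy : y ∈ unitBox v) : ENNReal.ofReal (m - 1) ≤ edist x y := by
  obtain ⟨i, hi⟩ := Function.ne_iff.1 h
  have hdvd : (m : ℤ) ∣ v i - u i := (ZMod.intCast_eq_intCast_iff_dvd_sub _ _ _).1 (congrFun hc i)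
  have hle : (m : ℤ) ≤ |v i - u i| :=
    Int.le_of_dvd (abs_pos.2 (sub_ne_zero.2 fun h => hi h.symm)) ((dvd_abs _ _).2 hdvd)
  refine ofReal_le_edist_of_coord i ?_
  have h1 := hx i
  have h2 := hy i
  rw [le_abs]
  rcases le_abs.1 hle with hle | hle
  · have : (m : ℝ) ≤ v i - u i := by exact_mod_cast hle
    right; linarith
  · have : (m : ℝ) ≤ -(v i - u i) := by exact_mod_cast hle
    left; linarith

lemma lintegral_expPlus_unitBox (hΛ : IsStationaryRandomMeasure P Λ) (γ : ℝ≥0∞) (u : Fin d → ℤ) :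
    ∫⁻ ω, expPlus (γ * Λ ω (unitBox u)) ∂P = ∫⁻ ω, expPlus (γ * Λ ω (cube d 1)) ∂P := by
  rw [cube_eq_box]
  exact hΛ.lintegral_box (g := fun t => expPlus (γ * t))
    (measurable_expPlus.comp (measurable_const_mul _)) _ _ _

/-- Exponential moments of the mass of finitely many unit boxes grow at most exponentially in
their number. -/
lemma lintegral_expPlus_sum_le [IsProbabilityMeasure P] (hΛ : IsStationaryRandomMeasure P Λ) (hdep : IsDependent P Λ b)
    {m : ℕ} [NeZero m] (hm : (b : ℝ) + 1 < m) (γ : ℝ≥0∞) (G : Finset (Fin d → ℤ)) :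
    ∫⁻ ω, expPlus (γ * ∑ u ∈ G, Λ ω (unitBox u)) ∂P
      ≤ (m ^ d : ℕ) * (∫⁻ ω, expPlus (γ * (m ^ d : ℕ) * Λ ω (cube d 1)) ∂P) ^ G.card := by
  classical
  set D : ℕ := m ^ d with hD
  have hcard : Fintype.card (Fin d → ZMod m) = D := by simp [hD, ZMod.card]
  -- Colouring by residues modulo `m`: since `m - 1 > b`, boxes of one colour carry independent
  -- masses.
  let ρ : (Fin d → ℤ) → (Fin d → ZMod m) := fun u i => (u i : ZMod m)
  set C := ∫⁻ ω, expPlus (γ * D * Λ ω (cube d 1)) ∂P with hC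
  have hC1 : 1 ≤ C := by
    calc (1 : ℝ≥0∞) = ∫⁻ _ω, 1 ∂P := by simp
      _ ≤ C := lintegral_mono fun ω => one_le_expPlus _
  have hK : ∀ u : Fin d → ℤ, MeasurableSet (unitBox u) := fun u => measurableSet_box _ _
  have hpt : ∀ ω, expPlus (γ * ∑ u ∈ G, Λ ω (unitBox u))
      ≤ ∑ c, ∏ u ∈ G with ρ u = c, expPlus (γ * D * Λ ω (unitBox u)) := by
    intro ω
    -- The heaviest colour class carries at least the fraction `1 / D` of the mass. Summing over all
    -- possible heaviest classes takes the place of Hölder's inequality.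
    obtain ⟨c, -, hc⟩ := Finset.exists_max_image Finset.univ
      (fun c => ∑ u ∈ G with ρ u = c, Λ ω (unitBox u)) ⟨0, Finset.mem_univ _⟩
    have h1 : ∑ u ∈ G, Λ ω (unitBox u) ≤ D * ∑ u ∈ G with ρ u = c, Λ ω (unitBox u) := by
      rw [← Finset.sum_fiberwise G ρ]
      refine (Finset.sum_le_card_nsmul _ _ _ hc).trans_eq ?_
      rw [Finset.card_univ, hcard, nsmul_eq_mul]
    calc expPlus (γ * ∑ u ∈ G, Λ ω (unitBox u))
        ≤ expPlus (∑ u ∈ G with ρ u = c, γ * D * Λ ω (unitBox u)) := by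
          refine expPlus_mono ?_
          rw [← Finset.mul_sum, mul_assoc]
          exact mul_le_mul_right h1 _
      _ = ∏ u ∈ G with ρ u = c, expPlus (γ * D * Λ ω (unitBox u)) := expPlus_sum _ _
      _ ≤ _ := Finset.single_le_sum
          (f := fun c => ∏ u ∈ G with ρ u = c, expPlus (γ * D * Λ ω (unitBox u)))
          (fun _ _ => zero_le) (Finset.mem_univ c)
  have hmeas : ∀ u : Fin d → ℤ, Measurable fun ω => expPlus (γ * D * Λ ω (unitBox u)) := fun u =>
    measurable_expPlus.comp ((measurable_eval hΛ.measurable (hK u)).const_mul _)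
  have hclass : ∀ c, ∫⁻ ω, ∏ u ∈ G with ρ u = c, expPlus (γ * D * Λ ω (unitBox u)) ∂P
      ≤ C ^ G.card := by
    intro c
    have hb : (b : ℝ≥0∞) < ENNReal.ofReal (m - 1) := by
      rw [← ENNReal.ofReal_coe_nnreal]
      have := b.2
      exact (ENNReal.ofReal_lt_ofReal_iff (by linarith)).2 (by linarith)
    rw [hdep.lintegral_prod (g := fun t => expPlus (γ * D * t)) hΛ.measurable hb hK
      (measurable_expPlus.comp (measurable_const_mul _)) _ ?_]
    · rw [Finset.prod_congr rfl fun u _ => lintegral_expPlus_unitBox hΛ (γ * D) u,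
        Finset.prod_const]
      exact pow_le_pow_right₀ hC1 (Finset.card_filter_le _ _)
    · intro u hu v hv huv x hx y hy
      exact edist_unitBox huv ((Finset.mem_filter.1 hu).2.trans (Finset.mem_filter.1 hv).2.symm)
        hx hy
  calc ∫⁻ ω, expPlus (γ * ∑ u ∈ G, Λ ω (unitBox u)) ∂P
      ≤ ∫⁻ ω, ∑ c, ∏ u ∈ G with ρ u = c, expPlus (γ * D * Λ ω (unitBox u)) ∂P :=
        lintegral_mono hpt
    _ = ∑ c, ∫⁻ ω, ∏ u ∈ G with ρ u = c, expPlus (γ * D * Λ ω (unitBox u)) ∂P :=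
        lintegral_finsetSum _ fun c _ => Finset.measurable_prod _ fun u _ => hmeas u
    _ ≤ ∑ _c : Fin d → ZMod m, C ^ G.card := Finset.sum_le_sum fun c _ => hclass c
    _ = D * C ^ G.card := by rw [Finset.sum_const, Finset.card_univ, hcard, nsmul_eq_mul]

/-- The offsets of the unit boxes that cover a cell of side length `n` outside its core. -/
def corridor (d : ℕ) (n β : ℕ) : Finset (Fin d → ℤ) :=
  Fintype.piFinset (fun _ => Finset.Ico (0 : ℤ) n) \
    Fintype.piFinset (fun _ => Finset.Ico (β : ℤ) (n - β))

lemma card_corridor {n β : ℕ} (h : 2 * β ≤ n) :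
    (corridor d n β).card = n ^ d - (n - 2 * β) ^ d := by
  rw [corridor, Finset.card_sdiff_of_subset]
  · simp only [Fintype.card_piFinset, Int.card_Ico, Finset.prod_const, Finset.card_univ,
      Fintype.card_fin]
    congr 2; omega
  · exact Fintype.piFinset_subset _ _ fun _ => Finset.Ico_subset_Ico (by positivity) (by omega)

/-- The mass of a set covered by cells is at most the mass of the cores plus the mass of the unit
boxes in the corridors. -/
lemma exists_corridor_cover {n β : ℕ} (h : 2 * β ≤ n) (F : Finset (Fin d → ℤ)) :
    ∃ G : Finset (Fin d → ℤ), G.card ≤ F.card * (n ^ d - (n - 2 * β) ^ d) ∧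
      ⋃ z ∈ F, cell (n : ℝ) z ⊆ (⋃ z ∈ F, core n β z) ∪ ⋃ u ∈ G, unitBox u := by
  classical
  refine ⟨(F ×ˢ corridor d n β).image fun q => fun i => n * q.1 i + q.2 i, ?_, ?_⟩
  · refine Finset.card_image_le.trans ?_
    rw [Finset.card_product, card_corridor h]
  · intro x hx
    simp only [Set.mem_iUnion] at hx
    obtain ⟨z, hz, hx⟩ := hx
    by_cases hc : x ∈ core (n : ℝ) β z
    · exact Or.inl (Set.mem_biUnion hz hc)
    · refine Or.inr (Set.mem_biUnion (x := fun i => ⌊x i⌋) ?_ (mem_unitBox_floor x))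
      simp only [Finset.coe_image, Set.mem_image, Finset.mem_coe, Finset.mem_product, Prod.exists]
      refine ⟨z, fun i => ⌊x i⌋ - n * z i, ⟨hz, ?_⟩, by funext i; ring⟩
      simp only [corridor, Finset.mem_sdiff, Fintype.mem_piFinset, Finset.mem_Ico]
      refine ⟨fun i => ?_, fun hin => hc fun i => ?_⟩
      · have h1 := hx i
        constructor
        · have : (n * z i : ℤ) ≤ ⌊x i⌋ := Int.le_floor.2 (by push_cast; exact h1.1)
          linarith
        · have : ⌊x i⌋ < (n * z i + n : ℤ) := Int.floor_lt.2 (by push_cast; exact h1.2)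
          linarith
      · obtain ⟨h1, h2⟩ := hin i
        have h3 : (β + n * z i : ℤ) ≤ ⌊x i⌋ := by linarith
        have h4 : ⌊x i⌋ + 1 ≤ (n * z i + n - β : ℤ) := by linarith
        have h5 := Int.le_floor.1 h3
        have h6 : ((⌊x i⌋ + 1 : ℤ) : ℝ) ≤ ((n * z i + n - β : ℤ) : ℝ) := by exact_mod_cast h4
        have h7 := Int.lt_floor_add_one (x i)
        push_cast at h5 h6
        constructor <;> linarith

end ExponentialMoments

/-! ### Lower bound: emptying a ball -/

section IsolationLowerBound

variable {Ω : Type*} [MeasurableSpace Ω] {d : ℕ} {P : Measure Ω} [IsProbabilityMeasure P]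
  {Λ X : Ω → Measure (E d)} {lam : ℝ} {b : ℝ≥0}

/-- The volume of the unit ball. -/
def ballVolume (d : ℕ) : ℝ := (volume (Metric.ball (0 : E d) 1)).toReal

lemma ballVolume_nonneg : 0 ≤ ballVolume d := ENNReal.toReal_nonneg

lemma volume_ball_eq [NeZero d] {R : ℝ} (hR : 0 ≤ R) :
    volume (Metric.ball (0 : E d) R) = ENNReal.ofReal (ballVolume d * R ^ d) := by
  rw [Measure.addHaar_ball _ _ hR, finrank_euclideanSpace_fin, mul_comm, ballVolume,
    ENNReal.ofReal_mul ENNReal.toReal_nonneg, ENNReal.ofReal_toReal measure_ball_lt_top.ne]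

/-- Truncation of the mass `t` at the level `τ`. -/
lemma one_le_exp_mul_add {lam α τ : ℝ} (hlam : 0 ≤ lam) (hα : 0 ≤ α) (hτ : 0 ≤ τ) (t : ℝ≥0∞) :
    1 ≤ ENNReal.ofReal (Real.exp (lam * τ)) * expMinus (ENNReal.ofReal lam * t)
      + ENNReal.ofReal (Real.exp (-(α * τ))) * expPlus (ENNReal.ofReal α * t) := by
  rcases le_total t (ENNReal.ofReal τ) with h | h
  · refine le_trans ?_ le_self_add
    calc (1 : ℝ≥0∞) = ENNReal.ofReal (Real.exp (lam * τ))
          * expMinus (ENNReal.ofReal lam * ENNReal.ofReal τ) := by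
          rw [← ENNReal.ofReal_mul hlam, expMinus_ofReal (by positivity),
            ← ENNReal.ofReal_mul (Real.exp_pos _).le, ← Real.exp_add]
          simp
      _ ≤ _ := mul_le_mul_right (expMinus_antitone (mul_le_mul_right h _)) _
  · refine le_trans ?_ le_add_self
    calc (1 : ℝ≥0∞) = ENNReal.ofReal (Real.exp (-(α * τ)))
          * expPlus (ENNReal.ofReal α * ENNReal.ofReal τ) := by
          rw [← ENNReal.ofReal_mul hα, ENNReal.ofReal, ENNReal.ofReal, expPlus_coe,
            Real.coe_toNNReal _ (by positivity), ← ENNReal.ofReal,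
            ← ENNReal.ofReal_mul (Real.exp_pos _).le, ← Real.exp_add]
          simp
      _ ≤ _ := mul_le_mul_right (expPlus_mono (mul_le_mul_right h _)) _

/-- The void probability of cores is controlled by that of the ball, up to the exponential cost of
emptying the corridors and an error from large corridor masses. -/
lemma voidProb_pow_le [NeZero d] (hlam : 0 < lam) (hΛ : IsStationaryRandomMeasure P Λ)
    (hmean : ∫⁻ ω, Λ ω (unitCube d) ∂P = 1) (hdep : IsDependent P Λ b) {m : ℕ} [NeZero m]
    (hm : (b : ℝ) + 1 < m) {β : ℕ} (hβ : (b : ℝ) + 1 ≤ β) {U : Finset (Fin d → ℤ)}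
    (hU : cube d 1 ⊆ ⋃ u ∈ U, unitBox u) {α : ℝ} (hα : 1 ≤ α) {n : ℕ} (hn : 2 * β < n) {R : ℝ}
    (hR : 0 ≤ R) {τ : ℝ} (hτ : 0 ≤ τ) :
    ∃ N : ℕ, (N : ℝ) * n ^ d ≤ ballVolume d * (R + n * √d) ^ d ∧
      voidProb P Λ lam (n - 2 * β) ^ N ≤ ENNReal.ofReal (Real.exp (lam * τ))
          * ∫⁻ ω, Λ ω (cube d 1) * expNeg lam (Metric.ball 0 R) (Λ ω) ∂P
        + ENNReal.ofReal (Real.exp (-(α * τ))) * ((m ^ d : ℕ)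
          * (∫⁻ ω, expPlus (ENNReal.ofReal (2 * α) * (m ^ d : ℕ) * Λ ω (cube d 1)) ∂P)
            ^ (U.card + N * (n ^ d - (n - 2 * β) ^ d))) := by
  classical
  have hn0 : (0 : ℝ) < n := by exact_mod_cast (by omega : 0 < n)
  have hQ := measurableSet_cube (d := d) 1
  obtain ⟨F, hF, hcov⟩ := exists_finset_cell hn0 (Metric.isBounded_ball (x := (0 : E d)) (r := R))
  obtain ⟨G, hGcard, hG⟩ := exists_corridor_cover hn.le F
  refine ⟨F.card, ?_, ?_⟩
  · have hsub : ∀ z ∈ F, cell (n : ℝ) z ⊆ Metric.ball 0 (R + n * √d) := by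
      intro z hz x hx
      obtain ⟨y, hyz, hy⟩ := (hF z).1 hz
      rw [Metric.mem_ball] at hy ⊢
      have h1 := dist_le_of_mem_cell hn0 hx hyz
      have h2 := dist_triangle x y 0
      linarith
    have h := card_mul_pow_le_volume hn0 F hsub
    rw [volume_ball_eq (by positivity), ← ENNReal.ofReal_pow hn0.le, ← ENNReal.ofReal_natCast,
      ← ENNReal.ofReal_mul (by positivity), ENNReal.ofReal_le_ofReal_iff
        (mul_nonneg ballVolume_nonneg (by positivity))] at h
    exact h
  · set C := ∫⁻ ω, expPlus (ENNReal.ofReal (2 * α) * (m ^ d : ℕ) * Λ ω (cube d 1)) ∂P with hC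
    have hC1 : 1 ≤ C := by
      calc (1 : ℝ≥0∞) = ∫⁻ _ω, 1 ∂P := by simp
        _ ≤ C := lintegral_mono fun ω => one_le_expPlus _
    let T : Ω → ℝ≥0∞ := fun ω => ∑ u ∈ G, Λ ω (unitBox u)
    have hpt : ∀ ω, Λ ω (cube d 1) * expNeg lam (⋃ z ∈ F, core n β z) (Λ ω)
        ≤ ENNReal.ofReal (Real.exp (lam * τ))
            * (Λ ω (cube d 1) * expNeg lam (Metric.ball 0 R) (Λ ω))
          + ENNReal.ofReal (Real.exp (-(α * τ)))
            * expPlus (ENNReal.ofReal (2 * α) * ∑ u ∈ U ∪ G, Λ ω (unitBox u)) := by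
      intro ω
      set Y := Λ ω (cube d 1) with hY
      set K := Λ ω (⋃ z ∈ F, core n β z) with hK
      have hball : Λ ω (Metric.ball 0 R) ≤ K + T ω :=
        (measure_mono (hcov.trans hG)).trans ((measure_union_le _ _).trans
          (add_le_add le_rfl (measure_biUnion_finset_le _ _)))
      have hYU : Y ≤ ∑ u ∈ U, Λ ω (unitBox u) :=
        (measure_mono hU).trans (measure_biUnion_finset_le _ _)
      have h1 : expMinus (ENNReal.ofReal lam * K) * expMinus (ENNReal.ofReal lam * T ω)
          ≤ expNeg lam (Metric.ball 0 R) (Λ ω) := by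
        rw [← expMinus_add, ← mul_add, expNeg_eq]
        exact expMinus_antitone (mul_le_mul_right hball _)
      -- The factor `Y` is absorbed through `Y ≤ exp Y`. Since `α ≥ 1`, both exponents are at most
      -- `α` times the mass of the boxes in `U ∪ G`, whence the constant `2 * α`.
      have h2 : Y * expPlus (ENNReal.ofReal α * T ω)
          ≤ expPlus (ENNReal.ofReal (2 * α) * ∑ u ∈ U ∪ G, Λ ω (unitBox u)) := by
        have hUs : ∑ u ∈ U, Λ ω (unitBox u) ≤ ∑ u ∈ U ∪ G, Λ ω (unitBox u) :=
          Finset.sum_le_sum_of_subset Finset.subset_union_left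
        have hGs : T ω ≤ ∑ u ∈ U ∪ G, Λ ω (unitBox u) :=
          Finset.sum_le_sum_of_subset Finset.subset_union_right
        have hα1 : (1 : ℝ≥0∞) ≤ ENNReal.ofReal α := by simpa using hα
        refine (mul_le_mul_left (le_expPlus Y) _).trans ?_
        rw [← expPlus_add]
        refine expPlus_mono ?_
        rw [two_mul, ENNReal.ofReal_add (by linarith) (by linarith), add_mul]
        refine add_le_add ?_ (mul_le_mul_right hGs _)
        calc Y ≤ 1 * ∑ u ∈ U ∪ G, Λ ω (unitBox u) := by rw [one_mul]; exact hYU.trans hUs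
          _ ≤ _ := mul_le_mul_left hα1 _
      have h3 := one_le_exp_mul_add hlam.le (by linarith : 0 ≤ α) hτ (T ω)
      rw [expNeg_eq]
      set κ := expMinus (ENNReal.ofReal lam * K)
      calc Y * κ ≤ Y * κ * (ENNReal.ofReal (Real.exp (lam * τ)) * expMinus (ENNReal.ofReal lam * T ω)
            + ENNReal.ofReal (Real.exp (-(α * τ))) * expPlus (ENNReal.ofReal α * T ω)) := by
            conv_lhs => rw [← mul_one (Y * κ)]
            exact mul_le_mul_right h3 _
        _ = ENNReal.ofReal (Real.exp (lam * τ)) * (Y * (κ * expMinus (ENNReal.ofReal lam * T ω)))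
            + ENNReal.ofReal (Real.exp (-(α * τ)))
              * ((Y * expPlus (ENNReal.ofReal α * T ω)) * κ) := by ring
        _ ≤ _ := by
            refine add_le_add (mul_le_mul_right (mul_le_mul_right h1 _) _) (mul_le_mul_right ?_ _)
            calc (Y * expPlus (ENNReal.ofReal α * T ω)) * κ
                ≤ expPlus (ENNReal.ofReal (2 * α) * ∑ u ∈ U ∪ G, Λ ω (unitBox u)) * 1 :=
                  mul_le_mul' h2 (expMinus_le_one _)
              _ = _ := mul_one _
    have hm1 : Measurable fun ω => Λ ω (cube d 1) * expNeg lam (Metric.ball 0 R) (Λ ω) :=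
      (measurable_eval hΛ.measurable hQ).mul (measurable_expMinus.comp
        ((measurable_eval hΛ.measurable Metric.isOpen_ball.measurableSet).const_mul _))
    have hm2 : Measurable fun ω =>
        expPlus (ENNReal.ofReal (2 * α) * ∑ u ∈ U ∪ G, Λ ω (unitBox u)) :=
      measurable_expPlus.comp ((Finset.measurable_sum _ fun u _ =>
        measurable_eval hΛ.measurable (measurableSet_box _ _)).const_mul _)
    rw [← lintegral_mul_expNeg_biUnion_core hΛ hmean hdep hn0 hβ F]
    refine (lintegral_mono hpt).trans ?_
    rw [lintegral_add_left (hm1.const_mul _), lintegral_const_mul _ hm1, lintegral_const_mul _ hm2]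
    refine add_le_add le_rfl (mul_le_mul_right ?_ _)
    refine (lintegral_expPlus_sum_le hΛ hdep hm _ _).trans (mul_le_mul_right ?_ _)
    exact pow_le_pow_right₀ hC1 ((Finset.card_union_le _ _).trans (by omega))

lemma tendsto_corridor_fraction (d β : ℕ) :
    Tendsto (fun n : ℕ => ((n ^ d - (n - 2 * β) ^ d : ℕ) : ℝ) / (n : ℝ) ^ d) atTop (𝓝 0) := by
  have h := ((tendsto_add_pow_div_pow d (-(2 * β : ℝ))).comp
    (tendsto_natCast_atTop_atTop (R := ℝ))).const_sub 1
  rw [sub_self] at h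
  refine h.congr' ?_
  filter_upwards [eventually_gt_atTop (2 * β)] with n hn
  have hn0 : (n : ℝ) ^ d ≠ 0 := pow_ne_zero _ (by exact_mod_cast (by omega : n ≠ 0))
  rw [Nat.cast_sub (Nat.pow_le_pow_left (Nat.sub_le _ _) d), Function.comp_apply, eq_div_iff hn0,
    sub_mul, div_mul_cancel₀ _ hn0, Nat.cast_pow, Nat.cast_pow, Nat.cast_sub hn.le]
  push_cast
  ring

/-- Lower bound for the probability that the ball `B_R` is empty, weighted by the mass of the unit
cube. -/
lemma eventually_le_lintegral_expNeg_ball [NeZero d] (hlam : 0 < lam)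
    (hΛ : IsStationaryRandomMeasure P Λ) (hmean : ∫⁻ ω, Λ ω (unitCube d) ∂P = 1)
    (hdep : IsDependent P Λ b) (hexp : HasAllExpMoments P (fun ω => Λ ω (cube d 1))) {I : ℝ}
    (hI0 : 0 ≤ I) (hI : Tendsto (fun R : ℝ => voidCost P Λ lam R / R ^ d) atTop (𝓝 I)) {ε₀ : ℝ}
    (hε₀ : 0 < ε₀) :
    ∀ᶠ R : ℝ in atTop, ENNReal.ofReal (Real.exp (-(ballVolume d * I + ε₀) * R ^ d))
      ≤ ∫⁻ ω, Λ ω (cube d 1) * expNeg lam (Metric.ball 0 R) (Λ ω) ∂P := by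
  set v := ballVolume d with hv
  have hv0 : 0 ≤ v := ballVolume_nonneg
  -- For `ε ≤ 1` the left side is at most `v * I + ε * (v * (I + 2) + 2)`, which dictates the choice
  -- of `ε`.
  obtain ⟨ε, hε, hε1, hεv⟩ : ∃ ε : ℝ, 0 < ε ∧ ε ≤ 1 ∧ (I + ε) * (1 + ε) * v + 2 * ε ≤ v * I + ε₀ := by
    refine ⟨min 1 (ε₀ / (v * (I + 2) + 2)), by positivity, min_le_left _ _, ?_⟩
    set ε := min 1 (ε₀ / (v * (I + 2) + 2))
    have h1 : ε ≤ 1 := min_le_left _ _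
    have h0 : 0 < ε := by positivity
    have h2 : ε * (v * (I + 2) + 2) ≤ ε₀ := by
      rw [← le_div_iff₀ (by positivity)]; exact min_le_right _ _
    nlinarith [mul_nonneg h0.le hv0, mul_nonneg (mul_nonneg h0.le hv0) (sub_nonneg.2 h1)]
  set A := (I + ε) * (1 + ε) * v with hA
  have hA0 : 0 ≤ A := by positivity
  -- Corridor mass up to `δ * R ^ d` costs a factor `exp(ε * R ^ d)`. With `α * δ ≥ A + 2` the
  -- truncation error starts at `exp(-(A + 2) * R ^ d)`: one unit of `R ^ d` is spent on the
  -- exponential moments, the other makes the error negligible.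
  set δ := ε / lam with hδ
  have hδ0 : 0 < δ := by positivity
  set α := max 1 ((A + 2) / δ) with hα
  have hα1 : 1 ≤ α := le_max_left _ _
  have hαδ : A + 2 ≤ α * δ := by rw [← div_le_iff₀ hδ0]; exact le_max_right _ _
  obtain ⟨β, hβ⟩ := exists_nat_ge ((b : ℝ) + 1)
  obtain ⟨m, hm⟩ := exists_nat_gt ((b : ℝ) + 1)
  have : NeZero m := ⟨by rintro rfl; have := b.2; norm_num at hm; linarith⟩
  obtain ⟨U, hU⟩ : ∃ U : Finset (Fin d → ℤ), cube d 1 ⊆ ⋃ u ∈ U, unitBox u := by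
    obtain ⟨U, -, hU⟩ := exists_finset_cell one_pos (isBounded_cube (d := d) 1)
    refine ⟨U, hU.trans (Set.iUnion₂_mono fun u _ x hx i => ?_)⟩
    have := hx i
    constructor <;> linarith
  set C := ∫⁻ ω, expPlus (ENNReal.ofReal (2 * α) * (m ^ d : ℕ) * Λ ω (cube d 1)) ∂P with hC
  have hC1 : 1 ≤ C := by
    calc (1 : ℝ≥0∞) = ∫⁻ _ω, 1 ∂P := by simp
      _ ≤ C := lintegral_mono fun ω => one_le_expPlus _
  have hCtop : C ≠ ∞ := by
    have hm0 : (0 : ℝ) < m := by have := b.2; linarith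
    have h := hexp (2 * α * (m ^ d : ℕ)) (by push_cast; positivity)
    rw [ENNReal.ofReal_mul (by linarith), ENNReal.ofReal_natCast] at h
    exact h.ne
  set c := Real.log C.toReal with hc
  have hC1' : 1 ≤ C.toReal := by
    rw [← ENNReal.toReal_one]; exact (ENNReal.toReal_le_toReal ENNReal.one_ne_top hCtop).2 hC1
  have hc0 : 0 ≤ c := Real.log_nonneg hC1'
  have hCc : C = ENNReal.ofReal (Real.exp c) := by
    rw [hc, Real.exp_log (by linarith), ENNReal.ofReal_toReal hCtop]
  -- choice of the mesh
  have hmesh : ∀ᶠ n : ℕ in atTop, 2 * β < n ∧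
      voidCost P Λ lam (n - 2 * β) ≤ (I + ε) * n ^ d ∧
      ((n ^ d - (n - 2 * β) ^ d : ℕ) : ℝ) * (2 * v * c) ≤ (n : ℝ) ^ d := by
    have h1 : ∀ᶠ R : ℝ in atTop, voidCost P Λ lam R / R ^ d < I + ε :=
      hI.eventually (gt_mem_nhds (by linarith))
    have h2 : Tendsto (fun n : ℕ => (n : ℝ) - 2 * β) atTop atTop :=
      tendsto_atTop_add_const_right atTop _ tendsto_natCast_atTop_atTop
    have h3 := (tendsto_corridor_fraction d β).mul_const (2 * v * c)
    rw [zero_mul] at h3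
    filter_upwards [eventually_gt_atTop (2 * β), h2.eventually h1,
      h3.eventually (gt_mem_nhds one_pos)] with n hn h4 h5
    have hn' : (2 * β : ℝ) < n := by exact_mod_cast hn
    have hn0 : (0 : ℝ) < n := lt_of_le_of_lt (by positivity) hn'
    refine ⟨hn, ?_, ?_⟩
    · rw [div_lt_iff₀ (pow_pos (by linarith) d)] at h4
      refine h4.le.trans (mul_le_mul_of_nonneg_left ?_ (by linarith))
      exact pow_le_pow_left₀ (by linarith) (by linarith [(Nat.cast_nonneg β : (0 : ℝ) ≤ β)]) d
    · rw [div_mul_eq_mul_div, div_lt_one (by positivity)] at h5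
      exact h5.le
  obtain ⟨n, hn, hcost, hfrac⟩ := hmesh.exists
  have hn' : (2 * β : ℝ) < n := by exact_mod_cast hn
  have hn0 : (0 : ℝ) < n := lt_of_le_of_lt (by positivity) hn'
  have hgrow : ∀ᶠ R : ℝ in atTop, (R + n * √d) ^ d / R ^ d < 1 + ε :=
    (tendsto_add_pow_div_pow d (n * √d)).eventually (gt_mem_nhds (by linarith))
  set D : ℝ := (m ^ d : ℕ) * Real.exp (c * U.card) with hD
  have hpow : Tendsto (fun R : ℝ => R ^ d) atTop atTop := tendsto_pow_atTop (NeZero.ne d)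
  have hsmall : ∀ᶠ R : ℝ in atTop, D * Real.exp (-(R ^ d)) ≤ 1 / 2 := by
    have h := (Real.tendsto_exp_neg_atTop_nhds_zero.comp hpow).const_mul D
    rw [mul_zero] at h
    filter_upwards [h.eventually (gt_mem_nhds (by norm_num : (0 : ℝ) < 1 / 2))] with R hR
    exact hR.le
  have hhalf : ∀ᶠ R : ℝ in atTop, Real.exp (-(ε * R ^ d)) ≤ 1 / 2 := by
    have h := Real.tendsto_exp_neg_atTop_nhds_zero.comp (hpow.const_mul_atTop hε)
    filter_upwards [h.eventually (gt_mem_nhds (by norm_num : (0 : ℝ) < 1 / 2))] with R hR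
    exact hR.le
  filter_upwards [hgrow, hsmall, hhalf, eventually_gt_atTop 0] with R h1 h2 h3 hR
  rw [div_lt_iff₀ (by positivity)] at h1
  obtain ⟨N, hN, hmain⟩ := voidProb_pow_le hlam hΛ hmean hdep hm hβ hU hα1 hn hR.le
    (τ := δ * R ^ d) (by positivity)
  have hNR : (N : ℝ) * n ^ d ≤ v * ((1 + ε) * R ^ d) :=
    hN.trans (mul_le_mul_of_nonneg_left h1.le hv0)
  set W := ∫⁻ ω, Λ ω (cube d 1) * expNeg lam (Metric.ball 0 R) (Λ ω) ∂P with hW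
  have hWtop : W ≠ ∞ := by
    refine (lt_of_le_of_lt (lintegral_mono fun ω => ?_)
      ((hΛ.lintegral_cube_one hmean).trans_lt ENNReal.one_lt_top)).ne
    calc Λ ω (cube d 1) * expNeg lam (Metric.ball 0 R) (Λ ω) ≤ Λ ω (cube d 1) * 1 :=
          mul_le_mul_right (expMinus_le_one _) _
      _ = _ := mul_one _
  have hkey : Real.exp (-A * R ^ d) ≤ Real.exp (lam * (δ * R ^ d)) * W.toReal
      + D * Real.exp (-(A + 1) * R ^ d) := by
    have hr1 : Real.exp (-A * R ^ d) ≤ Real.exp (N * -voidCost P Λ lam (n - 2 * β)) := by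
      rw [Real.exp_le_exp]
      have : (N : ℝ) * voidCost P Λ lam (n - 2 * β) ≤ A * R ^ d := by
        calc (N : ℝ) * voidCost P Λ lam (n - 2 * β) ≤ N * ((I + ε) * n ^ d) :=
              mul_le_mul_of_nonneg_left hcost (Nat.cast_nonneg _)
          _ = (I + ε) * (N * n ^ d) := by ring
          _ ≤ (I + ε) * (v * ((1 + ε) * R ^ d)) :=
              mul_le_mul_of_nonneg_left hNR (by linarith)
          _ = A * R ^ d := by rw [hA]; ring
      linarith
    have hr2 : Real.exp (-(α * (δ * R ^ d))) * ((m ^ d : ℕ) * Real.exp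
        ((U.card + N * (n ^ d - (n - 2 * β) ^ d) : ℕ) * c)) ≤ D * Real.exp (-(A + 1) * R ^ d) := by
      -- There are at most `2 * v * R ^ d / n ^ d` cells, and the mesh was chosen so that their
      -- corridors together contribute at most `R ^ d` to the exponent.
      have hNc : ((N * (n ^ d - (n - 2 * β) ^ d) : ℕ) : ℝ) * c ≤ R ^ d := by
        have h2v : (N : ℝ) * n ^ d ≤ 2 * v * R ^ d := by
          refine hNR.trans ?_
          have := mul_nonneg hv0 (pow_nonneg hR.le d)
          nlinarith
        have hnd : 0 < (n : ℝ) ^ d := by positivity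
        set κ : ℝ := ((n ^ d - (n - 2 * β) ^ d : ℕ) : ℝ) with hκ
        have hκ0 : 0 ≤ κ := Nat.cast_nonneg _
        rw [Nat.cast_mul, ← hκ]
        have e1 : ((N : ℝ) * κ * c) * n ^ d ≤ R ^ d * n ^ d := by
          calc ((N : ℝ) * κ * c) * n ^ d = (N * n ^ d) * (κ * c) := by ring
            _ ≤ (2 * v * R ^ d) * (κ * c) := mul_le_mul_of_nonneg_right h2v (by positivity)
            _ = R ^ d * (κ * (2 * v * c)) := by ring
            _ ≤ R ^ d * n ^ d := mul_le_mul_of_nonneg_left hfrac (by positivity)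
        exact le_of_mul_le_mul_right e1 hnd
      rw [hD, Nat.cast_add, add_mul, Real.exp_add]
      have e2 : Real.exp (-(α * (δ * R ^ d)))
          * Real.exp (((N * (n ^ d - (n - 2 * β) ^ d) : ℕ) : ℝ) * c)
          ≤ Real.exp (-(A + 1) * R ^ d) := by
        rw [← Real.exp_add, Real.exp_le_exp]
        have := mul_le_mul_of_nonneg_right hαδ (pow_nonneg hR.le d)
        linarith
      calc _ = ((m ^ d : ℕ) : ℝ) * Real.exp (c * U.card) * (Real.exp (-(α * (δ * R ^ d)))
          * Real.exp (((N * (n ^ d - (n - 2 * β) ^ d) : ℕ) : ℝ) * c)) := by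
            rw [mul_comm (U.card : ℝ) c]; ring
        _ ≤ _ := mul_le_mul_of_nonneg_left e2 (by positivity)
    have hmain' : ENNReal.ofReal (Real.exp (N * -voidCost P Λ lam (n - 2 * β)))
        ≤ ENNReal.ofReal (Real.exp (lam * (δ * R ^ d)) * W.toReal
          + Real.exp (-(α * (δ * R ^ d))) * ((m ^ d : ℕ) * Real.exp
            ((U.card + N * (n ^ d - (n - 2 * β) ^ d) : ℕ) * c))) := by
      rw [ENNReal.ofReal_add (by positivity) (by positivity),
        ENNReal.ofReal_mul (Real.exp_pos _).le, ENNReal.ofReal_toReal hWtop,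
        ENNReal.ofReal_mul (Real.exp_pos _).le, ENNReal.ofReal_mul (by positivity),
        ENNReal.ofReal_natCast, Real.exp_nat_mul, Real.exp_nat_mul,
        ENNReal.ofReal_pow (Real.exp_pos _).le, ENNReal.ofReal_pow (Real.exp_pos _).le, ← hCc,
        ← voidProb_eq_ofReal_exp hlam hΛ hmean (by linarith)]
      exact hmain
    have := (ENNReal.ofReal_le_ofReal_iff (by positivity)).1 hmain'
    linarith
  rw [← ENNReal.ofReal_toReal hWtop]
  refine ENNReal.ofReal_le_ofReal ?_
  have e1 : lam * (δ * R ^ d) = ε * R ^ d := by rw [hδ]; field_simp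
  have e3 : D * Real.exp (-(A + 1) * R ^ d) ≤ 1 / 2 * Real.exp (-A * R ^ d) := by
    rw [show -(A + 1) * R ^ d = -(R ^ d) + -A * R ^ d by ring, Real.exp_add, ← mul_assoc]
    exact mul_le_mul_of_nonneg_right h2 (Real.exp_pos _).le
  have e4 : 1 / 2 * Real.exp (-A * R ^ d) ≤ Real.exp (ε * R ^ d) * W.toReal := by
    rw [e1] at hkey; linarith
  -- Of the margin `2 * ε`, one `ε` pays for the truncation factor and the other absorbs the `1 / 2`
  -- through `h3`.
  calc Real.exp (-(v * I + ε₀) * R ^ d) ≤ Real.exp (-(A + 2 * ε) * R ^ d) := by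
        rw [Real.exp_le_exp]
        have := mul_le_mul_of_nonneg_right hεv (pow_nonneg hR.le d)
        linarith
    _ = Real.exp (-(ε * R ^ d)) * (Real.exp (-(ε * R ^ d)) * Real.exp (-A * R ^ d)) := by
        rw [← Real.exp_add, ← Real.exp_add]; congr 1; ring
    _ ≤ Real.exp (-(ε * R ^ d)) * (1 / 2 * Real.exp (-A * R ^ d)) := by
        gcongr
    _ ≤ Real.exp (-(ε * R ^ d)) * (Real.exp (ε * R ^ d) * W.toReal) := by
        gcongr
    _ = W.toReal := by rw [← mul_assoc, ← Real.exp_add]; simp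

/-- Lower bound for the probability not to percolate. -/
lemma eventually_le_one_sub_percolationProbability [NeZero d] (hlam : 0 < lam)
    (hΛ : IsStationaryRandomMeasure P Λ) (hmean : ∫⁻ ω, Λ ω (unitCube d) ∂P = 1)
    (hX : IsCoxProcess P (fun ω => ENNReal.ofReal lam • Λ ω) X)
    (hdep : IsDependent P Λ b) (hexp : HasAllExpMoments P (fun ω => Λ ω (cube d 1))) {I : ℝ}
    (hI0 : 0 ≤ I) (hI : Tendsto (fun R : ℝ => voidCost P Λ lam R / R ^ d) atTop (𝓝 I)) {ε : ℝ}
    (hε : 0 < ε) :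
    ∀ᶠ r : ℝ in atTop, ENNReal.ofReal (Real.exp (-(ballVolume d * I + ε) * r ^ d))
      ≤ 1 - percolationProbability P X lam r := by
  set a := ballVolume d * I with ha
  have ha0 : 0 ≤ a := mul_nonneg ballVolume_nonneg hI0
  -- Half of `ε` is kept back to absorb the change of radius from `r` to `r + √d`.
  have h := eventually_le_lintegral_expNeg_ball hlam hΛ hmean hdep hexp hI0 hI (half_pos hε)
  have hgrow : ∀ᶠ r : ℝ in atTop, (r + √d) ^ d / r ^ d < (a + ε) / (a + ε / 2) :=
    (tendsto_add_pow_div_pow d (√d)).eventually (gt_mem_nhds (by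
      rw [lt_div_iff₀ (by positivity)]; linarith))
  filter_upwards [(tendsto_atTop_add_const_right atTop (√d) tendsto_id).eventually h, hgrow,
    eventually_gt_atTop 0] with r h1 h2 hr
  simp only [id_eq] at h1
  refine le_trans ?_ (h1.trans (lintegral_le_one_sub_percolationProbability hlam hΛ hmean hX hr))
  refine ENNReal.ofReal_le_ofReal (Real.exp_le_exp.2 ?_)
  rw [div_lt_div_iff₀ (by positivity) (by positivity)] at h2
  linarith

end IsolationLowerBound

/-! ### Simple connectedness of the star-lattice -/

section LatticeTopology

variable {d : ℕ}

/-- Two lattice points are star-adjacent if all coordinates differ by at most one. -/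
def StarAdj (x y : Fin d → ℤ) : Prop := ∀ i, |x i - y i| ≤ 1

lemma StarAdj.refl (x : Fin d → ℤ) : StarAdj x x := fun i => by simp

lemma StarAdj.symm {x y : Fin d → ℤ} (h : StarAdj x y) : StarAdj y x := fun i => by
  rw [abs_sub_comm]; exact h i

/-- The map that moves every coordinate by one towards the origin. -/
def shrink (x : Fin d → ℤ) : Fin d → ℤ := fun i => x i - (x i).sign

lemma shrink_apply_eq (x : Fin d → ℤ) (i : Fin d) :
    (0 < x i ∧ shrink x i = x i - 1) ∨ (x i = 0 ∧ shrink x i = 0) ∨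
      (x i < 0 ∧ shrink x i = x i + 1) := by
  unfold shrink
  rcases lt_trichotomy (x i) 0 with h | h | h
  · right; right; rw [Int.sign_eq_neg_one_of_neg h]; omega
  · right; left; simp [h]
  · left; rw [Int.sign_eq_one_of_pos h]; omega

lemma starAdj_shrink (x : Fin d → ℤ) : StarAdj x (shrink x) := fun i => by
  rw [abs_le]
  rcases shrink_apply_eq x i with h | h | h <;> omega

lemma StarAdj.shrink {x y : Fin d → ℤ} (h : StarAdj x y) : StarAdj (shrink x) (shrink y) :=
  fun i => by
    have h1 := abs_le.1 (h i)
    rw [abs_le]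
    rcases shrink_apply_eq x i with h2 | h2 | h2 <;> rcases shrink_apply_eq y i with h3 | h3 | h3 <;>
      omega

lemma StarAdj.iterate_shrink {x y : Fin d → ℤ} (h : StarAdj x y) (n : ℕ) :
    StarAdj (CoxPercolation.shrink^[n] x) (CoxPercolation.shrink^[n] y) := by
  induction n with
  | zero => exact h
  | succ n ih => rw [Function.iterate_succ_apply', Function.iterate_succ_apply']; exact ih.shrink

lemma natAbs_iterate_shrink (x : Fin d → ℤ) (n : ℕ) (i : Fin d) :
    (shrink^[n] x i).natAbs = (x i).natAbs - n := by
  induction n with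
  | zero => simp
  | succ n ih =>
    rw [Function.iterate_succ_apply']
    rcases shrink_apply_eq (shrink^[n] x) i with h | h | h <;> omega

/-- The number of steps after which `shrink` reaches the origin. -/
def shrinkTime (x : Fin d → ℤ) : ℕ := ∑ i, (x i).natAbs

lemma iterate_shrink_eq_zero {x : Fin d → ℤ} {n : ℕ} (h : shrinkTime x ≤ n) : shrink^[n] x = 0 := by
  funext i
  have h1 := natAbs_iterate_shrink x n i
  have h2 : (x i).natAbs ≤ shrinkTime x :=
    Finset.single_le_sum (f := fun i => (x i).natAbs) (fun _ _ => Nat.zero_le _) (Finset.mem_univ i)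
  simp only [Pi.zero_apply]
  omega

/-- A square formed by an edge and its shrinking is filled by a cone. -/
lemma exists_starAdj_cone {x y : Fin d → ℤ} (h : StarAdj x y) :
    ∃ w, StarAdj x w ∧ StarAdj y w ∧ StarAdj (shrink x) w ∧ StarAdj (shrink y) w := by
  -- The apex takes in each coordinate the value nearer to the origin. When the two values differ in
  -- modulus, the farther one shrinks onto the nearer.
  refine ⟨fun i => if (x i).natAbs ≤ (y i).natAbs then x i else y i, ?_, ?_, ?_, ?_⟩ <;> intro i <;>
    have h1 := abs_le.1 (h i) <;> simp only <;> rw [abs_le] <;> split_ifs with h4 <;>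
    rcases shrink_apply_eq x i with h2 | h2 | h2 <;> rcases shrink_apply_eq y i with h3 | h3 | h3 <;>
    omega

/-- A function on the edges of the star-lattice which is closed on triangles is a gradient. -/
lemma exists_potential {A : Type*} [AddCommGroup A] (f : (Fin d → ℤ) → (Fin d → ℤ) → A)
    (hf : ∀ x y z, StarAdj x y → StarAdj y z → StarAdj x z → f x y + f y z = f x z) :
    ∃ g : (Fin d → ℤ) → A, ∀ x y, StarAdj x y → f x y = g x - g y := by
  have h0 : ∀ x, f x x = 0 := fun x => by
    have := hf x x x (.refl x) (.refl x) (.refl x)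
    simpa using this
  have hs : ∀ x y, StarAdj x y → f y x = -f x y := fun x y h => by
    have := hf x y x h h.symm (.refl x)
    rw [h0] at this
    exact eq_neg_of_add_eq_zero_right this
  -- The square is cut into four triangles at the apex of the cone.
  have hsq : ∀ x y, StarAdj x y →
      f x y = f x (shrink x) - f y (shrink y) + f (shrink x) (shrink y) := by
    intro x y h
    obtain ⟨w, h1, h2, h3, h4⟩ := exists_starAdj_cone h
    rw [← hf x w y h1 h2.symm h, ← hf x w _ h1 h3.symm (starAdj_shrink x),
      ← hf y w _ h2 h4.symm (starAdj_shrink y), ← hf _ w _ h3 h4.symm h.shrink,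
      hs _ _ h2, hs _ _ h3]
    abel
  -- The potential integrates `f` along the shrinking path to the origin. The sum is eventually
  -- constant because `f 0 0 = 0`.
  let G : ℕ → (Fin d → ℤ) → A := fun n x =>
    ∑ k ∈ Finset.range n, f (shrink^[k] x) (shrink^[k + 1] x)
  have htel : ∀ n x y, StarAdj x y → f x y = G n x - G n y + f (shrink^[n] x) (shrink^[n] y) := by
    intro n x y h
    induction n with
    | zero => simp [G]
    | succ n ih =>
      rw [ih, hsq _ _ (h.iterate_shrink n)]
      simp only [G, Finset.sum_range_succ, Function.iterate_succ_apply']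
      abel
  have hstab : ∀ n x, shrinkTime x ≤ n → G n x = G (shrinkTime x) x := by
    intro n x hn
    induction n, hn using Nat.le_induction with
    | base => rfl
    | succ n hn ih =>
      simp only [G] at ih ⊢
      rw [Finset.sum_range_succ, ih, iterate_shrink_eq_zero hn,
        iterate_shrink_eq_zero (hn.trans n.le_succ), h0, add_zero]
  refine ⟨fun x => G (shrinkTime x) x, fun x y h => ?_⟩
  have := htel (max (shrinkTime x) (shrinkTime y)) x y h
  rw [iterate_shrink_eq_zero (le_max_left _ _), iterate_shrink_eq_zero (le_max_right _ _), h0,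
    add_zero, hstab _ x (le_max_left _ _), hstab _ y (le_max_right _ _)] at this
  exact this

/-- Star-adjacency within a set. -/
def StepIn (S : Set (Fin d → ℤ)) (x y : Fin d → ℤ) : Prop := x ∈ S ∧ y ∈ S ∧ StarAdj x y

/-- A set of lattice points is star-connected. -/
def StarConnected (S : Set (Fin d → ℤ)) : Prop :=
  ∀ x ∈ S, ∀ y ∈ S, Relation.ReflTransGen (StepIn S) x y

lemma StepIn.symm {S : Set (Fin d → ℤ)} {x y : Fin d → ℤ} (h : StepIn S x y) : StepIn S y x :=
  ⟨h.2.1, h.1, h.2.2.symm⟩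

lemma reflTransGen_stepIn_symm {S : Set (Fin d → ℤ)} {x y : Fin d → ℤ}
    (h : Relation.ReflTransGen (StepIn S) x y) : Relation.ReflTransGen (StepIn S) y x := by
  induction h with
  | refl => exact .refl
  | tail _ hbc ih => exact Relation.ReflTransGen.head hbc.symm ih

lemma eq_of_reflTransGen_stepIn {A : Type*} {S : Set (Fin d → ℤ)} {g : (Fin d → ℤ) → A}
    (hg : ∀ x y, StepIn S x y → g x = g y) {x y : Fin d → ℤ}
    (h : Relation.ReflTransGen (StepIn S) x y) : g x = g y := by
  induction h with
  | refl => rfl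
  | tail _ hbc ih => exact ih.trans (hg _ _ hbc)

/-- The boundary of a star-connected set towards a star-connected component of its complement is
star-connected. -/
lemma starConnected_boundary {T D : Set (Fin d → ℤ)} (hT : StarConnected T) (hD : StarConnected D)
    (hdisj : Disjoint T D) (hclosed : ∀ x ∈ D, ∀ y, y ∉ T → StarAdj x y → y ∈ D) :
    StarConnected {y | y ∈ D ∧ ∃ t ∈ T, StarAdj t y} := by
  classical
  set B : Set (Fin d → ℤ) := {y | y ∈ D ∧ ∃ t ∈ T, StarAdj t y} with hB
  intro y₀ hy₀ y₁ hy₁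
  -- `Z` is the component of `y₀` in the boundary. Counting the edges between `T` and `Z` modulo 2
  -- gives a closed function, whose potential will show that `Z` is the whole boundary.
  set Z : Set (Fin d → ℤ) := {y | y ∈ B ∧ Relation.ReflTransGen (StepIn B) y₀ y} with hZ
  have hZD : ∀ z ∈ Z, z ∈ D := fun z hz => hz.1.1
  have hZT : ∀ z ∈ Z, z ∉ T := fun z hz hzT => Set.disjoint_left.1 hdisj hzT (hZD z hz)
  have hthird : ∀ t ∈ T, ∀ z ∈ Z, ∀ c, StarAdj t c → StarAdj z c → c ∉ T → c ∈ Z := by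
    intro t ht z hz c htc hzc hc
    have hcB : c ∈ B := ⟨hclosed z (hZD z hz) c hc hzc, t, ht, htc⟩
    exact ⟨hcB, hz.2.tail ⟨hz.1, hcB, hzc⟩⟩
  let f : (Fin d → ℤ) → (Fin d → ℤ) → ZMod 2 := fun a b =>
    if (a ∈ T ∧ b ∈ Z) ∨ (b ∈ T ∧ a ∈ Z) then 1 else 0
  let τ : (Fin d → ℤ) → ZMod 2 := fun a => if a ∈ T then 1 else 0
  have hval : ∀ a b, (a ∈ T ∨ a ∈ Z) → (b ∈ T ∨ b ∈ Z) → f a b = τ a + τ b := by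
    intro a b ha hb
    have two : (1 : ZMod 2) + 1 = 0 := by decide
    rcases ha with ha | ha <;> rcases hb with hb | hb
    · have h1 : a ∉ Z := fun h => hZT a h ha
      have h2 : b ∉ Z := fun h => hZT b h hb
      simp [f, τ, ha, hb, h1, h2, two]
    · simp [f, τ, ha, hb, hZT b hb]
    · simp [f, τ, ha, hb, hZT a ha]
    · simp [f, τ, hZT a ha, hZT b hb]
  obtain ⟨g, hg⟩ := exists_potential f (by
    intro a b c hab hbc hac
    -- If the triangle has common neighbours in both `T` and `Z`, then all its vertices lie in `T ∪
    -- Z`, where `f` is the coboundary of `τ`. Otherwise none of its edges joins `T` to `Z`.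
    by_cases h : (∃ t ∈ T, StarAdj t a ∧ StarAdj t b ∧ StarAdj t c) ∧
        ∃ z ∈ Z, StarAdj z a ∧ StarAdj z b ∧ StarAdj z c
    · obtain ⟨⟨t, ht, hta, htb, htc⟩, z, hz, hza, hzb, hzc⟩ := h
      have ha : a ∈ T ∨ a ∈ Z := or_iff_not_imp_left.2 (hthird t ht z hz a hta hza)
      have hb : b ∈ T ∨ b ∈ Z := or_iff_not_imp_left.2 (hthird t ht z hz b htb hzb)
      have hc : c ∈ T ∨ c ∈ Z := or_iff_not_imp_left.2 (hthird t ht z hz c htc hzc)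
      rw [hval a b ha hb, hval b c hb hc, hval a c ha hc, add_assoc, ← add_assoc (τ b),
        CharTwo.add_self_eq_zero, zero_add]
    · have hadj : ∀ u, (u = a ∨ u = b ∨ u = c) → StarAdj u a ∧ StarAdj u b ∧ StarAdj u c := by
        rintro u (rfl | rfl | rfl)
        · exact ⟨.refl _, hab, hac⟩
        · exact ⟨hab.symm, .refl _, hbc⟩
        · exact ⟨hac.symm, hbc.symm, .refl _⟩
      have hno : ∀ u v, (u = a ∨ u = b ∨ u = c) → (v = a ∨ v = b ∨ v = c) → f u v = 0 := by
        intro u v hu hv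
        refine if_neg ?_
        rintro (⟨h1, h2⟩ | ⟨h1, h2⟩)
        · exact h ⟨⟨u, h1, hadj u hu⟩, v, h2, hadj v hv⟩
        · exact h ⟨⟨v, h1, hadj v hv⟩, u, h2, hadj u hu⟩
      rw [hno a b (by simp) (by simp), hno b c (by simp) (by simp), hno a c (by simp) (by simp),
        add_zero])
  -- No edge inside `T` or inside `D` is counted, so `g` is constant on each of these connected
  -- sets. Hence `f` takes the same value on every edge from `T` to `D`, namely its value one at
  -- `y₀`, which places every boundary point in `Z`.
  have hgT : ∀ x y, StepIn T x y → g x = g y := by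
    intro x y h
    have := hg x y h.2.2
    have h0 : f x y = 0 := if_neg (by
      rintro (⟨-, h'⟩ | ⟨-, h'⟩)
      · exact hZT y h' h.2.1
      · exact hZT x h' h.1)
    rw [h0] at this
    exact sub_eq_zero.1 this.symm
  have hgD : ∀ x y, StepIn D x y → g x = g y := by
    intro x y h
    have := hg x y h.2.2
    have h0 : f x y = 0 := if_neg (by
      rintro (⟨h', -⟩ | ⟨h', -⟩)
      · exact Set.disjoint_left.1 hdisj h' h.1
      · exact Set.disjoint_left.1 hdisj h' h.2.1)
    rw [h0] at this
    exact sub_eq_zero.1 this.symm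
  obtain ⟨hy₀D, t₀, ht₀, hadj₀⟩ := hy₀
  obtain ⟨hy₁D, t₁, ht₁, hadj₁⟩ := hy₁
  have hy₀Z : y₀ ∈ Z := ⟨⟨hy₀D, t₀, ht₀, hadj₀⟩, .refl⟩
  have e0 : f t₀ y₀ = 1 := if_pos (Or.inl ⟨ht₀, hy₀Z⟩)
  have e1 : f t₁ y₁ = 1 := by
    rw [hg _ _ hadj₁, eq_of_reflTransGen_stepIn hgT (hT t₁ ht₁ t₀ ht₀),
      eq_of_reflTransGen_stepIn hgD (hD y₁ hy₁D y₀ hy₀D), ← hg _ _ hadj₀, e0]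
  have hmem : (t₁ ∈ T ∧ y₁ ∈ Z) ∨ (y₁ ∈ T ∧ t₁ ∈ Z) := by
    by_contra hc
    simp only [f, if_neg hc] at e1
    exact zero_ne_one e1
  rcases hmem with h | h
  · exact h.2.2
  · exact absurd hy₁D (Set.disjoint_left.1 hdisj h.1)

end LatticeTopology

/-! ### Long paths in the outer boundary -/

section OuterBoundary

variable {d : ℕ}

lemma StepIn.mono {S S' : Set (Fin d → ℤ)} (h : S ⊆ S') {x y : Fin d → ℤ} (hxy : StepIn S x y) :
    StepIn S' x y := ⟨h hxy.1, h hxy.2.1, hxy.2.2⟩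

lemma reflTransGen_stepIn_mono {S S' : Set (Fin d → ℤ)} (h : S ⊆ S') {x y : Fin d → ℤ}
    (hxy : Relation.ReflTransGen (StepIn S) x y) : Relation.ReflTransGen (StepIn S') x y :=
  Relation.ReflTransGen.mono (r := StepIn S) (fun _ _ => StepIn.mono h) x y hxy

/-- Two lattice points that agree in one coordinate are joined by a path on which this coordinate
is constant. -/
lemma reflTransGen_of_apply_eq {a b : Fin d → ℤ} {i : Fin d} (h : a i = b i) :
    Relation.ReflTransGen (StepIn {y | y i = b i}) a b := by
  have hmem : ∀ n, (b + shrink^[n] (a - b)) ∈ {y : Fin d → ℤ | y i = b i} := fun n => by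
    have h1 := natAbs_iterate_shrink (a - b) n i
    simp only [Pi.sub_apply, h, sub_self, Int.natAbs_zero, Nat.zero_sub, Int.natAbs_eq_zero] at h1
    change b i + shrink^[n] (a - b) i = b i
    rw [h1, add_zero]
  have hpath : ∀ n, Relation.ReflTransGen (StepIn {y | y i = b i}) a (b + shrink^[n] (a - b)) := by
    intro n
    induction n with
    | zero => simpa using Relation.ReflTransGen.refl
    | succ n ih =>
      refine ih.tail ⟨hmem n, hmem (n + 1), fun j => ?_⟩
      have := starAdj_shrink (shrink^[n] (a - b)) j
      rw [Function.iterate_succ_apply']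
      simpa using this
  have := hpath (shrinkTime (a - b))
  rwa [iterate_shrink_eq_zero le_rfl, add_zero] at this

/-- The complement of a lattice cube centred at the origin. -/
def outside (d N : ℕ) : Set (Fin d → ℤ) := {y | ∃ i, (N : ℤ) < |y i|}

/-- While one large coordinate is held fixed, a second one can be moved to `N + 1`. Holding that
one, all the others become free. The second coordinate is where `d ≥ 2` enters. -/
lemma starConnected_outside (hd : 2 ≤ d) (N : ℕ) : StarConnected (outside d N) := by
  have hN : (N : ℤ) < |(N + 1 : ℤ)| := by rw [abs_of_nonneg (by positivity)]; omega
  have key : ∀ x ∈ outside d N,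
      Relation.ReflTransGen (StepIn (outside d N)) x (fun _ => (N : ℤ) + 1) := by
    rintro x ⟨i, hi⟩
    have : Nontrivial (Fin d) := Fin.nontrivial_iff_two_le.2 hd
    obtain ⟨j, hj⟩ := exists_ne i
    set x' := Function.update x j ((N : ℤ) + 1) with hx'
    have hx'i : x' i = x i := Function.update_of_ne hj.symm _ _
    have hx'j : x' j = N + 1 := Function.update_self _ _ _
    refine (reflTransGen_stepIn_mono ?_ (reflTransGen_of_apply_eq (i := i) hx'i.symm)).trans
      (reflTransGen_stepIn_mono ?_ (reflTransGen_of_apply_eq (i := j) hx'j))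
    · intro y hy
      exact ⟨i, by rw [show y i = x' i from hy, hx'i]; exact hi⟩
    · intro y hy
      exact ⟨j, by rw [show y j = (N : ℤ) + 1 from hy]; exact hN⟩
  intro x hx y hy
  exact (key x hx).trans (reflTransGen_stepIn_symm (key y hy))

lemma abs_apply_sub_le_length {G : SimpleGraph (Fin d → ℤ)} (hG : ∀ x y, G.Adj x y → StarAdj x y)
    {x y : Fin d → ℤ} (w : G.Walk x y) (i : Fin d) : |x i - y i| ≤ w.length := by
  induction w with
  | nil => simp
  | @cons x v y h p ih =>
    have h1 := hG _ _ h i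
    have h2 := abs_sub_le (x i) (v i) (y i)
    rw [SimpleGraph.Walk.length_cons]
    push_cast
    linarith

/-- A star-connected set containing two points at large distance contains a long path without
repetitions starting at the first point. -/
lemma exists_injOn_path {B : Set (Fin d → ℤ)} {x y : Fin d → ℤ} (hx : x ∈ B)
    (h : Relation.ReflTransGen (StepIn B) x y) {N : ℕ} {i : Fin d} (hN : (N : ℤ) ≤ |x i - y i|) :
    ∃ p : ℕ → (Fin d → ℤ), p 0 = x ∧ (∀ k ≤ N, p k ∈ B) ∧
      (∀ k < N, StarAdj (p k) (p (k + 1))) ∧ Set.InjOn p {k | k ≤ N} := by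
  classical
  let G : SimpleGraph (Fin d → ℤ) :=
    { Adj := fun a b => a ≠ b ∧ StepIn B a b
      symm := ⟨fun _ _ h => ⟨h.1.symm, h.2.symm⟩⟩
      loopless := ⟨fun _ h => h.1 rfl⟩ }
  have hreach : G.Reachable x y := by
    clear hN
    induction h with
    | refl => exact .refl _
    | @tail b c _ hbc ih =>
      by_cases hbc' : b = c
      · exact hbc' ▸ ih
      · exact ih.trans (SimpleGraph.Adj.reachable ⟨hbc', hbc⟩)
  obtain ⟨w, hw⟩ := hreach.exists_isPath
  have hlen : N ≤ w.length := by
    have := hN.trans (abs_apply_sub_le_length (G := G) (fun _ _ h => h.2.2.2) w i)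
    exact_mod_cast this
  have hadj : ∀ k < N, G.Adj (w.getVert k) (w.getVert (k + 1)) := fun k hk =>
    w.adj_getVert_succ (hk.trans_le hlen)
  refine ⟨w.getVert, w.getVert_zero, fun k hk => ?_, fun k hk => (hadj k hk).2.2.2, ?_⟩
  · cases k with
    | zero => simpa using hx
    | succ k => exact (hadj k hk).2.2.1
  · exact hw.getVert_injOn.mono fun k hk => le_trans hk hlen

/-- The outer boundary of a finite star-connected set containing the origin contains a long path
without repetitions. -/
lemma exists_path_outer_boundary (hd : 2 ≤ d) {T : Set (Fin d → ℤ)} (hT : StarConnected T)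
    (h0 : 0 ∈ T) {N : ℕ} (hN : ∀ z ∈ T, ∀ i, |z i| ≤ N) {z : Fin d → ℤ} (hz : z ∈ T) {i : Fin d}
    (hzi : |z i| = N) :
    ∃ p : ℕ → (Fin d → ℤ), (∀ j, |p 0 j| ≤ N + 1) ∧ (∀ k ≤ N, p k ∉ T ∧ ∃ t ∈ T, StarAdj t (p k)) ∧
      (∀ k < N, StarAdj (p k) (p (k + 1))) ∧ Set.InjOn p {k | k ≤ N} := by
  have hout : outside d N ⊆ Tᶜ := fun y ⟨j, hj⟩ hy => absurd (hN y hy j) (not_le.2 hj)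
  obtain ⟨e, he, hze⟩ : ∃ e : ℤ, (e = 1 ∨ e = -1) ∧ z i = e * N := by
    rcases abs_choice (z i) with h | h
    · exact ⟨1, Or.inl rfl, by omega⟩
    · exact ⟨-1, Or.inr rfl, by omega⟩
  -- The component of the complement of `T` that contains the outside of the cube.
  set D : Set (Fin d → ℤ) :=
    {y | ∃ o ∈ outside d N, Relation.ReflTransGen (StepIn Tᶜ) o y} with hD
  have hDT : ∀ y ∈ D, y ∉ T := by
    rintro y ⟨o, ho, h⟩
    rcases Relation.ReflTransGen.cases_tail h with h | ⟨c, -, h⟩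
    · exact h ▸ hout ho
    · exact h.2.1
  have hclosed : ∀ x ∈ D, ∀ y, y ∉ T → StarAdj x y → y ∈ D := by
    rintro x hx y hy hxy
    obtain ⟨o, ho, h⟩ := id hx
    exact ⟨o, ho, h.tail ⟨hDT x hx, hy, hxy⟩⟩
  have hinD : ∀ o ∈ outside d N, ∀ y, Relation.ReflTransGen (StepIn Tᶜ) o y →
      Relation.ReflTransGen (StepIn D) o y := by
    intro o ho y h
    induction h with
    | refl => exact .refl
    | @tail b c hb hbc ih => exact ih.tail ⟨⟨o, ho, hb⟩, ⟨o, ho, hb.tail hbc⟩, hbc.2.2⟩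
  have houtD : outside d N ⊆ D := fun o ho => ⟨o, ho, .refl⟩
  have hDconn : StarConnected D := by
    rintro x ⟨o, ho, hx⟩ y ⟨o', ho', hy⟩
    exact (reflTransGen_stepIn_symm (hinD o ho x hx)).trans
      ((reflTransGen_stepIn_mono houtD (starConnected_outside hd N o ho o' ho')).trans
        (hinD o' ho' y hy))
  have hbd := starConnected_boundary hT hDconn
    (Set.disjoint_left.2 fun x hx hx' => hDT x hx' hx) hclosed
  -- the boundary point next to the extremal point
  set y₀ : Fin d → ℤ := Function.update z i (e * (N + 1)) with hy₀
  have hy₀i : y₀ i = e * (N + 1) := Function.update_self _ _ _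
  have hy₀out : y₀ ∈ outside d N := ⟨i, by
    rw [hy₀i]; rcases he with rfl | rfl <;> rw [lt_abs] <;> omega⟩
  have hadj₀ : StarAdj z y₀ := fun j => by
    rcases eq_or_ne j i with rfl | hj
    · rw [hy₀i, hze, abs_le]; rcases he with rfl | rfl <;> omega
    · rw [hy₀, Function.update_of_ne hj]; simp
  -- the boundary point on the opposite ray
  let ray : ℕ → (Fin d → ℤ) := fun k => Pi.single i (-e * k)
  have hrayi : ∀ k, ray k i = -e * k := fun k => Pi.single_eq_same _ _
  have hrayadj : ∀ k, StarAdj (ray k) (ray (k + 1)) := fun k j => by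
    rcases eq_or_ne j i with rfl | hj
    · rw [hrayi, hrayi, abs_le]; push_cast; rcases he with rfl | rfl <;> omega
    · simp [ray, Pi.single_eq_of_ne hj]
  have hrayout : ∀ k, N < k → ray k ∈ outside d N := fun k hk => ⟨i, by
    rw [hrayi]; rcases he with rfl | rfl <;> rw [lt_abs] <;> omega⟩
  -- The ray starts in `T` at the origin and finally leaves it. After the last exit its tail runs to
  -- the outside within the complement, so the exit point belongs to the outer boundary.
  have hex : ∃ k, ∀ l, k ≤ l → ray l ∉ T := ⟨N + 1, fun l hl => hout (hrayout l hl)⟩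
  classical
  obtain ⟨k, hk, hmin⟩ : ∃ k, (∀ l, k ≤ l → ray l ∉ T) ∧ ∀ m < k, ¬∀ l, m ≤ l → ray l ∉ T :=
    ⟨Nat.find hex, Nat.find_spec hex, fun m hm => Nat.find_min hex hm⟩
  have hk0 : k ≠ 0 := by
    rintro rfl
    exact hk 0 le_rfl (by simpa [ray] using h0)
  obtain ⟨m, rfl⟩ := Nat.exists_eq_succ_of_ne_zero hk0
  have hm : ray m ∈ T := by
    have h1 := hmin m (Nat.lt_succ_self m)
    push Not at h1
    obtain ⟨l, hl, hlT⟩ := h1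
    rcases hl.eq_or_lt with rfl | hl
    · exact hlT
    · exact absurd hlT (hk l hl)
  have hray : ∀ n, Relation.ReflTransGen (StepIn Tᶜ) (ray (m + 1 + n)) (ray (m + 1)) := by
    intro n
    induction n with
    | zero => exact .refl
    | succ n ih =>
      exact Relation.ReflTransGen.head
        ⟨hk _ (by omega), hk _ (by omega), (hrayadj (m + 1 + n)).symm⟩ ih
  have hy₁D : ray (m + 1) ∈ D := ⟨_, hrayout (m + 1 + N) (by omega), hray N⟩
  have hy₀B : y₀ ∈ {y | y ∈ D ∧ ∃ t ∈ T, StarAdj t y} := ⟨houtD hy₀out, z, hz, hadj₀⟩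
  -- The two boundary points have coordinates of opposite sign in direction `i`, one of modulus `N +
  -- 1`, so a path joining them has at least `N` steps.
  obtain ⟨p, hp0, hpB, hpadj, hpinj⟩ := exists_injOn_path (N := N) (i := i) hy₀B
    (hbd y₀ hy₀B (ray (m + 1)) ⟨hy₁D, ray m, hm, hrayadj m⟩) (by
      rw [hy₀i, hrayi, le_abs]; push_cast; rcases he with rfl | rfl <;> omega)
  refine ⟨p, fun j => ?_, fun k hk => ⟨hDT _ (hpB k hk).1, (hpB k hk).2⟩, hpadj, hpinj⟩
  rw [hp0]
  have h1 := abs_le.1 (hadj₀ j)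
  have h2 := abs_le.1 (hN z hz j)
  rw [abs_le]
  constructor <;> linarith

end OuterBoundary

/-! ### Enumeration of vacant families -/

section VacantFamilies

open scoped Pointwise

variable {d : ℕ}

/-- The lattice cube `{-N, …, N}^d`. -/
def latticeCube (d N : ℕ) : Finset (Fin d → ℤ) :=
  Fintype.piFinset fun _ => Finset.Icc (-(N : ℤ)) N

lemma mem_latticeCube {N : ℕ} {z : Fin d → ℤ} : z ∈ latticeCube d N ↔ ∀ i, |z i| ≤ N := by
  simp [latticeCube, abs_le]

lemma card_latticeCube (N : ℕ) : (latticeCube d N).card = (2 * N + 1) ^ d := by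
  simp only [latticeCube, Fintype.card_piFinset, Int.card_Icc, Finset.prod_const, Finset.card_univ,
    Fintype.card_fin]
  congr 1
  omega

/-- The star-neighbours of a lattice point, including the point itself. -/
def starNeighbors (y : Fin d → ℤ) : Finset (Fin d → ℤ) :=
  Fintype.piFinset fun i => Finset.Icc (y i - 1) (y i + 1)

lemma mem_starNeighbors {y z : Fin d → ℤ} : z ∈ starNeighbors y ↔ StarAdj y z := by
  simp only [starNeighbors, Fintype.mem_piFinset, Finset.mem_Icc, StarAdj, abs_le]
  refine forall_congr' fun i => ?_
  constructor <;> rintro ⟨h1, h2⟩ <;> constructor <;> linarith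

lemma card_starNeighbors (y : Fin d → ℤ) : (starNeighbors y).card = 3 ^ d := by
  simp only [starNeighbors, Fintype.card_piFinset, Int.card_Icc]
  rw [Finset.prod_congr rfl (g := fun _ => 3) fun i _ => by omega]
  simp

/-- The vertex sets of star-paths with `n` steps starting at `y`. -/
def pathSets : ℕ → (Fin d → ℤ) → Finset (Finset (Fin d → ℤ))
  | 0, y => {{y}}
  | n + 1, y => (starNeighbors y).biUnion fun y' => (pathSets n y').image (insert y)

lemma card_pathSets_le (n : ℕ) (y : Fin d → ℤ) : (pathSets n y).card ≤ (3 ^ d) ^ n := by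
  induction n generalizing y with
  | zero => simp [pathSets]
  | succ n ih =>
    rw [pathSets, pow_succ, mul_comm, ← card_starNeighbors y]
    refine Finset.card_biUnion_le_card_mul _ _ _ fun y' _ => ?_
    rw [card_starNeighbors]
    exact Finset.card_image_le.trans (ih y')

lemma image_mem_pathSets (n : ℕ) (p : ℕ → (Fin d → ℤ))
    (h : ∀ k < n, StarAdj (p k) (p (k + 1))) :
    (Finset.range (n + 1)).image p ∈ pathSets n (p 0) := by
  induction n generalizing p with
  | zero => simp [pathSets]
  | succ n ih =>
    rw [pathSets, Finset.mem_biUnion]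
    refine ⟨p 1, mem_starNeighbors.2 (h 0 (by omega)), Finset.mem_image.2
      ⟨_, ih (fun k => p (k + 1)) fun k hk => h (k + 1) (by omega), ?_⟩⟩
    rw [Finset.range_add_one' (n + 1), Finset.image_insert, Finset.map_eq_image, Finset.image_image]
    rfl

/-- The vertex sets of star-paths with `N` steps and without repetitions that start close to the
cube `{-N, …, N}^d`. -/
def contours (d N : ℕ) : Finset (Finset (Fin d → ℤ)) :=
  ((latticeCube d (N + 1)).biUnion (pathSets N)).filter fun F => F.card = N + 1

lemma card_contours_le (N : ℕ) : (contours d N).card ≤ (2 * N + 3) ^ d * (3 ^ d) ^ N := by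
  refine (Finset.card_filter_le _ _).trans ?_
  refine (Finset.card_biUnion_le_card_mul _ _ _ fun y _ => card_pathSets_le N y).trans_eq ?_
  rw [card_latticeCube]
  congr 2

lemma card_of_mem_contours {N : ℕ} {F : Finset (Fin d → ℤ)} (h : F ∈ contours d N) :
    F.card = N + 1 := (Finset.mem_filter.1 h).2

/-- The Euclidean vector of a lattice point. -/
def latticeVec (z : Fin d → ℤ) : E d := WithLp.toLp 2 fun i => (z i : ℝ)

open Classical in
/-- The lattice points `z` such that all points of the cells of `0` and of `z` have distance less
than `ρ`. -/
def discreteBall (d : ℕ) (ρ : ℝ) : Finset (Fin d → ℤ) :=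
  (latticeCube d ⌈ρ⌉₊).filter fun z => ‖latticeVec z‖ + √d < ρ

lemma mem_discreteBall {ρ : ℝ} {z : Fin d → ℤ} :
    z ∈ discreteBall d ρ ↔ ‖latticeVec z‖ + √d < ρ := by
  simp only [discreteBall, Finset.mem_filter, mem_latticeCube, and_iff_right_iff_imp]
  intro h i
  have h1 : |(z i : ℝ)| ≤ ‖latticeVec z‖ := PiLp.norm_apply_le (latticeVec z) i
  have h2 : |(z i : ℝ)| ≤ (⌈ρ⌉₊ : ℝ) := by
    have := Nat.le_ceil ρ
    have := Real.sqrt_nonneg d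
    linarith
  exact_mod_cast h2

/-- One `√d` is the margin in the definition of the discrete ball, the other the error of rounding
to a lattice point. -/
lemma volume_le_card_discreteBall [NeZero d] {ρ : ℝ} (hρ : 2 * √d ≤ ρ) :
    ballVolume d * (ρ - 2 * √d) ^ d ≤ (discreteBall d ρ).card := by
  have hsub : Metric.ball (0 : E d) (ρ - 2 * √d) ⊆ ⋃ z ∈ discreteBall d ρ, cell 1 z := by
    intro y hy
    refine Set.mem_biUnion (x := cellIndex 1 y) ?_ (mem_cell_cellIndex one_pos y)
    change cellIndex 1 y ∈ discreteBall d ρ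
    rw [mem_discreteBall]
    have h1 : dist (latticeVec (cellIndex 1 y)) y ≤ 1 * √d := by
      refine dist_le_of_mem_cell one_pos (z := cellIndex 1 y) (fun i => ?_)
        (mem_cell_cellIndex one_pos y)
      simp [latticeVec]
    have h2 := dist_triangle (latticeVec (cellIndex 1 y)) y 0
    rw [Metric.mem_ball] at hy
    rw [dist_zero_right] at h2
    linarith
  have h := volume_le_card_mul_pow _ hsub
  rw [volume_ball_eq (by linarith), ENNReal.ofReal_one, one_pow, mul_one,
    ← ENNReal.ofReal_natCast, ENNReal.ofReal_le_ofReal_iff (by positivity)] at h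
  exact h

/-- Families of sets of cells, one of which has to be vacant if the cluster of a point close to the
origin is finite: neighbourhoods of small clusters, and contours around large clusters. -/
def vacantFamily (d : ℕ) (ρ : ℝ) (M : ℕ) : ℕ → Finset (Finset (Fin d → ℤ))
  | 0 => ((latticeCube d M).powerset.filter Finset.Nonempty).image
      fun S => (S + discreteBall d ρ) \ S
  | k + 1 => contours d (M + k)

/-- Cauchy-Davenport in a torsion-free group: `|S + D| ≥ |S| + |D| - 1`. Up to one cell, no cluster
shape needs fewer vacant cells than a single occupied cell. -/
lemma card_le_card_add_sdiff {S D : Finset (Fin d → ℤ)} (hS : S.Nonempty) :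
    D.card - 1 ≤ ((S + D) \ S).card := by
  rcases D.eq_empty_or_nonempty with rfl | hD
  · simp
  · have h1 := cauchy_davenport_of_isAddTorsionFree hS hD
    have h2 := Finset.le_card_sdiff S (S + D)
    have h3 := hS.card_pos
    omega

end VacantFamilies

/-! ### Vacant cells forced by a finite cluster -/

section ClusterGeometry

open scoped Pointwise

variable {d : ℕ} {ν : Measure (E d)} {r s : ℝ}

/-- Subdividing the segment into steps shorter than `s` makes consecutive cells star-adjacent. -/
lemma reflTransGen_cellIndex_segment (hs : 0 < s) {U : Set (E d)} {p q : E d}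
    (h : segment ℝ p q ⊆ U) :
    Relation.ReflTransGen (StepIn {z | (cell s z ∩ U).Nonempty}) (cellIndex s p)
      (cellIndex s q) := by
  obtain ⟨n, hn⟩ := exists_nat_gt (dist p q / s)
  have hn0 : (0 : ℝ) < n := lt_of_le_of_lt (by positivity) hn
  rw [div_lt_iff₀ hs] at hn
  let u : ℕ → E d := fun k => AffineMap.lineMap p q ((k : ℝ) / n)
  have hu : ∀ k ≤ n, u k ∈ U := fun k hk => h (by
    rw [segment_eq_image_lineMap]
    exact ⟨_, ⟨by positivity, by rw [div_le_one hn0]; exact_mod_cast hk⟩, rfl⟩)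
  have hmem : ∀ k ≤ n, cellIndex s (u k) ∈ {z | (cell s z ∩ U).Nonempty} := fun k hk =>
    ⟨u k, mem_cell_cellIndex hs _, hu k hk⟩
  have hstep : ∀ k, StarAdj (cellIndex s (u k)) (cellIndex s (u (k + 1))) := by
    intro k i
    have hdist : dist (u k) (u (k + 1)) < s := by
      simp only [u]
      rw [dist_lineMap_lineMap, Real.dist_eq]
      push_cast
      rw [show (k : ℝ) / n - (k + 1) / n = -(1 / n) by ring, abs_neg, abs_of_pos (by positivity),
        div_mul_eq_mul_div, one_mul, div_lt_iff₀ hn0]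
      linarith
    have h1 := abs_lt.1 ((abs_apply_sub_le_dist (u k) (u (k + 1)) i).trans_lt hdist)
    have h2 := mem_cell_cellIndex hs (u k) i
    have h3 := mem_cell_cellIndex hs (u (k + 1)) i
    generalize cellIndex s (u k) i = a at *
    generalize cellIndex s (u (k + 1)) i = c at *
    have e1 : (a : ℝ) < c + 2 := by nlinarith
    have e2 : (c : ℝ) < a + 2 := by nlinarith
    have e1' : a < c + 2 := by exact_mod_cast e1
    have e2' : c < a + 2 := by exact_mod_cast e2
    rw [abs_le]
    constructor <;> omega
  have hpath : ∀ k ≤ n, Relation.ReflTransGen (StepIn {z | (cell s z ∩ U).Nonempty})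
      (cellIndex s (u 0)) (cellIndex s (u k)) := by
    intro k hk
    induction k with
    | zero => exact .refl
    | succ k ih => exact (ih (by omega)).tail ⟨hmem k (by omega), hmem _ hk, hstep k⟩
  have := hpath n le_rfl
  simpa [u, div_self hn0.ne'] using this

/-- The cells that meet the `r/2`-neighbourhood of an `r`-connected set form a star-connected
set. -/
lemma starConnected_thickening (hr : 0 < r) (hs : 0 < s) {C : Set (E d)} {x : E d}
    (hC : ∀ c ∈ C, Relation.ReflTransGen (fun a b => a ∈ C ∧ b ∈ C ∧ dist a b < r) x c) :
    StarConnected {z : Fin d → ℤ | (cell s z ∩ Metric.thickening (r / 2) C).Nonempty} := by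
  set U := Metric.thickening (r / 2) C with hU
  set T := {z : Fin d → ℤ | (cell s z ∩ U).Nonempty} with hT
  have hball : ∀ c ∈ C, Metric.ball c (r / 2) ⊆ U := fun c hc =>
    Metric.ball_subset_thickening hc _
  have hseg : ∀ c ∈ C, ∀ p ∈ Metric.ball c (r / 2), segment ℝ p c ⊆ U := fun c hc p hp =>
    ((convex_ball c (r / 2)).segment_subset hp (Metric.mem_ball_self (half_pos hr))).trans
      (hball c hc)
  have hstep : ∀ a ∈ C, ∀ c ∈ C, dist a c < r →
      Relation.ReflTransGen (StepIn T) (cellIndex s a) (cellIndex s c) := by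
    intro a ha c hc hac
    -- The balls of radius `r / 2` about two adjacent points share the midpoint, so the lattice path
    -- can pass from one ball to the other.
    have h1 : midpoint ℝ a c ∈ Metric.ball a (r / 2) := by
      rw [Metric.mem_ball, dist_midpoint_left]; norm_num; linarith
    have h2 : midpoint ℝ a c ∈ Metric.ball c (r / 2) := by
      rw [Metric.mem_ball, dist_midpoint_right]; norm_num; linarith
    exact (reflTransGen_stepIn_symm (reflTransGen_cellIndex_segment hs (hseg a ha _ h1))).trans
      (reflTransGen_cellIndex_segment hs (hseg c hc _ h2))
  have hxc : ∀ c ∈ C, Relation.ReflTransGen (StepIn T) (cellIndex s x) (cellIndex s c) := by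
    intro c hc
    have := hC c hc
    clear hc
    induction this with
    | refl => exact .refl
    | tail _ hbc ih => exact ih.trans (hstep _ hbc.1 _ hbc.2.1 hbc.2.2)
  have key : ∀ z ∈ T, Relation.ReflTransGen (StepIn T) (cellIndex s x) z := by
    rintro z ⟨p, hpz, hp⟩
    obtain ⟨c, hc, hpc⟩ := Metric.mem_thickening_iff.1 hp
    rw [mem_cell_iff hs] at hpz
    rw [← hpz]
    exact (hxc c hc).trans (reflTransGen_stepIn_symm
      (reflTransGen_cellIndex_segment hs (hseg c hc p hpc)))
  exact fun z hz w hw => (reflTransGen_stepIn_symm (key z hz)).trans (key w hw)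

/-- A point in such a boundary cell would be within `r / 2 + 2 * s * √d ≤ r` of a cluster point,
strictly, and so belong to the cluster; its cell would then meet the thickening. -/
lemma cell_vacant_of_notMem_thickening (hr : 0 < r) (hs : 0 < s) (hsr : 4 * (s * √d) ≤ r)
    {C : Set (E d)} (hC : ∀ c ∈ C, ∀ y, ν {y} ≠ 0 → dist c y < r → y ∈ C) {t y : Fin d → ℤ}
    (ht : (cell s t ∩ Metric.thickening (r / 2) C).Nonempty) (hty : StarAdj t y)
    (hy : ¬(cell s y ∩ Metric.thickening (r / 2) C).Nonempty) {q : E d} (hq : q ∈ cell s y) :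
    ν {q} = 0 := by
  by_contra hne
  obtain ⟨p, hpt, hp⟩ := ht
  obtain ⟨c, hc, hpc⟩ := Metric.mem_thickening_iff.1 hp
  have hpq : dist p q ≤ (2 * s) * √d := by
    refine dist_le_of_forall_abs_le (by positivity) fun i => ?_
    have h1 := hpt i
    have h2 := hq i
    have h3 := abs_le.1 (hty i)
    have h4 : (t i : ℝ) - y i ≤ 1 := by exact_mod_cast h3.2
    have h5 : (-1 : ℝ) ≤ t i - y i := by exact_mod_cast h3.1
    rw [abs_le]
    constructor <;> nlinarith
  have hcq : dist c q < r := by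
    have := dist_triangle_left c q p
    linarith
  exact hy ⟨q, hq, Metric.self_subset_thickening (half_pos hr) C (hC c hc q hne hcq)⟩

lemma dist_lt_of_mem_discreteBall (hs : 0 < s) {ρ : ℝ} (hρ : s * ρ = r) {z w : Fin d → ℤ}
    (hw : w ∈ discreteBall d ρ) {c y : E d} (hc : c ∈ cell s z) (hy : y ∈ cell s (z + w)) :
    dist c y < r := by
  rw [mem_discreteBall] at hw
  have h1 : dist y (c + s • latticeVec w) ≤ s * √d := by
    refine dist_le_of_forall_abs_le hs.le fun i => ?_
    have h1 := hc i
    have h2 := hy i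
    simp only [latticeVec, PiLp.add_apply, PiLp.smul_apply, smul_eq_mul, Pi.add_apply,
      Int.cast_add] at h2 ⊢
    rw [abs_le]
    constructor <;> linarith
  have h2 : dist c (c + s • latticeVec w) = s * ‖latticeVec w‖ := by
    rw [dist_self_add_right, norm_smul, Real.norm_of_nonneg hs.le]
  have h3 := dist_triangle_right c y (c + s • latticeVec w)
  nlinarith

/-- If the cluster of a point in the unit cube is finite, then all cells of some member of the
vacant families contain no points. -/
lemma exists_vacant_of_finite_cluster (hd : 2 ≤ d) {ρ : ℝ} (hρ : s * ρ = r) (hs : 0 < s)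
    (hsr : 4 * (s * √d) ≤ r) (hr : 2 * √d < r) (M : ℕ) {C : Set (E d)} (hfin : C.Finite)
    {x : E d} (hx : x ∈ cube d 1) (hxC : x ∈ C)
    (hclosed : ∀ c ∈ C, ∀ y, ν {y} ≠ 0 → dist c y < r → y ∈ C)
    (hconn : ∀ c ∈ C, Relation.ReflTransGen (fun a b => a ∈ C ∧ b ∈ C ∧ dist a b < r) x c) :
    ∃ k, ∃ F ∈ vacantFamily d ρ M k, ∀ z ∈ F, ∀ y ∈ cell s z, ν {y} = 0 := by
  classical
  have hr0 : 0 < r := lt_of_le_of_lt (by positivity) hr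
  set U := Metric.thickening (r / 2) C with hU
  have hUb : Bornology.IsBounded U := hfin.isBounded.thickening
  have hTfin := finite_setOf_cell_inter_nonempty hs hUb
  set T := {z : Fin d → ℤ | (cell s z ∩ U).Nonempty} with hT
  have hCU : C ⊆ U := Metric.self_subset_thickening (half_pos hr0) C
  -- The origin is within `√d < r / 2` of `x`.
  have h0T : 0 ∈ T := by
    refine ⟨0, fun i => by simpa using hs, Metric.mem_thickening_iff.2 ⟨x, hxC, ?_⟩⟩
    have := dist_le_of_mem_cube_one hx
    rw [dist_comm]
    linarith
  -- Small clusters are handled by the neighbourhood of their own cells, large ones by the outer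
  -- contour of the thickening.
  by_cases hM : ∀ z ∈ T, ∀ i, |z i| ≤ M
  · have hSfin := finite_setOf_cell_inter_nonempty hs hfin.isBounded
    set S : Finset (Fin d → ℤ) := hSfin.toFinset with hS
    have hmem : ∀ z, z ∈ S ↔ (cell s z ∩ C).Nonempty := fun z => by simp [hS]
    refine ⟨0, (S + discreteBall d ρ) \ S, Finset.mem_image.2 ⟨S, Finset.mem_filter.2
      ⟨Finset.mem_powerset.2 fun z hz => ?_, ?_⟩, rfl⟩, ?_⟩
    · rw [mem_latticeCube]
      obtain ⟨c, hcz, hc⟩ := (hmem z).1 hz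
      exact hM z ⟨c, hcz, hCU hc⟩
    · exact ⟨cellIndex s x, (hmem _).2 ⟨x, mem_cell_cellIndex hs x, hxC⟩⟩
    · intro u hu y hy
      rw [Finset.mem_sdiff, Finset.mem_add] at hu
      obtain ⟨⟨z, hz, w, hw, rfl⟩, hnot⟩ := hu
      by_contra hne
      obtain ⟨c, hcz, hc⟩ := (hmem z).1 hz
      exact hnot ((hmem _).2 ⟨y, hy, hclosed c hc y hne
        (dist_lt_of_mem_discreteBall hs hρ hw hcz hy)⟩)
  · have hd0 : Nonempty (Fin d) := ⟨⟨0, by omega⟩⟩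
    obtain ⟨⟨z, i⟩, hzi, hmax⟩ := Finset.exists_max_image
      (hTfin.toFinset ×ˢ (Finset.univ : Finset (Fin d))) (fun q => (q.1 q.2).natAbs)
      ⟨(0, Classical.arbitrary _), by simpa using h0T⟩
    have hz : z ∈ T := by simpa using hzi
    set N := (z i).natAbs with hN
    have hNmax : ∀ w ∈ T, ∀ j, |w j| ≤ N := fun w hw j => by
      have := hmax (w, j) (by simpa using hw)
      rw [Int.abs_eq_natAbs]
      exact_mod_cast this
    have hMN : M ≤ N := by
      by_contra hlt
      refine hM fun w hw j => (hNmax w hw j).trans ?_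
      omega
    obtain ⟨p, hp0, hpT, hpadj, hpinj⟩ := exists_path_outer_boundary hd
      (starConnected_thickening hr0 hs hconn) h0T hNmax hz
      (Int.abs_eq_natAbs (z i))
    -- Index zero is reserved for small clusters, so contours with `N` steps have index `N - M + 1`.
    refine ⟨N - M + 1, (Finset.range (N + 1)).image p, ?_, ?_⟩
    · rw [vacantFamily, Nat.add_sub_cancel' hMN, contours, Finset.mem_filter, Finset.mem_biUnion]
      refine ⟨⟨p 0, mem_latticeCube.2 (by exact_mod_cast hp0), image_mem_pathSets N p hpadj⟩, ?_⟩
      rw [Finset.card_image_of_injOn (hpinj.mono fun k hk => by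
        simpa [Nat.lt_succ_iff] using hk), Finset.card_range]
    · intro w hw y hy
      obtain ⟨k, hk, rfl⟩ := Finset.mem_image.1 hw
      obtain ⟨hnot, t, ht, hadj⟩ := hpT k (Nat.lt_succ_iff.1 (Finset.mem_range.1 hk))
      exact cell_vacant_of_notMem_thickening hr0 hs hsr hclosed ht hadj hnot hy

end ClusterGeometry

/-! ### Upper bound: the Peierls sum -/

section PercolationUpperBound

variable {Ω : Type*} [MeasurableSpace Ω] {d : ℕ} {P : Measure Ω} [IsProbabilityMeasure P]
  {Λ X : Ω → Measure (E d)} {lam : ℝ} {b : ℝ≥0}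

lemma disjoint_cube_core [NeZero d] {s β : ℝ} (hs : 0 < s) (hβ : 1 ≤ β) (z : Fin d → ℤ) :
    Disjoint (cube d 1) (core s β z) := by
  rw [Set.disjoint_left]
  intro x hx hx'
  have h := edist_cube_core hs hx hx'
  rw [edist_self, nonpos_iff_eq_zero, ENNReal.ofReal_eq_zero] at h
  linarith

/-- Union bound over the vacant families. -/
lemma one_sub_percolationProbability_le_tsum_vacantFamily [NeZero d] (hd : 2 ≤ d) (hlam : 0 < lam)
    (hΛ : IsStationaryRandomMeasure P Λ) (hmean : ∫⁻ ω, Λ ω (unitCube d) ∂P = 1)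
    (hX : IsCoxProcess P (fun ω => ENNReal.ofReal lam • Λ ω) X) (hdep : IsDependent P Λ b)
    {β : ℝ} (hβ : (b : ℝ) + 1 ≤ β) {r s ρ : ℝ} (hρ : s * ρ = r) (hs : 0 < s)
    (hsr : 4 * (s * √d) ≤ r) (hr : 2 * √d < r) (M : ℕ) :
    1 - percolationProbability P X lam r
      ≤ ∑' k, ∑ F ∈ vacantFamily d ρ M k, voidProb P Λ lam (s - 2 * β) ^ F.card := by
  have hβ1 : 1 ≤ β := by have := b.2; linarith
  let ι := Σ k : ℕ, {F // F ∈ vacantFamily d ρ M k}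
  refine (one_sub_percolationProbability_le_tsum hlam hΛ hmean hX (ι := ι)
    (fun i => ⋃ z ∈ i.2.1, core s β z)
    (fun i => Finset.measurableSet_biUnion _ fun z _ => measurableSet_core s β z)
    (fun i => (Bornology.isBounded_biUnion_finset _).2 fun z _ => isBounded_box _ _)
    (fun i => Set.disjoint_iUnion₂_right.2 fun z _ => disjoint_cube_core hs hβ1 z) ?_).trans_eq ?_
  · intro ν hν hA x hx hxν
    by_contra hnot
    obtain ⟨C, hfin, hxC, -, hclosed, hconn⟩ := exists_finite_cluster hxν hnot
    obtain ⟨k, F, hF, hvac⟩ := exists_vacant_of_finite_cluster hd hρ hs hsr hr M hfin hx hxC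
      hclosed hconn
    refine hA ⟨k, F, hF⟩ (hν.apply_eq_zero fun y hy => ?_)
    simp only [Set.mem_iUnion] at hy
    obtain ⟨z, hz, hy⟩ := hy
    exact hvac z hz y (core_subset_cell (by linarith) z hy)
  · rw [ENNReal.tsum_sigma']
    refine tsum_congr fun k => ?_
    rw [tsum_fintype, ← Finset.sum_coe_sort (vacantFamily d ρ M k)
      fun F => voidProb P Λ lam (s - 2 * β) ^ F.card]
    exact Finset.sum_congr rfl fun F _ =>
      lintegral_mul_expNeg_biUnion_core hΛ hmean hdep hs hβ F.1

lemma sum_vacantFamily_zero_le {q : ℝ≥0∞} (hq : q ≤ 1) (ρ : ℝ) (M : ℕ) :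
    ∑ F ∈ vacantFamily d ρ M 0, q ^ F.card
      ≤ (2 ^ (2 * M + 1) ^ d : ℕ) * q ^ ((discreteBall d ρ).card - 1) := by
  rw [← nsmul_eq_mul]
  refine (Finset.sum_le_card_nsmul _ _ (q ^ ((discreteBall d ρ).card - 1)) ?_).trans ?_
  · intro F hF
    obtain ⟨S, hS, rfl⟩ := Finset.mem_image.1 hF
    exact pow_le_pow_right_of_le_one' hq (card_le_card_add_sdiff (Finset.mem_filter.1 hS).2)
  · refine nsmul_le_nsmul_left zero_le ?_
    refine Finset.card_image_le.trans ((Finset.card_filter_le _ _).trans ?_)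
    rw [Finset.card_powerset, card_latticeCube]

/-- Absorbs the number of starting points into an exponential, so that contours with `N` steps
number at most `15 ^ (d * N)`. -/
lemma two_mul_add_three_le {N : ℕ} (hN : 1 ≤ N) : 2 * N + 3 ≤ 5 ^ N := by
  induction N, hN using Nat.le_induction with
  | base => norm_num
  | succ n hn ih => rw [pow_succ]; omega

lemma sum_vacantFamily_succ_le {q : ℝ≥0∞} (hq : q ≤ 1) (ρ : ℝ) {M : ℕ} (hM : 1 ≤ M) (k : ℕ) :
    ∑ F ∈ vacantFamily d ρ M (k + 1), q ^ F.card ≤ ((15 ^ d : ℕ) * q) ^ (M + k) := by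
  have h1 : ∀ F ∈ vacantFamily d ρ M (k + 1), q ^ F.card ≤ q ^ (M + k) := fun F hF => by
    rw [card_of_mem_contours hF]
    exact pow_le_pow_right_of_le_one' hq (Nat.le_succ _)
  refine (Finset.sum_le_card_nsmul _ _ _ h1).trans ?_
  rw [nsmul_eq_mul, mul_pow]
  refine mul_le_mul_left ?_ _
  have h2 : (vacantFamily d ρ M (k + 1)).card ≤ (15 ^ d) ^ (M + k) := by
    refine (card_contours_le (M + k)).trans ?_
    calc (2 * (M + k) + 3) ^ d * (3 ^ d) ^ (M + k)
        ≤ (5 ^ (M + k)) ^ d * (3 ^ d) ^ (M + k) :=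
          Nat.mul_le_mul_right _ (Nat.pow_le_pow_left (two_mul_add_three_le (by omega)) d)
      _ = (15 ^ d) ^ (M + k) := by
          rw [← pow_mul, mul_comm (M + k) d, pow_mul, ← mul_pow, ← mul_pow]
          norm_num
  exact_mod_cast h2

/-- Taking `M` at least the size of the discrete ball makes the contours no more likely than
isolation. The combinatorial prefactor depends on `d` and `M` only. -/
lemma tsum_vacantFamily_le {q : ℝ≥0∞} (hq : (15 ^ d : ℕ) * q ≤ 2⁻¹) (ρ : ℝ) {M : ℕ} (hM : 1 ≤ M)
    (hMD : (discreteBall d ρ).card ≤ M) :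
    ∑' k, ∑ F ∈ vacantFamily d ρ M k, q ^ F.card
      ≤ (2 ^ (2 * M + 1) ^ d + 2 * (15 ^ d) ^ M : ℕ) * q ^ ((discreteBall d ρ).card - 1) := by
  have hone : (1 : ℝ≥0∞) ≤ (15 ^ d : ℕ) := by exact_mod_cast Nat.one_le_pow _ _ (by norm_num)
  have hq1 : q ≤ 1 := by
    calc q = 1 * q := (one_mul q).symm
      _ ≤ (15 ^ d : ℕ) * q := mul_le_mul_left hone _
      _ ≤ 2⁻¹ := hq
      _ ≤ 1 := by simp
  rw [tsum_eq_zero_add' ENNReal.summable, Nat.cast_add, add_mul]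
  refine add_le_add (sum_vacantFamily_zero_le hq1 ρ M) ?_
  calc ∑' k, ∑ F ∈ vacantFamily d ρ M (k + 1), q ^ F.card
      ≤ ∑' k, ((15 ^ d : ℕ) * q) ^ M * 2⁻¹ ^ k := by
        refine ENNReal.tsum_le_tsum fun k => (sum_vacantFamily_succ_le hq1 ρ hM k).trans ?_
        rw [pow_add]
        exact mul_le_mul_right (pow_le_pow_left' hq k) _
    _ = ((15 ^ d : ℕ) * q) ^ M * 2 := by
        rw [ENNReal.tsum_mul_left, ENNReal.tsum_geometric, ENNReal.one_sub_inv_two, inv_inv]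
    _ = (2 * (15 ^ d) ^ M : ℕ) * q ^ M := by push_cast; rw [mul_pow]; ring
    _ ≤ _ := mul_le_mul_right (pow_le_pow_right_of_le_one' hq1 (by omega)) _

lemma tendsto_ballVolume_fraction [NeZero d] :
    Tendsto (fun ρ : ℝ => (ballVolume d * (ρ - 2 * √d) ^ d - 1) / ρ ^ d) atTop
      (𝓝 (ballVolume d)) := by
  have h1 := (tendsto_add_pow_div_pow d (-(2 * √d))).const_mul (ballVolume d)
  have h2 : Tendsto (fun ρ : ℝ => (1 : ℝ) / ρ ^ d) atTop (𝓝 0) :=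
    tendsto_const_nhds.div_atTop (tendsto_pow_atTop (NeZero.ne d))
  have h3 := h1.sub h2
  rw [mul_one, sub_zero] at h3
  refine h3.congr fun ρ => ?_
  rw [← sub_eq_add_neg]
  ring

/-- Upper bound for the probability not to percolate. -/
lemma eventually_one_sub_percolationProbability_le [NeZero d] (hd : 2 ≤ d) (hlam : 0 < lam)
    (hΛ : IsStationaryRandomMeasure P Λ) (hmean : ∫⁻ ω, Λ ω (unitCube d) ∂P = 1)
    (hX : IsCoxProcess P (fun ω => ENNReal.ofReal lam • Λ ω) X) (hdep : IsDependent P Λ b)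
    {I : ℝ} (hI0 : 0 ≤ I)
    (hI : Tendsto (fun R : ℝ => voidCost P Λ lam R / R ^ d) atTop (𝓝 I)) {ε : ℝ} (hε : 0 < ε) :
    ∀ᶠ r : ℝ in atTop, 1 - percolationProbability P X lam r
      ≤ ENNReal.ofReal (Real.exp (-(ballVolume d * I - ε) * r ^ d)) := by
  -- For `I = 0` the bound by one suffices. Otherwise the void probability of a cell tends to zero
  -- and division by `I` is possible.
  rcases hI0.eq_or_lt with rfl | hIpos
  · filter_upwards [eventually_ge_atTop 0] with r hr
    refine tsub_le_self.trans ?_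
    rw [← ENNReal.ofReal_one]
    refine ENNReal.ofReal_le_ofReal (Real.one_le_exp ?_)
    have := mul_nonneg hε.le (pow_nonneg hr d)
    linarith
  set v := ballVolume d with hv
  have hv0 : 0 ≤ v := ballVolume_nonneg
  -- choice of the ratio of the range and the mesh
  obtain ⟨ρ, hfrac, hρ4, hρ0⟩ : ∃ ρ : ℝ, v - ε / (4 * I) < (v * (ρ - 2 * √d) ^ d - 1) / ρ ^ d ∧
      4 * √d ≤ ρ ∧ 0 < ρ :=
    ((tendsto_ballVolume_fraction.eventually (lt_mem_nhds (by
      have : 0 < ε / (4 * I) := by positivity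
      linarith))).and ((eventually_ge_atTop _).and (eventually_gt_atTop 0))).exists
  set n := (discreteBall d ρ).card with hn
  set M := n + 1 with hM
  set K : ℝ := ((2 ^ (2 * M + 1) ^ d + 2 * (15 ^ d) ^ M : ℕ) : ℝ) with hK
  have hn1 : v * (ρ - 2 * √d) ^ d - 1 ≤ (n - 1 : ℕ) := by
    have h1 := volume_le_card_discreteBall (d := d) (ρ := ρ)
      (by have := Real.sqrt_nonneg d; linarith)
    have h2 : (n : ℝ) ≤ (n - 1 : ℕ) + 1 := by exact_mod_cast (by omega : n ≤ n - 1 + 1)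
    linarith
  have hnv : v - ε / (4 * I) ≤ (n - 1 : ℕ) / ρ ^ d :=
    hfrac.le.trans (div_le_div_of_nonneg_right hn1 (by positivity))
  set w : ℝ := (n - 1 : ℕ) / ρ ^ d with hw
  have hw0 : 0 ≤ w := by positivity
  set β : ℝ := b + 1 with hβ
  have hβ0 : 0 < β := by have := b.2; positivity
  -- The budget: `ε / 4` for the volume lost to discretisation, `ε / 4` for the approximation of
  -- `I`, and `ε / 2` for the prefactor `K`, which does not depend on `r`.
  obtain ⟨δ, hδ, hδI, hδw⟩ : ∃ δ : ℝ, 0 < δ ∧ δ < I ∧ δ * w ≤ ε / 4 := by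
    refine ⟨min (I / 2) (ε / (4 * (w + 1))), by positivity, ?_, ?_⟩
    · exact (min_le_left _ _).trans_lt (by linarith)
    · calc min (I / 2) (ε / (4 * (w + 1))) * w ≤ ε / (4 * (w + 1)) * (w + 1) :=
            mul_le_mul (min_le_right _ _) (by linarith) hw0 (by positivity)
        _ = ε / 4 := by field_simp
  -- the cost of an empty core
  have hcost : ∀ᶠ s : ℝ in atTop, (I - δ) * s ^ d ≤ voidCost P Λ lam (s - 2 * β) := by
    have h1 : Tendsto (fun s : ℝ => s - 2 * β) atTop atTop :=
      tendsto_atTop_add_const_right atTop _ tendsto_id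
    have h2 := (hI.comp h1).mul (tendsto_add_pow_div_pow d (-(2 * β)))
    rw [mul_one] at h2
    filter_upwards [h2.eventually (lt_mem_nhds (by linarith : I - δ < I)),
      eventually_gt_atTop (2 * β)] with s h3 h4
    have hs : 0 < s := by linarith
    have h5 : (s - 2 * β) ^ d ≠ 0 := pow_ne_zero _ (by linarith)
    rw [Function.comp_apply, ← sub_eq_add_neg, div_mul_div_comm, mul_comm ((s - 2 * β) ^ d),
      mul_div_mul_right _ _ h5, lt_div_iff₀ (by positivity)] at h3
    exact h3.le
  have hpow : Tendsto (fun r : ℝ => r ^ d) atTop atTop := tendsto_pow_atTop (NeZero.ne d)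
  have hsmall : ∀ᶠ s : ℝ in atTop, (15 ^ d : ℕ) * Real.exp (-((I - δ) * s ^ d)) ≤ 2⁻¹ := by
    have h := (Real.tendsto_exp_neg_atTop_nhds_zero.comp
      (hpow.const_mul_atTop (sub_pos.2 hδI))).const_mul ((15 ^ d : ℕ) : ℝ)
    rw [mul_zero] at h
    filter_upwards [h.eventually (gt_mem_nhds (by norm_num : (0 : ℝ) < 2⁻¹))] with s hs
    exact hs.le
  have hmesh : Tendsto (fun r : ℝ => r / ρ) atTop atTop := tendsto_id.atTop_div_const hρ0
  have hconst : ∀ᶠ r : ℝ in atTop, K ≤ Real.exp (ε / 2 * r ^ d) :=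
    (Real.tendsto_exp_atTop.comp (hpow.const_mul_atTop (half_pos hε))).eventually
      (eventually_ge_atTop K)
  filter_upwards [hmesh.eventually hcost, hmesh.eventually hsmall,
    hmesh.eventually (eventually_gt_atTop (2 * β)), hconst,
    eventually_gt_atTop (2 * √d)] with r h1 h2 h3 h4 h5
  set s := r / ρ with hs
  have hr0 : 0 < r := lt_of_le_of_lt (by positivity) h5
  have hs0 : 0 < s := by positivity
  have hsρ : s * ρ = r := div_mul_cancel₀ _ hρ0.ne'
  have hq : voidProb P Λ lam (s - 2 * β) ≤ ENNReal.ofReal (Real.exp (-((I - δ) * s ^ d))) := by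
    rw [voidProb_eq_ofReal_exp hlam hΛ hmean (by linarith)]
    exact ENNReal.ofReal_le_ofReal (Real.exp_le_exp.2 (by linarith))
  have hq2 : (15 ^ d : ℕ) * voidProb P Λ lam (s - 2 * β) ≤ 2⁻¹ := by
    refine (mul_le_mul_right hq _).trans ?_
    rw [← ENNReal.ofReal_natCast, ← ENNReal.ofReal_mul (by positivity)]
    refine (ENNReal.ofReal_le_ofReal h2).trans_eq ?_
    rw [ENNReal.ofReal_inv_of_pos (by norm_num)]
    norm_num
  have hsr : 4 * (s * √d) ≤ r := by
    rw [← hsρ]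
    nlinarith
  refine (one_sub_percolationProbability_le_tsum_vacantFamily hd hlam hΛ hmean hX hdep le_rfl
    hsρ hs0 hsr h5 M).trans ((tsum_vacantFamily_le hq2 ρ (by omega) (by omega)).trans ?_)
  refine (mul_le_mul_right (pow_le_pow_left' hq _) _).trans ?_
  rw [← ENNReal.ofReal_natCast, ← ENNReal.ofReal_pow (Real.exp_pos _).le,
    ← ENNReal.ofReal_mul (Nat.cast_nonneg _), ← Real.exp_nat_mul]
  refine ENNReal.ofReal_le_ofReal ?_
  refine (mul_le_mul_of_nonneg_right h4 (Real.exp_pos _).le).trans ?_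
  rw [← Real.exp_add, Real.exp_le_exp]
  have e1 : ((n - 1 : ℕ) : ℝ) * -((I - δ) * s ^ d) = -((I - δ) * w) * r ^ d := by
    rw [hw, hs, div_pow]; field_simp
  have e2 : v * I - ε / 2 ≤ (I - δ) * w := by
    have h6 := mul_le_mul_of_nonneg_left hnv hIpos.le
    have h7 : I * (v - ε / (4 * I)) = v * I - ε / 4 := by field_simp
    rw [h7] at h6
    linarith
  rw [e1]
  have := mul_le_mul_of_nonneg_right e2 (pow_nonneg hr0.le d)
  linarith

end PercolationUpperBound

end CoxPercolation

end

open CoxPercolation in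
theorem theorem2p3 {Ω : Type*} [MeasurableSpace Ω] (P : Measure Ω) [IsProbabilityMeasure P]
    (d : ℕ) (hd : 1 ≤ d) (Λ X : Ω → Measure (E d)) (lam : ℝ) (hlam : 0 < lam)
    (hΛ : IsStationaryRandomMeasure P Λ)
    (hmean : ∫⁻ ω, Λ ω (unitCube d) ∂P = 1)
    (hX : IsCoxProcess P (fun ω => ENNReal.ofReal lam • Λ ω) X) :
    liminf (fun r : ℝ =>
        logRate d r (palmExpectation P Λ 1 (expNeg lam (Metric.ball 0 r)))) atTop
      ≤ liminf (fun r : ℝ => logRate d r (1 - percolationProbability P X lam r)) atTop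
    ∧ (2 ≤ d → ∀ b : ℝ≥0, IsDependent P Λ b →
        HasAllExpMoments P (fun ω => Λ ω (cube d 1)) →
        ∃ I : ℝ,
          Tendsto (fun r : ℝ => logRate d r (∫⁻ ω, expNeg lam (cube d r) (Λ ω) ∂P)) atTop
            (𝓝 ((-I : ℝ) : EReal)) ∧
          Tendsto (fun r : ℝ => logRate d r (1 - percolationProbability P X lam r)) atTop
            (𝓝 ((-((volume (Metric.ball (0 : E d) 1)).toReal * I) : ℝ) : EReal))) := by
  refine ⟨liminf_logRate_palm_le hlam hΛ hmean hX, fun hd2 b hdep hexp => ?_⟩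
  have : NeZero d := ⟨by omega⟩
  obtain ⟨I, hI0, hI⟩ := exists_tendsto_voidCost hlam hΛ hmean hdep
  exact ⟨I, tendsto_logRate_voidProb hlam hΛ hmean hI, tendsto_logRate
    (fun ε hε => eventually_le_one_sub_percolationProbability hlam hΛ hmean hX hdep hexp hI0 hI hε)
    (fun ε hε => eventually_one_sub_percolationProbability_le hd2 hlam hΛ hmean hX hdep hI0 hI hε)⟩
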